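/- All groups are permutation groups on $[n]$, $n\ge 1$, acting on the assignments $\theta\colon[n]\to\{0,1\}$ by permuting variables. Boolean circuits consist of input gates (variables), AND-, OR- and NOT-gates and one output gate. A circuit $\psi$ with variables among the $n$ points is a *complete symmetry breaking circuit* for $G\le\mathrm{Sym}(n)$ if every $G$-orbit of assignments contains exactly one assignment $\tau$ with $\psi[\tau]=1$. A circuit $\psi$ with variables among the $n$ points and finitely many additional variables is a *complete symmetry breaking circuit with additional variables* for $G$ if every $G$-orbit of assignments $[n]\to\{0,1\}$ contains exactly one assignment $\tau$ for which $\psi[\tau]$ (a circuit in the additional variables) is satisfiable. Groups are given to algorithms by lists of generating permutations of length at most $q(n)$, where $q$ is any fixed polynomial. Algorithms are programs of a unit-cost random access machine with addition and subtraction, and they write circuits gate by gate. **Lemma.** There is a polynomial $p$ (depending only on the input convention $q$) such that the following holds. Let $\mathcal H$ be any class of instances $(n,S)$, each consisting of an integer $n\ge 1$ and a list $S$ of permutations generating a group $H=\langle S\rangle\le\mathrm{Sym}(n)$. Suppose that some algorithm computes, for every $(n,S)\in\mathcal H$, a complete symmetry breaking circuit for $H=\langle S\rangle$ in time at most $t(n,S)$.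 Then there is an algorithm which, given any $(n,S)\in\mathcal H$ and any list $T$ of generators of a group $G=\langle T\rangle\le\mathrm{Sym}(n)$ with $H=\langle S\rangle\le G$, computes a complete symmetry breaking circuit with additional variables for $G$ in time at most $$t(n,S)\cdot p\bigl(n\,|G:H|\bigr).$$ -/

import Mathlib

/-! ### Boolean circuits -/

/-- A gate of a Boolean circuit: an input gate labelled by a variable, or a NOT-, AND- or OR-gate
whose arguments are the values of the gates at the given positions. -/
inductive Gate (V : Type) where
  | var (v : V)
  | not (i : ℕ)
  | and (i j : ℕ)
  | or (i j : ℕ)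

/-- The gate only refers to gates at positions below `k`. -/
def Gate.RefersBelow {V : Type} (k : ℕ) : Gate V → Prop
  | .var _ => True
  | .not i => i < k
  | .and i j => i < k ∧ j < k
  | .or i j => i < k ∧ j < k

/-- The value of a gate under the assignment `θ`, where `vals` lists the values of the gates at
the earlier positions. -/
def Gate.value {V : Type} (θ : V → Bool) (vals : List Bool) : Gate V → Bool
  | .var v => θ v
  | .not i => !(vals.getD i false)
  | .and i j => vals.getD i false && vals.getD j false
  | .or i j => vals.getD i false || vals.getD j false

/-- A Boolean circuit with variables from `V`: a nonempty list of gates in topological order. The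
last gate is the output gate. -/
structure Circuit (V : Type) where
  gates : List (Gate V)
  nonempty : gates ≠ []
  wired : ∀ (k : ℕ) (hk : k < gates.length), gates[k].RefersBelow k

/-- The values of all gates, in order. -/
def Circuit.values {V : Type} (C : Circuit V) (θ : V → Bool) : List Bool :=
  C.gates.foldl (fun vals g => vals ++ [g.value θ vals]) []

/-- The value of the output gate under the complete assignment `θ`. -/
def Circuit.eval {V : Type} (C : Circuit V) (θ : V → Bool) : Bool :=
  (C.values θ).getLastD false

/-! ### Complete symmetry breaking -/

/-- The orbit of an assignment `θ` under a permutation group `G`. The element `g` sends `θ` to the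
assignment `τ` with `τ (g i) = θ i` for all `i`. -/
def assignmentOrbit {n : ℕ} (G : Subgroup (Equiv.Perm (Fin n))) (θ : Fin n → Bool) :
    Set (Fin n → Bool) :=
  {τ | ∃ g ∈ G, ∀ i, τ (g i) = θ i}

/-- `C` is a complete symmetry breaking circuit for `G`. -/
def IsCompleteSB {n : ℕ} (G : Subgroup (Equiv.Perm (Fin n))) (C : Circuit (Fin n)) : Prop :=
  ∀ θ : Fin n → Bool, ∃ τ ∈ assignmentOrbit G θ, C.eval τ = true ∧
    ∀ τ' ∈ assignmentOrbit G θ, τ' ≠ τ → C.eval τ' = false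

/-- `C`, whose variables are those in `Fin n` and additional ones in `Fin m`, is a complete
symmetry breaking circuit with additional variables for `G`. -/
def IsCompleteSBWithAdditional {n m : ℕ} (G : Subgroup (Equiv.Perm (Fin n)))
    (C : Circuit (Fin n ⊕ Fin m)) : Prop :=
  ∀ θ : Fin n → Bool, ∃ τ ∈ assignmentOrbit G θ,
    (∃ α : Fin m → Bool, C.eval (Sum.elim τ α) = true) ∧
    ∀ τ' ∈ assignmentOrbit G θ, τ' ≠ τ → ∀ α : Fin m → Bool, C.eval (Sum.elim τ' α) = false

/-! ### Random access machines -/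

/-- The memory of a random access machine: registers holding natural numbers and
(finite, growable) arrays of natural numbers. -/
structure RamState where
  reg : ℕ → ℕ
  arr : ℕ → List ℕ

def RamState.setReg (s : RamState) (x v : ℕ) : RamState :=
  { s with reg := Function.update s.reg x v }

def RamState.setArr (s : RamState) (a : ℕ) (l : List ℕ) : RamState :=
  { s with arr := Function.update s.arr a l }

/-- The elementary instructions. Registers are called `x`, `y`, `z`, and arrays `a`. -/
inductive RamInstr where
  | const (x c : ℕ)
  | add (x y z : ℕ)
  | sub (x y z : ℕ)
  | length (x a : ℕ)
  | read (x a y : ℕ)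
  | write (a y z : ℕ)
  | push (a y : ℕ)
  | pop (a : ℕ)

/-- The effect of an elementary instruction. Subtraction is truncated, reading outside of an array
yields `0`, and writing outside of an array has no effect. -/
def RamInstr.exec (s : RamState) : RamInstr → RamState
  | .const x c => s.setReg x c
  | .add x y z => s.setReg x (s.reg y + s.reg z)
  | .sub x y z => s.setReg x (s.reg y - s.reg z)
  | .length x a => s.setReg x (s.arr a).length
  | .read x a y => s.setReg x ((s.arr a).getD (s.reg y) 0)
  | .write a y z => s.setArr a ((s.arr a).set (s.reg y) (s.reg z))
  | .push a y => s.setArr a (s.arr a ++ [s.reg y])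
  | .pop a => s.setArr a (s.arr a).dropLast

/-- Programs of the random access machine. Tests ask whether a register is nonzero. -/
inductive RamProg where
  | instr (i : RamInstr)
  | seq (P Q : RamProg)
  | ite (x : ℕ) (P Q : RamProg)
  | while (x : ℕ) (P : RamProg)

/-- `P.Runs s k s'`: started in memory state `s`, the program `P` halts after exactly `k` steps in
memory state `s'`. Each elementary instruction and each test is one step. -/
inductive RamProg.Runs : RamProg → RamState → ℕ → RamState → Prop
  | instr (i : RamInstr) (s : RamState) : Runs (.instr i) s 1 (i.exec s)
  | seq {P Q : RamProg} {s s' s'' : RamState} {k l : ℕ} :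
      Runs P s k s' → Runs Q s' l s'' → Runs (.seq P Q) s (k + l) s''
  | iteTrue {x : ℕ} {P Q : RamProg} {s s' : RamState} {k : ℕ} :
      s.reg x ≠ 0 → Runs P s k s' → Runs (.ite x P Q) s (1 + k) s'
  | iteFalse {x : ℕ} {P Q : RamProg} {s s' : RamState} {k : ℕ} :
      s.reg x = 0 → Runs Q s k s' → Runs (.ite x P Q) s (1 + k) s'
  | whileDone {x : ℕ} {P : RamProg} {s : RamState} :
      s.reg x = 0 → Runs (.while x P) s 1 s
  | whileStep {x : ℕ} {P : RamProg} {s s' s'' : RamState} {k l : ℕ} :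
      s.reg x ≠ 0 → Runs P s k s' → Runs (.while x P) s' l s'' →
      Runs (.while x P) s (1 + k + l) s''

/-! ### Input and output -/

/-- The permutation group generated by a list of permutations. -/
def generatedGroup {n : ℕ} (S : List (Equiv.Perm (Fin n))) : Subgroup (Equiv.Perm (Fin n)) :=
  Subgroup.closure {σ | σ ∈ S}

/-- A list of permutations of `Fin n`, written as the concatenation of their tables of values. -/
def encodePerms {n : ℕ} (S : List (Equiv.Perm (Fin n))) : List ℕ :=
  S.flatMap fun σ => List.ofFn fun i => (σ i : ℕ)

/-- Three numbers per gate, the variables being numbered by `name`. -/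
def Gate.encode {V : Type} (name : V → ℕ) : Gate V → List ℕ
  | .var v => [0, name v, 0]
  | .not i => [1, i, 0]
  | .and i j => [2, i, j]
  | .or i j => [3, i, j]

def Circuit.encode {V : Type} (name : V → ℕ) (C : Circuit V) : List ℕ :=
  C.gates.flatMap (Gate.encode name)

/-- The variables in `Fin n` are numbered `0, ..., n - 1`, and the additional ones
`n, n + 1, ..., n + m - 1`. -/
def varName {n m : ℕ} : Fin n ⊕ Fin m → ℕ :=
  Sum.elim (fun i => (i : ℕ)) (fun j => n + j)

/-- Initial memory: register `0` holds `n`, array `0` holds the permutations in `S` and array `1`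
those in `T`; everything else is zero, respectively empty. -/
def initialState {n : ℕ} (S T : List (Equiv.Perm (Fin n))) : RamState where
  reg := Function.update (fun _ => 0) 0 n
  arr := Function.update (Function.update (fun _ => []) 0 (encodePerms S)) 1 (encodePerms T)

/-- Started on a generating list `S` of a permutation group, `A` halts after at most `t` steps
with a complete symmetry breaking circuit for this group in array `2`. -/
def ComputesSB (A : RamProg) {n : ℕ} (S : List (Equiv.Perm (Fin n))) (t : ℕ) : Prop :=
  ∃ (k : ℕ) (s : RamState) (C : Circuit (Fin n)),
    A.Runs (initialState S []) k s ∧ k ≤ t ∧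
    s.arr 2 = C.encode Fin.val ∧ IsCompleteSB (generatedGroup S) C

/-- Started on generating lists `S` and `T` of two permutation groups, `B` halts after at most `t`
steps with a complete symmetry breaking circuit with additional variables for the second one, the
group generated by `T`, in array `2`. -/
def ComputesSBWithAdditional (B : RamProg) {n : ℕ} (S T : List (Equiv.Perm (Fin n)))
    (t : ℕ) : Prop :=
  ∃ (k : ℕ) (s : RamState) (m : ℕ) (C : Circuit (Fin n ⊕ Fin m)),
    B.Runs (initialState S T) k s ∧ k ≤ t ∧
    s.arr 2 = C.encode varName ∧ IsCompleteSBWithAdditional (generatedGroup T) C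

/-! ### Straight-line code and counted loops -/

/-! Let `C` be the given circuit for `H`. Choose representatives `R` with `G` the union of the right
cosets `H r`. The `G`-orbit of `θ` is then the union of the `H`-orbits of the assignments `r θ`, and
each of these contains exactly one assignment `y_r` accepted by `C`. Read assignments as binary
numbers. The representative of the orbit is its accepted assignment with the least number;
equivalently, `θ` is chosen iff `C` accepts `θ` and `θ ≤ y_r` for every `r` (`IsMinimal`,
`exists_isMinimal`).

The additional variables guess each `y_r` together with a proof that it lies in the `H`-orbit of `r
θ`. Since `y_r` is unique, a successful guess gives the true comparison (`IsMinimal.number_le`). The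
proof is a chain of `n + 1` assignments from `r θ` to `y_r`, in which every link applies one of `n *
n` fixed elements of `H`. These are the entries of a Sims table, which holds inverse coset
representatives along the chain of point stabilizers. All entries lie in `H`, so chains never leave
the orbit. Conversely, sifting `h⁻¹` to the identity writes every `h` in `H` as a product of one
entry per row (`IsMinimal.of_chainHolds`, `IsMinimal.chainHolds`).

The table is found by sifting the generators of `H` and all products of two inverse entries, and
inserting whatever does not sift, until nothing changes. A stable table decides membership in `H`
(`simsTable_spec`). With this test, `R` is grown from the identity by right multiplication with the
generators of `G`; it never exceeds the index and finally covers `G` (`IsCosetList.length_le`,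
`IsCosetList.covers`).

Everything is carried out by explicit machine programs, with step counts proved alongside
correctness. The given program runs in renumbered memory, out of reach of the rest. Its output
cannot be longer than its running time, so `|R| + 1` copies of `C` cost at most `t` times a
polynomial (`overgroupProg_computes`). -/

@[simp]
theorem RamState.setReg_reg (s : RamState) (x v y : ℕ) :
    (s.setReg x v).reg y = if y = x then v else s.reg y := by
  simp [RamState.setReg, Function.update_apply]

@[simp]
theorem RamState.setReg_arr (s : RamState) (x v : ℕ) : (s.setReg x v).arr = s.arr := rfl

@[simp]
theorem RamState.setArr_reg (s : RamState) (a : ℕ) (l : List ℕ) : (s.setArr a l).reg = s.reg := rfl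

@[simp]
theorem RamState.setArr_arr (s : RamState) (a b : ℕ) (l : List ℕ) :
    (s.setArr a l).arr b = if b = a then l else s.arr b := by
  simp [RamState.setArr, Function.update_apply]

/-! ### Syntactic footprints of programs -/

/-- The instruction may change register `r`. -/
def RamInstr.writesReg : RamInstr → ℕ → Bool
  | .const x _, r => r == x
  | .add x _ _, r => r == x
  | .sub x _ _, r => r == x
  | .length x _, r => r == x
  | .read x _ _, r => r == x
  | .write _ _ _, _ => false
  | .push _ _, _ => false
  | .pop _, _ => false

/-- The instruction may change array `b`. -/
def RamInstr.writesArr : RamInstr → ℕ → Bool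
  | .write a _ _, b => b == a
  | .push a _, b => b == a
  | .pop a, b => b == a
  | .const _ _, _ => false
  | .add _ _ _, _ => false
  | .sub _ _ _, _ => false
  | .length _ _, _ => false
  | .read _ _ _, _ => false

/-- The program may change register `r`. -/
def RamProg.writesReg : RamProg → ℕ → Bool
  | .instr i, r => i.writesReg r
  | .seq P Q, r => P.writesReg r || Q.writesReg r
  | .ite _ P Q, r => P.writesReg r || Q.writesReg r
  | .while _ P, r => P.writesReg r

/-- The program may change array `b`. -/
def RamProg.writesArr : RamProg → ℕ → Bool
  | .instr i, b => i.writesArr b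
  | .seq P Q, b => P.writesArr b || Q.writesArr b
  | .ite _ P Q, b => P.writesArr b || Q.writesArr b
  | .while _ P, b => P.writesArr b

/-- The states agree on everything that the program cannot change. -/
structure Frame (P : RamProg) (s s' : RamState) : Prop where
  reg : ∀ x, P.writesReg x = false → s'.reg x = s.reg x
  arr : ∀ a, P.writesArr a = false → s'.arr a = s.arr a

theorem Frame.refl (P : RamProg) (s : RamState) : Frame P s s := ⟨fun _ _ => rfl, fun _ _ => rfl⟩

theorem Frame.trans {P : RamProg} {s s' s'' : RamState} (h : Frame P s s') (h' : Frame P s' s'') :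
    Frame P s s'' :=
  ⟨fun x hx => (h'.reg x hx).trans (h.reg x hx), fun a ha => (h'.arr a ha).trans (h.arr a ha)⟩

theorem RamInstr.frame (i : RamInstr) (s : RamState) : Frame (.instr i) s (i.exec s) := by
  constructor
  · intro x hx
    cases i <;>
      simp_all [RamProg.writesReg, RamInstr.writesReg, RamInstr.exec, RamState.setReg,
        RamState.setArr]
  · intro x hx
    cases i <;>
      simp_all [RamProg.writesArr, RamInstr.writesArr, RamInstr.exec, RamState.setReg,
        RamState.setArr]

/-- The footprint is syntactic and computable, so for a concrete program the fact that a given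
register or array survives is usually proved by `rfl`. -/
theorem RamProg.Runs.frame {P : RamProg} {s s' : RamState} {k : ℕ} (h : P.Runs s k s') :
    Frame P s s' := by
  induction h with
  | instr i s => exact i.frame s
  | seq _ _ h₁ h₂ =>
    constructor
    · intro x hx
      simp only [RamProg.writesReg, Bool.or_eq_false_iff] at hx
      rw [h₂.reg x hx.2, h₁.reg x hx.1]
    · intro x hx
      simp only [RamProg.writesArr, Bool.or_eq_false_iff] at hx
      rw [h₂.arr x hx.2, h₁.arr x hx.1]
  | iteTrue _ _ h =>
    constructor
    · intro x hx
      simp only [RamProg.writesReg, Bool.or_eq_false_iff] at hx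
      exact h.reg x hx.1
    · intro x hx
      simp only [RamProg.writesArr, Bool.or_eq_false_iff] at hx
      exact h.arr x hx.1
  | iteFalse _ _ h =>
    constructor
    · intro x hx
      simp only [RamProg.writesReg, Bool.or_eq_false_iff] at hx
      exact h.reg x hx.2
    · intro x hx
      simp only [RamProg.writesArr, Bool.or_eq_false_iff] at hx
      exact h.arr x hx.2
  | whileDone _ => exact Frame.refl _ _
  | whileStep _ _ _ h₁ h₂ =>
    exact ⟨fun x hx => (h₂.reg x hx).trans (h₁.reg x hx),
      fun x hx => (h₂.arr x hx).trans (h₁.arr x hx)⟩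

theorem RamProg.Runs.pos {P : RamProg} {s s' : RamState} {k : ℕ} (h : P.Runs s k s') : 0 < k := by
  induction h <;> omega

/-- A step pushes at most one number. This is how the running time of the given program bounds the
size of its circuit. -/
theorem RamProg.Runs.length_arr_le {P : RamProg} {s s' : RamState} {k : ℕ} (h : P.Runs s k s')
    (a : ℕ) : (s'.arr a).length ≤ (s.arr a).length + k := by
  induction h with
  | instr i s =>
    cases i with
    | write b y z =>
      rw [RamInstr.exec, RamState.setArr_arr]
      split_ifs with h <;> simp [h]
    | push b y =>
      rw [RamInstr.exec, RamState.setArr_arr]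
      split_ifs with h <;> simp [h]
    | pop b =>
      rw [RamInstr.exec, RamState.setArr_arr]
      split_ifs with h
      · simp [h]
        omega
      · omega
    | _ => simp [RamInstr.exec]
  | _ => omega

/-! ### Time-bounded correctness assertions -/

/-- Started in state `s`, the program halts after at most `t` steps in a state satisfying `Q`. -/
def RamProg.Ends (P : RamProg) (s : RamState) (t : ℕ) (Q : RamState → Prop) : Prop :=
  ∃ k s', P.Runs s k s' ∧ k ≤ t ∧ Q s'

namespace RamProg.Ends

variable {P P' : RamProg} {s : RamState} {t t' : ℕ} {Q R : RamState → Prop}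

/-- The frame is passed to the weakening, so postconditions need to mention only what changes; facts
on untouched memory are recovered here and in `seq`. -/
theorem mono (h : P.Ends s t R) (ht : t ≤ t') (hQ : ∀ s', Frame P s s' → R s' → Q s') :
    P.Ends s t' Q := by
  obtain ⟨k, s', hr, hk, hs⟩ := h
  exact ⟨k, s', hr, hk.trans ht, hQ s' hr.frame hs⟩

theorem seq (h : P.Ends s t R) (h' : ∀ s', Frame P s s' → R s' → P'.Ends s' t' Q) :
    (RamProg.seq P P').Ends s (t + t') Q := by
  obtain ⟨k, s', hr, hk, hs⟩ := h
  obtain ⟨k', s'', hr', hk', hs'⟩ := h' s' hr.frame hs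
  exact ⟨_, _, .seq hr hr', by omega, hs'⟩

theorem ite {x : ℕ} (h : s.reg x ≠ 0 → P.Ends s t Q) (h' : s.reg x = 0 → P'.Ends s t Q) :
    (RamProg.ite x P P').Ends s (t + 1) Q := by
  by_cases hx : s.reg x = 0
  · obtain ⟨k, s', hr, hk, hs⟩ := h' hx
    exact ⟨_, _, .iteFalse hx hr, by omega, hs⟩
  · obtain ⟨k, s', hr, hk, hs⟩ := h hx
    exact ⟨_, _, .iteTrue hx hr, by omega, hs⟩

end RamProg.Ends

/-- Straight-line code. Register `99` is scratch memory. -/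
def RamProg.block : List RamInstr → RamProg
  | [] => .instr (.const 99 0)
  | i :: l => .seq (.instr i) (block l)

/-- The effect of straight-line code. -/
def RamState.execs (s : RamState) : List RamInstr → RamState
  | [] => s.setReg 99 0
  | i :: l => (i.exec s).execs l

theorem RamProg.runs_block (l : List RamInstr) (s : RamState) :
    (block l).Runs s (l.length + 1) (s.execs l) := by
  induction l generalizing s with
  | nil => exact .instr (.const 99 0) s
  | cons i l ih =>
    have := RamProg.Runs.seq (.instr i s) (ih (i.exec s))
    rwa [show 1 + (l.length + 1) = (i :: l).length + 1 by simp; omega] at this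

theorem RamProg.Ends.block {l : List RamInstr} {s : RamState} {Q : RamState → Prop}
    (h : Q (s.execs l)) : (RamProg.block l).Ends s (l.length + 1) Q :=
  ⟨_, _, runs_block l s, le_rfl, h⟩

/-- Repeat `P` for `i = 0, 1, ...` as long as `i` is below the content of register `N`. Register
`c` is used for the comparison, and register `99` as scratch memory. -/
def RamProg.loop (i c N : ℕ) (P : RamProg) : RamProg :=
  .seq (block [.const i 0, .sub c N i])
    (.while c (.seq P (block [.const 99 1, .add i i 99, .sub c N i])))

/-- The predicate does not depend on the control registers of a loop. -/
def IgnoresRegs (i c : ℕ) (I : ℕ → RamState → Prop) : Prop :=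
  ∀ j s s', I j s → (∀ x, x ≠ i → x ≠ c → x ≠ 99 → s'.reg x = s.reg x) → s'.arr = s.arr → I j s'

/-- The control registers of a loop are different from each other and from scratch memory. -/
def LoopRegs (i c N : ℕ) : Bool := i != c && i != 99 && c != 99 && N != i && N != c && N != 99

/-- A loop whose bound may change while it is running. -/
theorem RamProg.Ends.loop_le {i c N : ℕ} {P : RamProg} {I : ℕ → RamState → Prop} {s : RamState}
    (B b : ℕ) (hreg : LoopRegs i c N = true) (hP : P.writesReg i = false)
    (hI : IgnoresRegs i c I) (h0 : I 0 s) (hB : ∀ j s, I j s → s.reg N ≤ B)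
    (hstep : ∀ j s', Frame (loop i c N P) s s' → I j s' → s'.reg i = j → j < s'.reg N →
      P.Ends s' b (I (j + 1))) :
    (loop i c N P).Ends s (B * (b + 5) + 4) (fun s' => ∃ j, I j s' ∧ s'.reg N ≤ j) := by
  simp only [LoopRegs, Bool.and_eq_true, bne_iff_ne, ne_eq] at hreg
  obtain ⟨⟨⟨⟨⟨hic, hi9⟩, hc9⟩, hNi⟩, hNc⟩, hN9⟩ := hreg
  -- Induction on a bound `d` for the remaining rounds. Register `N` may grow during the run, so
  -- termination rests on `B`. A round costs the body, one test and four control steps; the initial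
  -- block and the last test account for the final `4`.
  have key : ∀ d j s', B - j ≤ d → Frame (RamProg.loop i c N P) s s' → I j s' → s'.reg i = j →
      s'.reg c = s'.reg N - j →
      (RamProg.while c (.seq P (RamProg.block [.const 99 1, .add i i 99, .sub c N i]))).Ends s'
        (d * (b + 5) + 1) (fun s' => ∃ j, I j s' ∧ s'.reg N ≤ j) := by
    intro d
    induction d with
    | zero =>
      intro j s' hd _ hIj _ hc
      have := hB j s' hIj
      exact ⟨1, s', .whileDone (by omega), by omega, j, hIj, by omega⟩
    | succ d ih =>
      intro j s' hd hF hIj hi hc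
      by_cases hz : s'.reg c = 0
      · exact ⟨1, s', .whileDone hz, by omega, j, hIj, by omega⟩
      · have hBj := hB j s' hIj
        obtain ⟨k, u, hr, hk, hu⟩ := hstep j s' hF hIj hi (by omega)
        have hblk := runs_block [.const 99 1, .add i i 99, .sub c N i] u
        set u' := u.execs [.const 99 1, .add i i 99, .sub c N i]
        have hui : u.reg i = j := by rw [hr.frame.reg i hP, hi]
        have hI' : I (j + 1) u' := by
          refine hI _ _ _ hu ?_ ?_
          · intro x h1 h2 h3
            simp [u', RamState.execs, RamInstr.exec, *]
          · simp [u', RamState.execs, RamInstr.exec]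
        have hi' : u'.reg i = j + 1 := by
          simp [u', RamState.execs, RamInstr.exec, *]
        have hc' : u'.reg c = u'.reg N - (j + 1) := by
          simp [u', RamState.execs, RamInstr.exec, *]
        have hbody := RamProg.Runs.seq hr hblk
        have hF' : Frame (RamProg.loop i c N P) s u' := by
          refine hF.trans ⟨fun x hx => hbody.frame.reg x ?_, fun x hx => hbody.frame.arr x ?_⟩
          · simp only [RamProg.loop, RamProg.writesReg, Bool.or_eq_false_iff] at hx ⊢
            exact hx.2
          · simp only [RamProg.loop, RamProg.writesArr, Bool.or_eq_false_iff] at hx ⊢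
            exact hx.2
        obtain ⟨k', v, hr', hk', hv⟩ := ih (j + 1) u' (by omega) hF' hI' hi' hc'
        refine ⟨_, v, .whileStep hz hbody hr', ?_, hv⟩
        simp only [List.length_cons, List.length_nil]
        nlinarith
  have hinit := RamProg.Ends.block (l := [.const i 0, .sub c N i]) (s := s)
    (Q := fun s' => s' = s.execs [.const i 0, .sub c N i]) rfl
  refine (RamProg.Ends.seq hinit (t' := B * (b + 5) + 1) ?_).mono ?_ (fun _ _ h => h)
  · rintro s' hF rfl
    refine key B 0 _ (by omega) ?_ ?_ ?_ ?_
    · refine ⟨fun x hx => hF.reg x ?_, fun x hx => hF.arr x ?_⟩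
      · simp only [RamProg.loop, RamProg.writesReg, Bool.or_eq_false_iff] at hx
        exact hx.1
      · simp only [RamProg.loop, RamProg.writesArr, Bool.or_eq_false_iff] at hx
        exact hx.1
    · refine hI _ _ _ h0 ?_ ?_
      · intro x h1 h2 h3
        simp [RamState.execs, RamInstr.exec, *]
      · simp [RamState.execs, RamInstr.exec]
    · simp [RamState.execs, RamInstr.exec, *]
    · simp [RamState.execs, RamInstr.exec, *]
  · simp only [List.length_cons, List.length_nil]
    omega

/-- A loop with a fixed bound. -/
theorem RamProg.Ends.loop {i c N : ℕ} {P : RamProg} (I : ℕ → RamState → Prop) {s : RamState}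
    {B b : ℕ} (hB : s.reg N = B) (hreg : LoopRegs i c N = true) (hP : P.writesReg i = false)
    (hPN : P.writesReg N = false) (hI : IgnoresRegs i c I) (h0 : I 0 s)
    (hstep : ∀ j s', Frame (RamProg.loop i c N P) s s' → I j s' → s'.reg i = j → j < B →
      P.Ends s' b (I (j + 1))) :
    (RamProg.loop i c N P).Ends s (B * (b + 5) + 4) (I B) := by
  have hreg' := hreg
  simp only [LoopRegs, Bool.and_eq_true, bne_iff_ne, ne_eq] at hreg'
  obtain ⟨⟨⟨⟨⟨hic, hi9⟩, hc9⟩, hNi⟩, hNc⟩, hN9⟩ := hreg'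
  -- The two added clauses force the loop to stop at `j = B` exactly.
  refine (loop_le (I := fun j s => I j s ∧ j ≤ B ∧ s.reg N = B) B b hreg hP ?_ ?_ ?_ ?_).mono
    le_rfl ?_
  · rintro j s s' ⟨h1, h2, h3⟩ hr ha
    exact ⟨hI j s s' h1 hr ha, h2, by rw [hr N hNi hNc hN9, h3]⟩
  · exact ⟨h0, Nat.zero_le _, hB⟩
  · rintro j s ⟨-, -, h⟩
    exact h.le
  · rintro j s' hF ⟨h1, h2, h3⟩ hi hj
    refine (hstep j s' hF h1 hi (by omega)).mono le_rfl ?_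
    intro s'' hF' h
    exact ⟨h, by omega, by rw [hF'.reg N hPN, h3]⟩
  · rintro s' - ⟨j, ⟨h1, h2, h3⟩, h⟩
    rwa [show j = B by omega] at h1

/-! ### Running a program in a separate part of the memory -/

/-- Renumber all registers and arrays. -/
def RamInstr.shift (d : ℕ) : RamInstr → RamInstr
  | .const x c => .const (x + d) c
  | .add x y z => .add (x + d) (y + d) (z + d)
  | .sub x y z => .sub (x + d) (y + d) (z + d)
  | .length x a => .length (x + d) (a + d)
  | .read x a y => .read (x + d) (a + d) (y + d)
  | .write a y z => .write (a + d) (y + d) (z + d)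
  | .push a y => .push (a + d) (y + d)
  | .pop a => .pop (a + d)

/-- Renumber all registers and arrays. -/
def RamProg.shift (d : ℕ) : RamProg → RamProg
  | .instr i => .instr (i.shift d)
  | .seq P Q => .seq (P.shift d) (Q.shift d)
  | .ite x P Q => .ite (x + d) (P.shift d) (Q.shift d)
  | .while x P => .while (x + d) (P.shift d)

/-- The memory `u` contains a copy of the memory `s`, from register and array `d` on. -/
structure Embeds (d : ℕ) (s u : RamState) : Prop where
  reg : ∀ x, u.reg (x + d) = s.reg x
  arr : ∀ a, u.arr (a + d) = s.arr a

theorem RamInstr.embeds_shift {d : ℕ} {s u : RamState} (h : Embeds d s u) (i : RamInstr) :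
    Embeds d (i.exec s) ((i.shift d).exec u) := by
  obtain ⟨h₁, h₂⟩ := h
  cases i <;>
    refine ⟨fun x => ?_, fun a => ?_⟩ <;>
    simp [RamInstr.exec, RamInstr.shift, h₁, h₂]

/-- Programs name registers and arrays by fixed numbers only, never by computed ones, so the
renumbered program simulates the original step by step in the same time. -/
theorem RamProg.Runs.shift {d : ℕ} {P : RamProg} {s s' u : RamState} {k : ℕ}
    (h : P.Runs s k s') (hu : Embeds d s u) :
    ∃ u', (P.shift d).Runs u k u' ∧ Embeds d s' u' := by
  induction h generalizing u with
  | instr i s => exact ⟨_, .instr _ _, RamInstr.embeds_shift hu i⟩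
  | seq _ _ h₁ h₂ =>
    obtain ⟨v, hv, ev⟩ := h₁ hu
    obtain ⟨w, hw, ew⟩ := h₂ ev
    exact ⟨w, .seq hv hw, ew⟩
  | iteTrue hx _ h =>
    obtain ⟨v, hv, ev⟩ := h hu
    exact ⟨v, .iteTrue (by rwa [hu.reg]) hv, ev⟩
  | iteFalse hx _ h =>
    obtain ⟨v, hv, ev⟩ := h hu
    exact ⟨v, .iteFalse (by rwa [hu.reg]) hv, ev⟩
  | whileDone hx => exact ⟨u, .whileDone (by rwa [hu.reg]), hu⟩
  | whileStep hx _ _ h₁ h₂ =>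
    obtain ⟨v, hv, ev⟩ := h₁ hu
    obtain ⟨w, hw, ew⟩ := h₂ ev
    exact ⟨w, .whileStep (by rwa [hu.reg]) hv hw, ew⟩

theorem RamProg.writesReg_shift {d x : ℕ} (hx : x < d) (P : RamProg) :
    (P.shift d).writesReg x = false := by
  induction P with
  | instr i => cases i <;> simp [RamProg.shift, RamInstr.shift, RamProg.writesReg,
      RamInstr.writesReg] <;> omega
  | _ => simp [RamProg.shift, RamProg.writesReg, *]

theorem RamProg.writesArr_shift {d x : ℕ} (hx : x < d) (P : RamProg) :
    (P.shift d).writesArr x = false := by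
  induction P with
  | instr i => cases i <;> simp [RamProg.shift, RamInstr.shift, RamProg.writesArr,
      RamInstr.writesArr] <;> omega
  | _ => simp [RamProg.shift, RamProg.writesArr, *]

/-! ### Permutations as lists of numbers -/

section PermValues

variable {n : ℕ}

/-- The permutation as a function on numbers; it is `0` outside of its domain. -/
def permVal (σ : Equiv.Perm (Fin n)) (v : ℕ) : ℕ := if h : v < n then σ ⟨v, h⟩ else 0

theorem permVal_fin (σ : Equiv.Perm (Fin n)) (v : Fin n) : permVal σ v = σ v := by
  simp [permVal]

theorem permVal_lt (σ : Equiv.Perm (Fin n)) {v : ℕ} (hv : v < n) : permVal σ v < n := by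
  simp [permVal, hv]

theorem permVal_mul (σ τ : Equiv.Perm (Fin n)) {v : ℕ} (hv : v < n) :
    permVal (σ * τ) v = permVal σ (permVal τ v) := by
  simp [permVal, hv]

@[simp]
theorem permVal_one {v : ℕ} (hv : v < n) : permVal (1 : Equiv.Perm (Fin n)) v = v := by
  simp [permVal, hv]

theorem permVal_inv_self (σ : Equiv.Perm (Fin n)) {v : ℕ} (hv : v < n) :
    permVal σ⁻¹ (permVal σ v) = v := by
  rw [← permVal_mul _ _ hv, inv_mul_cancel, permVal_one hv]

theorem permVal_self_inv (σ : Equiv.Perm (Fin n)) {v : ℕ} (hv : v < n) :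
    permVal σ (permVal σ⁻¹ v) = v := by
  rw [← permVal_mul _ _ hv, mul_inv_cancel, permVal_one hv]

theorem permVal_injective (σ : Equiv.Perm (Fin n)) {v w : ℕ} (hv : v < n) (hw : w < n)
    (h : permVal σ v = permVal σ w) : v = w := by
  rw [← permVal_inv_self σ hv, h, permVal_inv_self σ hw]

theorem perm_ext_permVal {σ τ : Equiv.Perm (Fin n)} (h : ∀ v < n, permVal σ v = permVal τ v) :
    σ = τ := by
  ext v
  rw [← permVal_fin, ← permVal_fin, h v v.2]

theorem length_encodePerms (L : List (Equiv.Perm (Fin n))) :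
    (encodePerms L).length = L.length * n := by
  induction L with
  | nil => simp [encodePerms]
  | cons σ L ih =>
    simp only [encodePerms, List.flatMap_cons, List.length_append, List.length_ofFn,
      List.length_cons] at ih ⊢
    rw [ih]
    ring

theorem encodePerms_append (L L' : List (Equiv.Perm (Fin n))) :
    encodePerms (L ++ L') = encodePerms L ++ encodePerms L' := by
  simp [encodePerms]

theorem getD_encodePerms (L : List (Equiv.Perm (Fin n))) {k v : ℕ} (hk : k < L.length)
    (hv : v < n) : (encodePerms L).getD (k * n + v) 0 = permVal (L.getD k 1) v := by
  induction L generalizing k with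
  | nil => simp at hk
  | cons σ L ih =>
    have hc : encodePerms (σ :: L) = List.ofFn (fun i => (σ i : ℕ)) ++ encodePerms L := rfl
    cases k with
    | zero =>
      rw [hc, List.getD_append _ _ _ _ (by simpa using hv)]
      simp [permVal, hv]
    | succ k =>
      rw [hc, List.getD_append_right _ _ _ _ (by simp; nlinarith),
        List.length_ofFn, show (k + 1) * n + v - n = k * n + v by
          rw [Nat.succ_mul]; omega]
      simpa using ih (by simpa using hk)

/-- The positions are enumerated through a permutation `π` so that inverses can be written directly:
sending `v` to position `π v` produces the table of `π⁻¹`. -/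
theorem encodePerms_set {L : List (Equiv.Perm (Fin n))} {k : ℕ} (hk : k < L.length)
    (π σ : Equiv.Perm (Fin n)) {l : List ℕ} (hlen : l.length = (encodePerms L).length)
    (hin : ∀ v < n, l.getD (k * n + permVal π v) 0 = permVal σ (permVal π v))
    (hout : ∀ p, (∀ v < n, p ≠ k * n + permVal π v) → l.getD p 0 = (encodePerms L).getD p 0) :
    l = encodePerms (L.set k σ) := by
  rw [length_encodePerms] at hlen
  refine List.ext_getElem (by rw [hlen, length_encodePerms, List.length_set]) ?_
  intro p hp hp'
  rw [← List.getD_eq_getElem l 0 hp, ← List.getD_eq_getElem _ 0 hp']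
  have hn : 0 < n := by
    by_contra h
    have := Nat.mul_eq_zero.mpr (Or.inr (by omega) : L.length = 0 ∨ n = 0)
    omega
  have hv : p % n < n := Nat.mod_lt _ hn
  have hq : p / n < L.length := by
    rw [Nat.div_lt_iff_lt_mul hn]
    omega
  have hpe : p = p / n * n + p % n := by
    rw [mul_comm]; exact (Nat.div_add_mod p n).symm
  set q := p / n
  set v := p % n
  rw [hpe, getD_encodePerms _ (by simpa using hq) hv]
  by_cases h : q = k
  · have := hin (permVal π⁻¹ v) (permVal_lt _ hv)
    rw [permVal_self_inv _ hv] at this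
    rw [h, this, List.getD_eq_getElem _ _ (by simpa using hk), List.getElem_set_self]
  · rw [hout, getD_encodePerms _ hq hv]
    · congr 1
      simp only [List.getD_eq_getElem?_getD]
      rw [List.getElem?_set_ne (by omega)]
    · intro w hw he
      have hlt := permVal_lt π hw
      apply h
      have h1 : (q * n + v) / n = q := by
        rw [mul_comm, Nat.mul_add_div hn, Nat.div_eq_of_lt hv, add_zero]
      have h2 : (k * n + permVal π w) / n = k := by
        rw [mul_comm, Nat.mul_add_div hn, Nat.div_eq_of_lt hlt, add_zero]
      rw [← h1, he, h2]

theorem encodePerms_one_list {l : List ℕ} {σ : Equiv.Perm (Fin n)} (hlen : l.length = n)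
    (h : ∀ v < n, l.getD v 0 = permVal σ v) : l = encodePerms [σ] := by
  refine List.ext_getElem (by rw [hlen, length_encodePerms]; simp) ?_
  intro p hp hp'
  rw [← List.getD_eq_getElem l 0 hp, ← List.getD_eq_getElem _ 0 hp', h p (by omega)]
  simpa using (getD_encodePerms [σ] (k := 0) (by simp) (by omega : p < n)).symm

end PermValues

/-! ### Tables of coset representatives for a chain of stabilizers -/

/-- Apply `f 0`, ..., `f (k - 1)`. -/
def iterSteps {α : Type*} (f : ℕ → α → α) : ℕ → α → α
  | 0, x => x
  | k + 1, x => f k (iterSteps f k x)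

section SimsTable

variable {n : ℕ}

/-- The entry of the table `L` in row `i` for the image of `i` under `g`. -/
def tableEntry (L : List (Equiv.Perm (Fin n))) (i : ℕ) (g : Equiv.Perm (Fin n)) :
    Equiv.Perm (Fin n) :=
  L.getD (i * n + permVal g i) 1

/-- One step of sifting: multiplication by the entry in row `i`. -/
def siftStep (L : List (Equiv.Perm (Fin n))) (i : ℕ) (g : Equiv.Perm (Fin n)) :
    Equiv.Perm (Fin n) :=
  tableEntry L i g * g

/-- The entry in row `i` sends the image of `i` under `g` back to `i`. -/
def RowFits (L : List (Equiv.Perm (Fin n))) (i : ℕ) (g : Equiv.Perm (Fin n)) : Prop :=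
  permVal (tableEntry L i g) (permVal g i) = i

instance (L : List (Equiv.Perm (Fin n))) (i : ℕ) (g : Equiv.Perm (Fin n)) :
    Decidable (RowFits L i g) :=
  inferInstanceAs (Decidable (_ = _))

/-- Sift through the first `k` rows. -/
def sift (L : List (Equiv.Perm (Fin n))) (k : ℕ) (g : Equiv.Perm (Fin n)) : Equiv.Perm (Fin n) :=
  iterSteps (siftStep L) k g

/-- Insert the inverse of `g` in row `i` if there is no fitting entry. -/
def tableInsert (i : ℕ) (L : List (Equiv.Perm (Fin n))) (g : Equiv.Perm (Fin n)) :
    List (Equiv.Perm (Fin n)) :=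
  if RowFits L i g then L else L.set (i * n + permVal g i) g⁻¹

/-- Sift through the first `k` rows, filling gaps of the table. -/
def siftInsert (k : ℕ) (L : List (Equiv.Perm (Fin n))) (g : Equiv.Perm (Fin n)) :
    List (Equiv.Perm (Fin n)) × Equiv.Perm (Fin n) :=
  iterSteps (fun i x => (tableInsert i x.1 x.2, siftStep (tableInsert i x.1 x.2) i x.2)) k (L, g)

/-- Sifting succeeds in all rows. -/
def Sifts (L : List (Equiv.Perm (Fin n))) (g : Equiv.Perm (Fin n)) : Prop :=
  ∀ i < n, RowFits L i (sift L i g)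

/-- The permutation fixes all points below `i`. -/
def FixesBelow (i : ℕ) (g : Equiv.Perm (Fin n)) : Prop := ∀ v < i, v < n → permVal g v = v

theorem FixesBelow.mul {i : ℕ} {g h : Equiv.Perm (Fin n)} (hg : FixesBelow i g)
    (hh : FixesBelow i h) : FixesBelow i (g * h) := by
  intro v hv hn
  rw [permVal_mul _ _ hn, hh v hv hn, hg v hv hn]

theorem FixesBelow.inv {i : ℕ} {g : Equiv.Perm (Fin n)} (hg : FixesBelow i g) :
    FixesBelow i g⁻¹ := by
  intro v hv hn
  conv_lhs => rw [← hg v hv hn]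
  exact permVal_inv_self g hn

theorem FixesBelow.one (i : ℕ) : FixesBelow i (1 : Equiv.Perm (Fin n)) :=
  fun _ _ hn => permVal_one hn

theorem FixesBelow.mono {i j : ℕ} (hij : i ≤ j) {g : Equiv.Perm (Fin n)} (hg : FixesBelow j g) :
    FixesBelow i g :=
  fun v hv hn => hg v (by omega) hn

theorem FixesBelow.eq_one {g : Equiv.Perm (Fin n)} (hg : FixesBelow n g) : g = 1 :=
  perm_ext_permVal fun v hv => by rw [hg v hv hv, permVal_one hv]

/-! ### Tables along the stabilizer chain -/

/-- A nontrivial entry in row `i` and column `j` fixes the points below `i` and maps `j` to `i`. -/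
def IsTableEntry (i j : ℕ) (w : Equiv.Perm (Fin n)) : Prop :=
  w = 1 ∨ (FixesBelow i w ∧ permVal w j = i ∧ i ≠ j)

/-- A table with entries from `H`. -/
structure IsSimsTable (H : Subgroup (Equiv.Perm (Fin n))) (L : List (Equiv.Perm (Fin n))) :
    Prop where
  length : L.length = n * n
  mem : ∀ w ∈ L, w ∈ H
  entry : ∀ i < n, ∀ j < n, IsTableEntry i j (L.getD (i * n + j) 1)

theorem index_lt {i j : ℕ} (hi : i < n) (hj : j < n) : i * n + j < n * n := by nlinarith

variable {H : Subgroup (Equiv.Perm (Fin n))} {L : List (Equiv.Perm (Fin n))}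

theorem IsSimsTable.entry_mem (h : IsSimsTable H L) {i : ℕ} (hi : i < n) (g : Equiv.Perm (Fin n)) :
    tableEntry L i g ∈ H := by
  have hlt : i * n + permVal g i < L.length := by
    rw [h.length]; exact index_lt hi (permVal_lt g hi)
  rw [tableEntry, List.getD_eq_getElem _ _ hlt]
  exact h.mem _ (List.getElem_mem hlt)

theorem IsTableEntry.fixesBelow {i j : ℕ} {w : Equiv.Perm (Fin n)} (h : IsTableEntry i j w) :
    FixesBelow i w := by
  rcases h with rfl | h
  · exact FixesBelow.one i
  · exact h.1

/-- The diagonal entry of a row is always trivial, so a permutation fixing `i` passes row `i`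
unchanged. -/
theorem IsSimsTable.rowFits_of_fixes (h : IsSimsTable H L) {i : ℕ} (hi : i < n)
    {g : Equiv.Perm (Fin n)} (hg : permVal g i = i) : RowFits L i g ∧ siftStep L i g = g := by
  have : tableEntry L i g = 1 := by
    rw [tableEntry, hg]
    rcases h.entry i hi i hi with h | h
    · exact h
    · exact absurd rfl h.2.2
  rw [RowFits, siftStep, this, hg, permVal_one hi, one_mul]
  exact ⟨rfl, rfl⟩

theorem IsSimsTable.fixesBelow_siftStep (h : IsSimsTable H L) {i : ℕ} (hi : i < n)
    {g : Equiv.Perm (Fin n)} (hg : FixesBelow i g) (hf : RowFits L i g) :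
    FixesBelow (i + 1) (siftStep L i g) := by
  intro v hv hn
  rw [siftStep, permVal_mul _ _ hn]
  rcases Nat.lt_succ_iff_lt_or_eq.mp hv with hv | rfl
  · rw [hg v hv hn]
    exact (h.entry i hi _ (permVal_lt g hi)).fixesBelow v hv hn
  · exact hf

theorem IsSimsTable.sift_of_fixesBelow (h : IsSimsTable H L) {i : ℕ} (hi : i ≤ n)
    {g : Equiv.Perm (Fin n)} (hg : FixesBelow i g) : sift L i g = g := by
  induction i with
  | zero => rfl
  | succ i ih =>
    rw [sift, iterSteps, ← sift, ih (by omega) (hg.mono (by omega))]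
    exact (h.rowFits_of_fixes (by omega) (hg i (by omega) (by omega))).2

theorem IsSimsTable.fixesBelow_sift (h : IsSimsTable H L) {g : Equiv.Perm (Fin n)}
    (hg : Sifts L g) {i : ℕ} (hi : i ≤ n) : FixesBelow i (sift L i g) := by
  induction i with
  | zero => intro v hv; omega
  | succ i ih => exact h.fixesBelow_siftStep (by omega) (ih (by omega)) (hg i (by omega))

theorem IsSimsTable.sift_eq_one (h : IsSimsTable H L) {g : Equiv.Perm (Fin n)}
    (hg : Sifts L g) : sift L n g = 1 :=
  (h.fixesBelow_sift hg le_rfl).eq_one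

/-- Sifting only multiplies by elements of `H`. -/
theorem IsSimsTable.mem_of_sift_mem (h : IsSimsTable H L) {g : Equiv.Perm (Fin n)} {k : ℕ}
    (hk : k ≤ n) (hg : sift L k g ∈ H) : g ∈ H := by
  induction k with
  | zero => exact hg
  | succ k ih =>
    refine ih (by omega) ?_
    rw [sift, iterSteps, ← sift, siftStep] at hg
    exact (H.mul_mem_cancel_left (h.entry_mem (by omega) _)).mp hg

/-- Sifting of `g` and of `siftStep L i g` agree in the rows from `i + 1` on. -/
theorem IsSimsTable.sift_eq_sift (h : IsSimsTable H L) {i : ℕ} (hi : i < n)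
    {g : Equiv.Perm (Fin n)} (hg : FixesBelow i g) (hf : RowFits L i g) {k : ℕ} (hk : i < k) :
    sift L k g = sift L k (siftStep L i g) := by
  induction k with
  | zero => omega
  | succ k ih =>
    rcases Nat.lt_succ_iff_lt_or_eq.mp hk with hk | rfl
    · rw [sift, iterSteps, ← sift, ih hk, sift, sift, iterSteps]
    · rw [h.sift_of_fixesBelow (by omega) (h.fixesBelow_siftStep hi hg hf), sift, iterSteps,
        ← sift, h.sift_of_fixesBelow hi.le hg]

/-- Rows below `i` act trivially on both permutations, and after row `i` the two sifting processes
coincide. -/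
theorem IsSimsTable.sifts_iff (h : IsSimsTable H L) {i : ℕ} (hi : i < n)
    {g : Equiv.Perm (Fin n)} (hg : FixesBelow i g) (hf : RowFits L i g) :
    Sifts L g ↔ Sifts L (siftStep L i g) := by
  have hs := h.fixesBelow_siftStep hi hg hf
  constructor
  · intro hS k hk
    by_cases hki : i < k
    · rw [← h.sift_eq_sift hi hg hf hki]
      exact hS k hk
    · rw [h.sift_of_fixesBelow hk.le (hs.mono (by omega))]
      exact (h.rowFits_of_fixes hk (hs k (by omega) hk)).1
  · intro hS k hk
    rcases Nat.lt_trichotomy i k with hki | rfl | hki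
    · rw [h.sift_eq_sift hi hg hf hki]
      exact hS k hk
    · rwa [h.sift_of_fixesBelow hk.le hg]
    · rw [h.sift_of_fixesBelow hk.le (hg.mono (by omega))]
      exact (h.rowFits_of_fixes hk (hg k hki hk)).1

/-! ### Sifting pairs of entries suffices -/

/-- The monoid generated by the inverses of the entries in the rows from `i` on. -/
def rowMonoid (L : List (Equiv.Perm (Fin n))) (i : ℕ) : Submonoid (Equiv.Perm (Fin n)) :=
  Submonoid.closure {g | ∃ i' j, i ≤ i' ∧ i' < n ∧ j < n ∧ g = (L.getD (i' * n + j) 1)⁻¹}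

theorem rowMonoid_anti (L : List (Equiv.Perm (Fin n))) {i k : ℕ} (h : i ≤ k) :
    rowMonoid L k ≤ rowMonoid L i := by
  refine Submonoid.closure_mono ?_
  rintro g ⟨i', j, h1, h2⟩
  exact ⟨i', j, by omega, h2⟩

theorem IsSimsTable.fixesBelow_of_mem (h : IsSimsTable H L) {i : ℕ} {g : Equiv.Perm (Fin n)}
    (hg : g ∈ rowMonoid L i) : FixesBelow i g := by
  induction hg using Submonoid.closure_induction with
  | mem g hg =>
    obtain ⟨i', j, h1, h2, h3, rfl⟩ := hg
    exact ((h.entry i' h2 j h3).fixesBelow.mono h1).inv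
  | one => exact FixesBelow.one i
  | mul g g' _ _ h1 h2 => exact h1.mul h2

/-- Undoing a successful sifting factors `g` into inverse entries, one for each row from `i` on. -/
theorem IsSimsTable.mem_rowMonoid (h : IsSimsTable H L) {i : ℕ} (hi : i ≤ n)
    {g : Equiv.Perm (Fin n)} (hg : FixesBelow i g) (hS : Sifts L g) : g ∈ rowMonoid L i := by
  induction d : n - i generalizing i g with
  | zero =>
    obtain rfl : i = n := by omega
    rw [hg.eq_one]
    exact one_mem _
  | succ d ih =>
    have hi' : i < n := by omega
    have hf : RowFits L i g := by
      have := hS i hi'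
      rwa [h.sift_of_fixesBelow hi hg] at this
    have := ih (by omega : i + 1 ≤ n) (h.fixesBelow_siftStep hi' hg hf)
      ((h.sifts_iff hi' hg hf).mp hS) (by omega)
    have hmul : g = (tableEntry L i g)⁻¹ * siftStep L i g := by
      rw [siftStep, inv_mul_cancel_left]
    rw [hmul]
    refine mul_mem (Submonoid.subset_closure ?_) (rowMonoid_anti L (by omega) this)
    exact ⟨i, _, le_rfl, hi', permVal_lt g hi', rfl⟩

/-- If all products of two entries sift, then so does everything that the entries generate. -/
theorem IsSimsTable.sifts_of_mem (h : IsSimsTable H L)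
    (hpair : ∀ a ∈ L, ∀ b ∈ L, Sifts L (a⁻¹ * b⁻¹)) {i : ℕ} (hi : i ≤ n)
    {g : Equiv.Perm (Fin n)} (hg : g ∈ rowMonoid L i) : Sifts L g := by
  induction d : n - i generalizing i g with
  | zero =>
    obtain rfl : i = n := by omega
    rw [(h.fixesBelow_of_mem hg).eq_one]
    intro k hk
    rw [h.sift_of_fixesBelow hk.le (FixesBelow.one k)]
    exact (h.rowFits_of_fixes hk (permVal_one hk)).1
  | succ d ih =>
    have hi' : i < n := by omega
    have hmem : ∀ i' < n, ∀ j < n, L.getD (i' * n + j) 1 ∈ L := by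
      intro i' h1 j h2
      have hlt : i' * n + j < L.length := by rw [h.length]; exact index_lt h1 h2
      rw [List.getD_eq_getElem _ _ hlt]
      exact List.getElem_mem hlt
    -- Normal form: one inverse entry of row `i` times an element of the later rows. Another
    -- generator on the left is absorbed, because its product with the row-`i` factor sifts by
    -- hypothesis and therefore again has this form.
    have hdec : ∃ j < n, ∃ k ∈ rowMonoid L (i + 1), g = (L.getD (i * n + j) 1)⁻¹ * k := by
      induction hg using Submonoid.closure_induction_left with
      | one =>
        -- The identity uses the diagonal entry, which is trivial.
        refine ⟨i, hi', 1, one_mem _, ?_⟩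
        rcases h.entry i hi' i hi' with h | h
        · rw [h, inv_one, one_mul]
        · exact absurd rfl h.2.2
      | mul_left x hx g' hg' hih =>
        obtain ⟨i', j', h1, h2, h3, rfl⟩ := hx
        obtain ⟨j, hj, k, hk, rfl⟩ := hih
        have hS := hpair _ (hmem i' h2 j' h3) _ (hmem i hi' j hj)
        set x := (L.getD (i' * n + j') 1)⁻¹ * (L.getD (i * n + j) 1)⁻¹ with hx
        have hfix : FixesBelow i x :=
          ((h.entry i' h2 j' h3).fixesBelow.mono h1).inv.mul (h.entry i hi' j hj).fixesBelow.inv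
        have hf : RowFits L i x := by
          have := hS i hi'
          rwa [h.sift_of_fixesBelow hi hfix] at this
        have hk' := h.mem_rowMonoid (by omega : i + 1 ≤ n) (h.fixesBelow_siftStep hi' hfix hf)
          ((h.sifts_iff hi' hfix hf).mp hS)
        refine ⟨permVal x i, permVal_lt x hi', siftStep L i x * k, mul_mem hk' hk, ?_⟩
        rw [← mul_assoc, ← hx, siftStep, tableEntry, ← mul_assoc, inv_mul_cancel_left]
    obtain ⟨j, hj, k, hk, rfl⟩ := hdec
    have hkS := ih (by omega : i + 1 ≤ n) hk (by omega)
    have hkf := h.fixesBelow_of_mem hk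
    rcases h.entry i hi' j hj with hw | ⟨hw1, hw2, -⟩
    · rwa [hw, inv_one, one_mul]
    -- Since `k` fixes `i`, the product sends `i` to `j`; row `i` therefore selects `w` itself and
    -- sifting continues with `k`.
    · set w := L.getD (i * n + j) 1 with hwdef
      have hval : permVal (w⁻¹ * k) i = j := by
        rw [permVal_mul _ _ hi', hkf i (by omega) hi']
        conv_lhs => rw [← hw2]
        exact permVal_inv_self w hj
      have hent : tableEntry L i (w⁻¹ * k) = w := by rw [tableEntry, hval]
      have hf : RowFits L i (w⁻¹ * k) := by rw [RowFits, hent, hval, hw2]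
      rw [h.sifts_iff hi' (hw1.inv.mul (hkf.mono (by omega))) hf, siftStep, hent,
        mul_inv_cancel_left]
      exact hkS

/-- In a finite group the generators already generate the subgroup as a monoid, so inverses need no
separate sifting. -/
theorem IsSimsTable.sifts_of_mem_closure (h : IsSimsTable H L) {S : List (Equiv.Perm (Fin n))}
    (hpair : ∀ a ∈ L, ∀ b ∈ L, Sifts L (a⁻¹ * b⁻¹)) (hgen : ∀ s ∈ S, Sifts L s)
    {g : Equiv.Perm (Fin n)} (hg : g ∈ generatedGroup S) : Sifts L g := by
  refine h.sifts_of_mem hpair (Nat.zero_le n) ?_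
  have hsub : Submonoid.closure {σ | σ ∈ S} ≤ rowMonoid L 0 := by
    rw [Submonoid.closure_le]
    intro s hs
    exact h.mem_rowMonoid (Nat.zero_le n) (fun v hv => by omega) (hgen s hs)
  apply hsub
  rw [← Subgroup.closure_toSubmonoid_of_finite]
  exact hg

/-! ### Completing a table -/

/-- The number of nontrivial entries. -/
def tableSize (L : List (Equiv.Perm (Fin n))) : ℕ := L.countP (fun w => decide (w ≠ 1))

theorem IsSimsTable.tableSize_le (h : IsSimsTable H L) : tableSize L ≤ n * n :=
  List.countP_le_length.trans h.length.le

/-- The table `L'` is equal to `L` or has more nontrivial entries. -/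
def TableLE (L L' : List (Equiv.Perm (Fin n))) : Prop := L' = L ∨ tableSize L < tableSize L'

theorem TableLE.trans {L L' L'' : List (Equiv.Perm (Fin n))} (h : TableLE L L')
    (h' : TableLE L' L'') : TableLE L L'' := by
  rcases h with rfl | h
  · exact h'
  · rcases h' with rfl | h'
    · exact Or.inr h
    · exact Or.inr (h.trans h')

/-- Used to infer from an unchanged final table that the intermediate tables were unchanged too. -/
theorem TableLE.antisymm {L L' : List (Equiv.Perm (Fin n))} (h : TableLE L L')
    (h' : TableLE L' L) : L' = L := by
  rcases h with h | h
  · exact h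
  · rcases h' with h' | h'
    · exact h'.symm
    · omega

/-- A nontrivial entry in the relevant column would already fit. Hence an insertion always replaces
a trivial entry by a nontrivial one, and the table size strictly increases. -/
theorem IsSimsTable.tableInsert_spec (h : IsSimsTable H L) {i : ℕ} (hi : i < n)
    {g : Equiv.Perm (Fin n)} (hgH : g ∈ H) (hg : FixesBelow i g) :
    IsSimsTable H (tableInsert i L g) ∧ RowFits (tableInsert i L g) i g ∧
      TableLE L (tableInsert i L g) ∧
      (tableInsert i L g = L → RowFits L i g) := by
  by_cases hf : RowFits L i g
  · rw [tableInsert, if_pos hf]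
    exact ⟨h, hf, Or.inl rfl, fun _ => hf⟩
  · have hlt : i * n + permVal g i < L.length := by
      rw [h.length]; exact index_lt hi (permVal_lt g hi)
    have hne : permVal g i ≠ i := fun he => hf (h.rowFits_of_fixes hi he).1
    have hinv : permVal g⁻¹ (permVal g i) = i := permVal_inv_self g hi
    have hg1 : g⁻¹ ≠ 1 := by
      intro he
      rw [he, permVal_one (permVal_lt g hi)] at hinv
      exact hne hinv
    have hold : L[i * n + permVal g i] = 1 := by
      rcases h.entry i hi _ (permVal_lt g hi) with hw | hw
      · rwa [List.getD_eq_getElem _ _ hlt] at hw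
      · exact absurd hw.2.1 hf
    have hsize : tableSize L < tableSize (L.set (i * n + permVal g i) g⁻¹) := by
      rw [tableSize, tableSize, List.countP_set hlt]
      simp [hold, hg1]
    rw [tableInsert, if_neg hf]
    refine ⟨⟨?_, ?_, ?_⟩, ?_, Or.inr hsize, ?_⟩
    · rw [List.length_set, h.length]
    · intro w hw
      rcases List.mem_or_eq_of_mem_set hw with hw | rfl
      · exact h.mem w hw
      · exact H.inv_mem hgH
    · intro i' hi' j hj
      by_cases he : i' * n + j = i * n + permVal g i
      · have hgi := permVal_lt g hi
        have h1 : i' = i := by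
          rcases Nat.lt_trichotomy i' i with h | h | h
          · nlinarith
          · exact h
          · nlinarith
        subst h1
        have h2 : j = permVal g i' := by omega
        rw [he, List.getD_eq_getElem _ _ (by simpa using hlt), List.getElem_set_self, h2]
        exact Or.inr ⟨hg.inv, hinv, hne.symm⟩
      · rw [List.getD_eq_getElem?_getD, List.getElem?_set_ne (by omega),
          ← List.getD_eq_getElem?_getD]
        exact h.entry i' hi' j hj
    · rw [RowFits, tableEntry, List.getD_eq_getElem _ _ (by simpa using hlt),
        List.getElem_set_self, hinv]
    · intro he
      rw [he] at hsize
      omega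

theorem IsSimsTable.siftStep_mem (h : IsSimsTable H L) {i : ℕ} (hi : i < n)
    {g : Equiv.Perm (Fin n)} (hg : g ∈ H) : siftStep L i g ∈ H :=
  H.mul_mem (h.entry_mem hi g) hg

/-- The last clause is what makes a stable table useful: if filling changed nothing, the process was
plain sifting and every row fitted. -/
theorem IsSimsTable.siftInsert_spec (h : IsSimsTable H L) {g : Equiv.Perm (Fin n)} (hg : g ∈ H)
    {k : ℕ} (hk : k ≤ n) :
    IsSimsTable H (siftInsert k L g).1 ∧ (siftInsert k L g).2 ∈ H ∧
      FixesBelow k (siftInsert k L g).2 ∧ TableLE L (siftInsert k L g).1 ∧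
      ((siftInsert k L g).1 = L → (siftInsert k L g).2 = sift L k g ∧
        ∀ i < k, RowFits L i (sift L i g)) := by
  induction k with
  | zero => exact ⟨h, hg, fun v hv => by omega, Or.inl rfl, fun _ => ⟨rfl, fun i hi => by omega⟩⟩
  | succ k ih =>
    obtain ⟨h1, h2, h3, h4, h5⟩ := ih (by omega)
    have hS : siftInsert (k + 1) L g =
      (tableInsert k (siftInsert k L g).1 (siftInsert k L g).2,
        siftStep (tableInsert k (siftInsert k L g).1 (siftInsert k L g).2) k
          (siftInsert k L g).2) := rfl
    rw [hS]
    set L' := (siftInsert k L g).1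
    set g' := (siftInsert k L g).2
    obtain ⟨i1, i2, i3, i4⟩ := h1.tableInsert_spec (by omega : k < n) h2 h3
    refine ⟨i1, i1.siftStep_mem (by omega) h2, i1.fixesBelow_siftStep (by omega) h3 i2,
      h4.trans i3, ?_⟩
    intro he
    dsimp only at he ⊢
    have hL : L' = L := TableLE.antisymm h4 (he ▸ i3)
    obtain ⟨j1, j2⟩ := h5 hL
    have hfit := i4 (he.trans hL.symm)
    rw [hL, j1] at hfit
    refine ⟨?_, ?_⟩
    · rw [he, j1]
      rfl
    · intro i hi
      rcases Nat.lt_succ_iff_lt_or_eq.mp hi with hi | rfl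
      · exact j2 i hi
      · exact hfit

/-- The product of two entries, to be sifted. -/
def pairProduct (L : List (Equiv.Perm (Fin n))) (a b : ℕ) : Equiv.Perm (Fin n) :=
  (L.getD b 1 * L.getD a 1)⁻¹

/-- Sift the first `k` generators. -/
def siftGenerators (S : List (Equiv.Perm (Fin n))) (k : ℕ) (L : List (Equiv.Perm (Fin n))) :
    List (Equiv.Perm (Fin n)) :=
  iterSteps (fun j L => (siftInsert n L (S.getD j 1)).1) k L

/-- Sift products of entry `a` with the first `k` entries. -/
def siftProducts (a k : ℕ) (L : List (Equiv.Perm (Fin n))) : List (Equiv.Perm (Fin n)) :=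
  iterSteps (fun b L => (siftInsert n L (pairProduct L a b)).1) k L

/-- Sift products of the first `k` entries with all entries. -/
def siftAllProducts (k : ℕ) (L : List (Equiv.Perm (Fin n))) : List (Equiv.Perm (Fin n)) :=
  iterSteps (fun a L => siftProducts a (n * n) L) k L

/-- Sift all generators and all products of two entries. -/
def siftPass (S L : List (Equiv.Perm (Fin n))) : List (Equiv.Perm (Fin n)) :=
  siftAllProducts (n * n) (siftGenerators S S.length L)

/-- Each step preserves the table or enlarges it, so an iteration that returns its input did nothing
in any single step. -/
theorem IsSimsTable.iterSteps_spec {f : ℕ → List (Equiv.Perm (Fin n)) → List (Equiv.Perm (Fin n))}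
    {k : ℕ} (hf : ∀ j < k, ∀ L, IsSimsTable H L → IsSimsTable H (f j L) ∧ TableLE L (f j L))
    (h : IsSimsTable H L) :
    IsSimsTable H (iterSteps f k L) ∧ TableLE L (iterSteps f k L) ∧
      (iterSteps f k L = L → ∀ j < k, f j L = L) := by
  induction k with
  | zero => exact ⟨h, Or.inl rfl, fun _ j hj => by omega⟩
  | succ k ih =>
    obtain ⟨h1, h2, h3⟩ := ih (fun j hj => hf j (by omega))
    obtain ⟨h4, h5⟩ := hf k (by omega) _ h1
    refine ⟨h4, h2.trans h5, fun he j hj => ?_⟩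
    have hL : iterSteps f k L = L := TableLE.antisymm h2 (by
      have := h5
      rw [iterSteps] at he
      rwa [he] at this)
    rcases Nat.lt_succ_iff_lt_or_eq.mp hj with hj | rfl
    · exact h3 hL j hj
    · have he' : f j (iterSteps f j L) = L := he
      rwa [hL] at he'

theorem IsSimsTable.getD_mem (h : IsSimsTable H L) (k : ℕ) : L.getD k 1 ∈ H := by
  by_cases hk : k < L.length
  · rw [List.getD_eq_getElem _ _ hk]
    exact h.mem _ (List.getElem_mem hk)
  · rw [List.getD_eq_default _ _ (by omega)]
    exact H.one_mem

theorem IsSimsTable.siftGenerators_spec {S : List (Equiv.Perm (Fin n))} (hS : ∀ s ∈ S, s ∈ H)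
    (h : IsSimsTable H L) {k : ℕ} (hk : k ≤ S.length) :
    IsSimsTable H (siftGenerators S k L) ∧ TableLE L (siftGenerators S k L) ∧
      (siftGenerators S k L = L → ∀ j < k, (siftInsert n L (S.getD j 1)).1 = L) := by
  refine IsSimsTable.iterSteps_spec (fun j hj L hL => ?_) h
  have := hL.siftInsert_spec (g := S.getD j 1) (by
    rw [List.getD_eq_getElem _ _ (by omega : j < S.length)]
    exact hS _ (List.getElem_mem _)) (le_refl n)
  exact ⟨this.1, this.2.2.2.1⟩

theorem IsSimsTable.pairProduct_mem (h : IsSimsTable H L) (a b : ℕ) : pairProduct L a b ∈ H :=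
  H.inv_mem (H.mul_mem (h.getD_mem b) (h.getD_mem a))

theorem IsSimsTable.siftProducts_spec (h : IsSimsTable H L) (a k : ℕ) :
    IsSimsTable H (siftProducts a k L) ∧ TableLE L (siftProducts a k L) ∧
      (siftProducts a k L = L →
        ∀ b < k, (siftInsert n L (pairProduct L a b)).1 = L) := by
  refine IsSimsTable.iterSteps_spec (fun b _ L hL => ?_) h
  have := hL.siftInsert_spec (hL.pairProduct_mem a b) (le_refl n)
  exact ⟨this.1, this.2.2.2.1⟩

theorem IsSimsTable.siftAllProducts_spec (h : IsSimsTable H L) (k : ℕ) :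
    IsSimsTable H (siftAllProducts k L) ∧ TableLE L (siftAllProducts k L) ∧
      (siftAllProducts k L = L → ∀ a < k, siftProducts a (n * n) L = L) := by
  refine IsSimsTable.iterSteps_spec (fun a _ L hL => ?_) h
  exact ⟨(hL.siftProducts_spec a _).1, (hL.siftProducts_spec a _).2.1⟩

theorem IsSimsTable.siftPass_spec {S : List (Equiv.Perm (Fin n))} (hS : ∀ s ∈ S, s ∈ H)
    (h : IsSimsTable H L) :
    IsSimsTable H (siftPass S L) ∧ TableLE L (siftPass S L) ∧
      (siftPass S L = L → (∀ s ∈ S, Sifts L s) ∧ ∀ a ∈ L, ∀ b ∈ L, Sifts L (a⁻¹ * b⁻¹)) := by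
  obtain ⟨h1, h2, h3⟩ := h.siftGenerators_spec hS le_rfl
  obtain ⟨h4, h5, h6⟩ := h1.siftAllProducts_spec (n * n)
  refine ⟨h4, h2.trans h5, fun he => ?_⟩
  have hL : siftGenerators S S.length L = L := TableLE.antisymm h2 (by
    rw [siftPass] at he
    rwa [he] at h5)
  rw [hL] at h6
  rw [siftPass, hL] at he
  refine ⟨fun s hs => ?_, fun a ha b hb => ?_⟩
  · obtain ⟨j, hj, rfl⟩ := List.mem_iff_getElem.mp hs
    have := h3 hL j hj
    rw [List.getD_eq_getElem _ _ hj] at this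
    exact ((h.siftInsert_spec (hS _ hs) le_rfl).2.2.2.2 this).2
  · obtain ⟨j, hj, rfl⟩ := List.mem_iff_getElem.mp ha
    obtain ⟨k, hk, rfl⟩ := List.mem_iff_getElem.mp hb
    have hj' : j < n * n := by rwa [h.length] at hj
    have hk' : k < n * n := by rwa [h.length] at hk
    have := (h.siftProducts_spec j (n * n)).2.2 (h6 he j hj') k hk'
    have := ((h.siftInsert_spec (h.pairProduct_mem j k) le_rfl).2.2.2.2 this).2
    rw [pairProduct, List.getD_eq_getElem _ _ hj, List.getD_eq_getElem _ _ hk, mul_inv_rev] at this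
    exact this

/-- The table without nontrivial entries. -/
def trivialTable (n : ℕ) : List (Equiv.Perm (Fin n)) := List.replicate (n * n) 1

theorem isSimsTable_trivialTable (H : Subgroup (Equiv.Perm (Fin n))) :
    IsSimsTable H (trivialTable n) := by
  refine ⟨by simp [trivialTable], ?_, ?_⟩
  · intro w hw
    rw [List.eq_of_mem_replicate hw]
    exact H.one_mem
  · intro i _ j _
    left
    simp only [trivialTable, List.getD_eq_getElem?_getD, List.getElem?_replicate]
    split_ifs <;> rfl

/-- The result of sufficiently many passes. -/
def simsTable (S : List (Equiv.Perm (Fin n))) : List (Equiv.Perm (Fin n)) :=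
  iterSteps (fun _ L => siftPass S L) (n * n + 1) (trivialTable n)

theorem simsTable_spec (S : List (Equiv.Perm (Fin n))) :
    IsSimsTable (generatedGroup S) (simsTable S) ∧
      ∀ g, g ∈ generatedGroup S ↔ sift (simsTable S) n g = 1 := by
  have hS : ∀ s ∈ S, s ∈ generatedGroup S := fun s hs => Subgroup.subset_closure hs
  -- After `k` passes, either at least `k` entries are nontrivial or the table is stable. There are
  -- only `n * n` places, so `n * n + 1` passes reach stability.
  have key : ∀ k, IsSimsTable (generatedGroup S)
        (iterSteps (fun _ L => siftPass S L) k (trivialTable n)) ∧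
      (k ≤ tableSize (iterSteps (fun _ L => siftPass S L) k (trivialTable n)) ∨
        siftPass S (iterSteps (fun _ L => siftPass S L) k (trivialTable n)) =
          iterSteps (fun _ L => siftPass S L) k (trivialTable n)) := by
    intro k
    induction k with
    | zero => exact ⟨isSimsTable_trivialTable _, Or.inl (Nat.zero_le _)⟩
    | succ k ih =>
      obtain ⟨h1, h2⟩ := ih
      obtain ⟨h3, h4, -⟩ := h1.siftPass_spec hS
      refine ⟨h3, ?_⟩
      rw [iterSteps]
      rcases h4 with h4 | h4
      · right
        rw [h4, h4]
      · rcases h2 with h2 | h2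
        · left
          omega
        · rw [h2] at h4
          omega
  obtain ⟨h1, h2⟩ := key (n * n + 1)
  rw [← simsTable] at h1 h2
  have hfix : siftPass S (simsTable S) = simsTable S := by
    rcases h2 with h2 | h2
    · have := h1.tableSize_le
      omega
    · exact h2
  obtain ⟨hgen, hpair⟩ := (h1.siftPass_spec hS).2.2 hfix
  refine ⟨h1, fun g => ⟨fun hg => ?_, fun hg => ?_⟩⟩
  · exact h1.sift_eq_one (h1.sifts_of_mem_closure hpair hgen hg)
  · refine h1.mem_of_sift_mem le_rfl (k := n) ?_
    rw [hg]
    exact Subgroup.one_mem _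

end SimsTable

/-! ### Programs for sifting -/

attribute [simp] RamState.execs RamInstr.exec

/-- Multiply the registers `x` and `y`. -/
def mulProg (z x y : ℕ) : RamProg :=
  .seq (.block [.const z 0]) (.loop 90 91 x (.block [.add z z y]))

/-- Repeated addition, as the machine has no multiplication: seven steps per unit of register `x`.
Registers `90` and `91` control the loop, hence the bounds on the names. -/
theorem mulProg_ends {z x y : ℕ} (hz : z < 90) (hx : x < 90) (hy : y < 90) (hzx : z ≠ x)
    (hzy : z ≠ y) (s : RamState) :
    (mulProg z x y).Ends s (7 * s.reg x + 6) (fun s' => s'.reg z = s.reg x * s.reg y) := by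
  refine RamProg.Ends.mono (t := 2 + (s.reg x * (2 + 5) + 4)) ?_ (by omega) (fun _ _ h => h)
  refine RamProg.Ends.seq (RamProg.Ends.block (l := [.const z 0])
    (Q := fun s' => s'.reg z = 0 ∧ s'.reg x = s.reg x ∧ s'.reg y = s.reg y) ?_) ?_
  · simp [hzx.symm, hzy.symm, show z ≠ 99 by omega, show x ≠ 99 by omega, show y ≠ 99 by omega]
  · rintro s₁ - ⟨h1, h2, h3⟩
    refine (RamProg.Ends.loop (fun j s' => s'.reg z = j * s.reg y ∧ s'.reg y = s.reg y) h2 ?_ ?_ ?_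
      ?_ ?_ ?_).mono le_rfl fun _ _ h => h.1
    · simp [LoopRegs, show x ≠ 90 by omega, show x ≠ 91 by omega, show x ≠ 99 by omega]
    · simp [RamProg.block, RamProg.writesReg, RamInstr.writesReg, show 90 ≠ z by omega]
    · simp [RamProg.block, RamProg.writesReg, RamInstr.writesReg, hzx.symm,
        show x ≠ 99 by omega]
    · rintro j s s' ⟨h1, h2⟩ hr ha
      rw [hr z (by omega) (by omega) (by omega), hr y (by omega) (by omega) (by omega)]
      exact ⟨h1, h2⟩
    · simp [h1, h3]
    · rintro j s' - ⟨h4, h5⟩ - -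
      refine RamProg.Ends.block ?_
      simp [show z ≠ 99 by omega, show y ≠ 99 by omega, hzy.symm, h4, h5]
      ring

section

variable {n : ℕ}

/-- The first `c` values of `σ ∘ π` have been written to entry `k`, at the positions given by `π`. -/
structure PartlySet (L : List (Equiv.Perm (Fin n))) (k : ℕ) (π σ : Equiv.Perm (Fin n)) (c : ℕ)
    (l : List ℕ) : Prop where
  length : l.length = (encodePerms L).length
  done : ∀ v < c, l.getD (k * n + permVal π v) 0 = permVal σ (permVal π v)
  rest : ∀ p, (∀ v < c, p ≠ k * n + permVal π v) → l.getD p 0 = (encodePerms L).getD p 0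

theorem PartlySet.zero (L : List (Equiv.Perm (Fin n))) (k : ℕ) (π σ : Equiv.Perm (Fin n)) :
    PartlySet L k π σ 0 (encodePerms L) :=
  ⟨rfl, fun v hv => by omega, fun _ _ => rfl⟩

theorem PartlySet.succ {L : List (Equiv.Perm (Fin n))} {k : ℕ} {π σ : Equiv.Perm (Fin n)} {c : ℕ}
    {l : List ℕ} (h : PartlySet L k π σ c l) (hk : k < L.length) (hc : c < n) :
    PartlySet L k π σ (c + 1) (l.set (k * n + permVal π c) (permVal σ (permVal π c))) := by
  have hp := permVal_lt π hc
  have hlt : k * n + permVal π c < l.length := by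
    rw [h.length, length_encodePerms]
    nlinarith
  refine ⟨by rw [List.length_set, h.length], fun v hv => ?_, fun p hpv => ?_⟩
  · rcases Nat.lt_succ_iff_lt_or_eq.mp hv with hv | rfl
    · rw [List.getD_eq_getElem?_getD, List.getElem?_set_ne, ← List.getD_eq_getElem?_getD,
        h.done v hv]
      intro he
      have := permVal_injective π (v := c) (w := v) hc (by omega) (by omega)
      omega
    · rw [List.getD_eq_getElem _ _ (by simpa using hlt), List.getElem_set_self]
  · rw [List.getD_eq_getElem?_getD, List.getElem?_set_ne (hpv c (by omega)).symm,
      ← List.getD_eq_getElem?_getD]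
    exact h.rest p fun v hv => hpv v (by omega)

theorem PartlySet.eq {L : List (Equiv.Perm (Fin n))} {k : ℕ} {π σ : Equiv.Perm (Fin n)}
    {l : List ℕ} (h : PartlySet L k π σ n l) (hk : k < L.length) : l = encodePerms (L.set k σ) :=
  encodePerms_set hk π σ h.length h.done h.rest

/-- Store the position of the entry for the permutation in array `4` and the level in register
`10` in register `14`. -/
def locateProg : RamProg :=
  .seq (.block [.read 12 4 10]) <| .seq (mulProg 13 10 0) <| .seq (.block [.add 13 13 12])
    (mulProg 14 13 0)

/-- Multiply the permutation in array `4` with the entry of array `3` at register `14`. -/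
def applyProg : RamProg :=
  .loop 20 21 0 (.block [.read 22 4 20, .add 22 14 22, .read 23 3 22, .write 4 20 23])

/-- Write the inverse of the permutation in array `4` to array `3` at register `14`. -/
def insertProg : RamProg :=
  .loop 20 21 0 (.block [.read 22 4 20, .add 22 14 22, .write 3 22 20])

/-- Array `3` contains the table `L`, and array `4` the permutation `g`. -/
structure HasTable (L : List (Equiv.Perm (Fin n))) (g : Equiv.Perm (Fin n)) (s : RamState) :
    Prop where
  reg : s.reg 0 = n
  length : L.length = n * n
  table : s.arr 3 = encodePerms L
  perm : s.arr 4 = encodePerms [g]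

theorem HasTable.getD_perm {L : List (Equiv.Perm (Fin n))} {g : Equiv.Perm (Fin n)} {s : RamState}
    (h : HasTable L g s) {v : ℕ} (hv : v < n) : (s.arr 4).getD v 0 = permVal g v := by
  rw [h.perm]
  simpa using getD_encodePerms [g] (k := 0) (by simp) hv

theorem locateProg_ends {L : List (Equiv.Perm (Fin n))} {g : Equiv.Perm (Fin n)} {s : RamState}
    (h : HasTable L g s) {i : ℕ} (hi : i < n) (hs : s.reg 10 = i) :
    locateProg.Ends s (7 * (n * n) + 7 * n + 16)
      (fun s' => s'.reg 12 = permVal g i ∧ s'.reg 14 = (i * n + permVal g i) * n) := by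
  have hg := permVal_lt g hi
  refine RamProg.Ends.mono (t := 2 + ((7 * i + 6) + (2 + (7 * (i * n + permVal g i) + 6)))) ?_ ?_
    (fun _ _ h => h)
  · refine RamProg.Ends.seq (RamProg.Ends.block (l := [.read 12 4 10])
      (Q := fun s' => s'.reg 12 = permVal g i) ?_) fun s₁ f₁ h₁ => ?_
    · simp only [RamState.execs, RamInstr.exec, RamState.setReg_reg, hs, ← h.getD_perm hi]
      rfl
    have e0 : s₁.reg 0 = n := (f₁.reg 0 rfl).trans h.reg
    have e10 : s₁.reg 10 = i := (f₁.reg 10 rfl).trans hs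
    have := mulProg_ends (z := 13) (x := 10) (y := 0) (by omega) (by omega) (by omega) (by omega)
      (by omega) s₁
    rw [e0, e10] at this
    refine RamProg.Ends.seq this fun s₂ f₂ h₂ => ?_
    refine RamProg.Ends.seq (RamProg.Ends.block (l := [.add 13 13 12])
      (Q := fun s' => s'.reg 13 = i * n + permVal g i) ?_) fun s₃ f₃ h₃ => ?_
    · simp [h₂, f₂.reg 12 rfl, h₁]
    have e0' : s₃.reg 0 = n := (f₃.reg 0 rfl).trans ((f₂.reg 0 rfl).trans e0)
    have := mulProg_ends (z := 14) (x := 13) (y := 0) (by omega) (by omega) (by omega) (by omega)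
      (by omega) s₃
    rw [h₃, e0'] at this
    refine this.mono le_rfl fun s₄ f₄ h₄ => ⟨?_, h₄⟩
    rw [f₄.reg 12 rfl, f₃.reg 12 rfl, f₂.reg 12 rfl, h₁]
  · have := index_lt hi hg
    omega

theorem applyProg_ends {L : List (Equiv.Perm (Fin n))} {g : Equiv.Perm (Fin n)} {s : RamState}
    (h : HasTable L g s) {k : ℕ} (hk : k < n * n) (hs : s.reg 14 = k * n) :
    applyProg.Ends s (10 * n + 4) (HasTable L (L.getD k 1 * g)) := by
  have hk' : k < L.length := by rwa [h.length]
  refine RamProg.Ends.mono (t := n * (5 + 5) + 4) ?_ (by omega) (fun _ _ h => h) (R := fun s' =>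
    HasTable L (L.getD k 1 * g) s')
  refine (RamProg.Ends.loop (fun j s' => PartlySet [g] 0 1 (L.getD k 1 * g) j (s'.arr 4)) (b := 5)
    h.reg rfl rfl rfl ?_ ?_ ?_).mono le_rfl ?_
  · intro j s s' h _ ha
    rwa [ha]
  · rw [h.perm]
    exact PartlySet.zero _ _ _ _
  · intro j s' f hp hj hjn
    have e3 : s'.arr 3 = encodePerms L := (f.arr 3 rfl).trans h.table
    have e14 : s'.reg 14 = k * n := (f.reg 14 rfl).trans hs
    -- The composition is done in place; position `j` has not been overwritten yet and still holds
    -- the value of `g`.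
    have e4 : (s'.arr 4).getD j 0 = permVal g j := by
      rw [hp.rest j, ← h.getD_perm hjn, h.perm]
      intro v hv he
      rw [permVal_one (by omega)] at he
      omega
    refine RamProg.Ends.block ?_
    have := hp.succ (by simp) hjn
    rw [permVal_one hjn, permVal_mul _ _ hjn, ← getD_encodePerms L hk' (permVal_lt g hjn)] at this
    simpa [-List.getD_eq_getElem?_getD, hj, e3, e14, e4] using this
  · intro s' f hp
    exact ⟨(f.reg 0 rfl).trans h.reg, h.length, (f.arr 3 rfl).trans h.table, hp.eq (by simp)⟩

theorem insertProg_ends {L : List (Equiv.Perm (Fin n))} {g : Equiv.Perm (Fin n)} {s : RamState}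
    (h : HasTable L g s) {k : ℕ} (hk : k < n * n) (hs : s.reg 14 = k * n) :
    insertProg.Ends s (10 * n + 4) (HasTable (L.set k g⁻¹) g) := by
  have hk' : k < L.length := by rwa [h.length]
  refine RamProg.Ends.mono (t := n * (4 + 5) + 4) ?_ (by omega) (fun _ _ h => h) (R := fun s' =>
    HasTable (L.set k g⁻¹) g s')
  -- Round `j` writes `j` at position `g j`, which fills in the inverse without searching.
  refine (RamProg.Ends.loop (fun j s' => PartlySet L k g g⁻¹ j (s'.arr 3)) (b := 4)
    h.reg rfl rfl rfl ?_ ?_ ?_).mono le_rfl ?_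
  · intro j s s' h _ ha
    rwa [ha]
  · rw [h.table]
    exact PartlySet.zero _ _ _ _
  · intro j s' f hp hj hjn
    have e14 : s'.reg 14 = k * n := (f.reg 14 rfl).trans hs
    have e4 : (s'.arr 4).getD j 0 = permVal g j := by
      rw [f.arr 4 rfl, h.getD_perm hjn]
    refine RamProg.Ends.block ?_
    have := hp.succ hk' hjn
    rw [permVal_inv_self _ hjn] at this
    simpa [-List.getD_eq_getElem?_getD, hj, e14, e4] using this
  · intro s' f hp
    exact ⟨(f.reg 0 rfl).trans h.reg, by rw [List.length_set, h.length], hp.eq hk',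
      (f.arr 4 rfl).trans h.perm⟩

/-- Sift the permutation in array `4` without changing the table. -/
def siftProg : RamProg := .loop 10 11 0 (.seq locateProg applyProg)

/-- Sift the permutation in array `4`, filling gaps of the table. -/
def siftInsertProg : RamProg :=
  .loop 10 11 0 <| .seq locateProg <|
    .seq (.block [.add 15 14 12, .read 15 3 15, .sub 16 15 10, .sub 17 10 15, .add 16 16 17]) <|
      .seq (.ite 16 insertProg (.block [])) applyProg

theorem HasTable.frame {P : RamProg} {L : List (Equiv.Perm (Fin n))} {g : Equiv.Perm (Fin n)}
    {s s' : RamState} (h : HasTable L g s) (f : Frame P s s') (h0 : P.writesReg 0 = false)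
    (h3 : P.writesArr 3 = false) (h4 : P.writesArr 4 = false) : HasTable L g s' :=
  ⟨(f.reg 0 h0).trans h.reg, h.length, (f.arr 3 h3).trans h.table, (f.arr 4 h4).trans h.perm⟩

theorem HasTable.ignoresRegs {i c : ℕ} (hi : i ≠ 0) (hc : c ≠ 0)
    (f : ℕ → List (Equiv.Perm (Fin n)) × Equiv.Perm (Fin n)) :
    IgnoresRegs i c (fun j s => HasTable (f j).1 (f j).2 s) := by
  intro j s s' h hr ha
  exact ⟨(hr 0 hi.symm hc.symm (by omega)).trans h.reg, h.length, by rw [ha, h.table],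
    by rw [ha, h.perm]⟩

theorem siftProg_ends {L : List (Equiv.Perm (Fin n))} {g : Equiv.Perm (Fin n)} {s : RamState}
    (h : HasTable L g s) :
    siftProg.Ends s (n * (7 * (n * n) + 17 * n + 25) + 4) (HasTable L (sift L n g)) := by
  refine RamProg.Ends.mono (t := n * (7 * (n * n) + 7 * n + 16 + (10 * n + 4) + 5) + 4) ?_ ?_
    (fun _ _ h => h)
  · refine RamProg.Ends.loop (fun j => HasTable L (sift L j g)) h.reg rfl rfl rfl
      (HasTable.ignoresRegs (by omega) (by omega) (fun j => (L, sift L j g))) h ?_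
    intro j s₁ f₁ h₁ hj hjn
    refine RamProg.Ends.seq (locateProg_ends h₁ hjn hj) fun s₂ f₂ h₂ => ?_
    exact applyProg_ends (h₁.frame f₂ rfl rfl rfl) (index_lt hjn (permVal_lt _ hjn)) h₂.2
  · apply le_of_eq
    ring

theorem siftInsertProg_ends {L : List (Equiv.Perm (Fin n))} {g : Equiv.Perm (Fin n)} {s : RamState}
    (h : HasTable L g s) :
    siftInsertProg.Ends s (n * (7 * (n * n) + 27 * n + 36) + 4)
      (HasTable (siftInsert n L g).1 (siftInsert n L g).2) := by
  refine RamProg.Ends.mono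
    (t := n * (7 * (n * n) + 7 * n + 16 + (6 + ((10 * n + 4 + 1) + (10 * n + 4))) + 5) + 4) ?_ ?_
    (fun _ _ h => h)
  · refine RamProg.Ends.loop (fun j => HasTable (siftInsert j L g).1 (siftInsert j L g).2)
      h.reg rfl rfl rfl
      (HasTable.ignoresRegs (by omega) (by omega) (fun j => siftInsert j L g)) h ?_
    intro j s₁ f₁ h₁ hj hjn
    have hS : siftInsert (j + 1) L g =
      (tableInsert j (siftInsert j L g).1 (siftInsert j L g).2,
        siftStep (tableInsert j (siftInsert j L g).1 (siftInsert j L g).2) j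
          (siftInsert j L g).2) := rfl
    rw [hS]
    set L' := (siftInsert j L g).1
    set g' := (siftInsert j L g).2
    have hlt := index_lt hjn (permVal_lt g' hjn)
    refine RamProg.Ends.seq (locateProg_ends h₁ hjn hj) fun s₂ f₂ h₂ => ?_
    have t₂ := h₁.frame f₂ rfl rfl rfl
    have e10 : s₂.reg 10 = j := (f₂.reg 10 rfl).trans hj
    -- With truncated subtraction, `(a - i) + (i - a)` vanishes iff `a = i`. Here `a` is the image
    -- under the table entry of the image of `i`, so this tests whether the row fits.
    refine RamProg.Ends.seq (RamProg.Ends.block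
      (l := [.add 15 14 12, .read 15 3 15, .sub 16 15 10, .sub 17 10 15, .add 16 16 17])
      (Q := fun s' => s'.reg 16 = 0 ↔ RowFits L' j g') ?_) fun s₃ f₃ h₃ => ?_
    · have hget := getD_encodePerms L' (by rwa [t₂.length]) (permVal_lt g' hjn)
      simp only [RamState.execs, RamInstr.exec, RamState.setReg_reg, RamState.setReg_arr, h₂, e10,
        t₂.table, RowFits, tableEntry, ← hget]
      simp only [reduceIte, Nat.reduceEqDiff]
      omega
    have t₃ := t₂.frame f₃ rfl rfl rfl
    have e14 : s₃.reg 14 = (j * n + permVal g' j) * n := (f₃.reg 14 rfl).trans h₂.2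
    refine RamProg.Ends.seq (RamProg.Ends.ite (Q := HasTable (tableInsert j L' g') g')
      (fun hne => ?_) fun h0 => ?_) fun s₄ f₄ h₄ => ?_
    · rw [tableInsert, if_neg (by rwa [ne_eq, h₃] at hne)]
      exact insertProg_ends t₃ hlt e14
    · refine (RamProg.Ends.block (l := []) (Q := fun s' => HasTable L' g' s') ?_).mono
        (by simp) fun s' _ h => ?_
      · exact ⟨by simp [t₃.reg], t₃.length, by simp [t₃.table], by simp [t₃.perm]⟩
      · rwa [tableInsert, if_pos (h₃.mp h0)]
    · exact applyProg_ends h₄ hlt ((f₄.reg 14 rfl).trans e14)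
  · apply le_of_eq
    ring

end

/-! ### Programs for completing the table -/

section

variable {n : ℕ}

/-- Copy the permutation with the index in register `30` from array `0` to array `4`. -/
def loadGenerator : RamProg :=
  .seq (mulProg 14 30 0) (.loop 20 21 0 (.block [.add 22 14 20, .read 23 0 22, .write 4 20 23]))

/-- Write the product for the entries with the indices in registers `34` and `36` to array `4`. -/
def loadProduct : RamProg :=
  .seq (mulProg 14 34 0) <| .seq (mulProg 18 36 0) <|
    .loop 20 21 0 (.block [.add 22 14 20, .read 22 3 22, .add 22 18 22, .read 22 3 22,
      .write 4 22 20])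

theorem loadGenerator_ends {S L : List (Equiv.Perm (Fin n))} {g : Equiv.Perm (Fin n)}
    {s : RamState} (h : HasTable L g s) (hS : s.arr 0 = encodePerms S) {j : ℕ}
    (hj : j < S.length) (hs : s.reg 30 = j) :
    loadGenerator.Ends s (7 * S.length + 10 * n + 10) (HasTable L (S.getD j 1)) := by
  refine RamProg.Ends.mono (t := (7 * j + 6) + (n * (4 + 5) + 4)) ?_ (by omega) (fun _ _ h => h)
  have := mulProg_ends (z := 14) (x := 30) (y := 0) (by omega) (by omega) (by omega) (by omega)
      (by omega) s
  rw [hs, h.reg] at this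
  refine RamProg.Ends.seq this fun s₁ f₁ h₁ => ?_
  have t₁ := h.frame f₁ rfl rfl rfl
  refine (RamProg.Ends.loop (fun i s' => PartlySet [g] 0 1 (S.getD j 1) i (s'.arr 4)) (b := 4)
    t₁.reg rfl rfl rfl ?_ ?_ ?_).mono le_rfl ?_
  · intro j s s' h _ ha
    rwa [ha]
  · rw [t₁.perm]
    exact PartlySet.zero _ _ _ _
  · intro i s' f hp hi hin
    have e14 : s'.reg 14 = j * n := (f.reg 14 rfl).trans h₁
    have e0 : s'.arr 0 = encodePerms S := (f.arr 0 rfl).trans ((f₁.arr 0 rfl).trans hS)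
    refine RamProg.Ends.block ?_
    have := hp.succ (by simp) hin
    rw [permVal_one hin, ← getD_encodePerms S hj hin] at this
    simpa [-List.getD_eq_getElem?_getD, hi, e0, e14] using this
  · intro s' f hp
    exact ⟨(f.reg 0 rfl).trans t₁.reg, h.length, (f.arr 3 rfl).trans t₁.table, hp.eq (by simp)⟩

/-- The inverse of the product `w_b w_a` is obtained by writing `i` at position `w_b (w_a i)`. -/
theorem loadProduct_ends {L : List (Equiv.Perm (Fin n))} {g : Equiv.Perm (Fin n)}
    {s : RamState} (h : HasTable L g s) {a b : ℕ} (ha : a < n * n) (hb : b < n * n)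
    (hsa : s.reg 34 = a) (hsb : s.reg 36 = b) :
    loadProduct.Ends s (14 * (n * n) + 11 * n + 16) (HasTable L (pairProduct L a b)) := by
  refine RamProg.Ends.mono (t := (7 * a + 6) + ((7 * b + 6) + (n * (6 + 5) + 4))) ?_ (by omega)
    (fun _ _ h => h)
  have ha' : a < L.length := by rwa [h.length]
  have hb' : b < L.length := by rwa [h.length]
  have := mulProg_ends (z := 14) (x := 34) (y := 0) (by omega) (by omega) (by omega) (by omega)
      (by omega) s
  rw [hsa, h.reg] at this
  refine RamProg.Ends.seq this fun s₁ f₁ h₁ => ?_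
  have t₁ := h.frame f₁ rfl rfl rfl
  have := mulProg_ends (z := 18) (x := 36) (y := 0) (by omega) (by omega) (by omega) (by omega)
      (by omega) s₁
  rw [f₁.reg 36 rfl, hsb, t₁.reg] at this
  refine RamProg.Ends.seq this fun s₂ f₂ h₂ => ?_
  have t₂ := t₁.frame f₂ rfl rfl rfl
  refine (RamProg.Ends.loop
    (fun i s' => PartlySet [g] 0 (L.getD b 1 * L.getD a 1) (pairProduct L a b) i (s'.arr 4)) (b := 6)
    t₂.reg rfl rfl rfl ?_ ?_ ?_).mono le_rfl ?_
  · intro j s s' h _ ha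
    rwa [ha]
  · rw [t₂.perm]
    exact PartlySet.zero _ _ _ _
  · intro i s' f hp hi hin
    have e14 : s'.reg 14 = a * n := (f.reg 14 rfl).trans ((f₂.reg 14 rfl).trans h₁)
    have e18 : s'.reg 18 = b * n := (f.reg 18 rfl).trans h₂
    have e3 : s'.arr 3 = encodePerms L := (f.arr 3 rfl).trans t₂.table
    refine RamProg.Ends.block ?_
    have := hp.succ (by simp) hin
    rw [pairProduct, permVal_inv_self _ hin, permVal_mul _ _ hin,
      ← getD_encodePerms L hb' (permVal_lt _ hin), ← getD_encodePerms L ha' hin] at this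
    simpa [-List.getD_eq_getElem?_getD, hi, e3, e14, e18, pairProduct] using this
  · intro s' f hp
    exact ⟨(f.reg 0 rfl).trans t₂.reg, h.length, (f.arr 3 rfl).trans t₂.table, hp.eq (by simp)⟩

/-- Sift all generators; their number is in register `32`. -/
def siftGeneratorsProg : RamProg := .loop 30 31 32 (.seq loadGenerator siftInsertProg)

/-- Sift all products of two entries; the length of the table is in register `1`. -/
def siftAllProductsProg : RamProg :=
  .loop 34 35 1 (.loop 36 37 1 (.seq loadProduct siftInsertProg))

/-- Repeat; the number of passes is in register `33`. -/
def simsTableProg : RamProg := .loop 38 39 33 (.seq siftGeneratorsProg siftAllProductsProg)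

/-- Array `3` contains the table `L`, and array `4` some permutation. -/
def HasSomeTable (L : List (Equiv.Perm (Fin n))) (s : RamState) : Prop := ∃ g, HasTable L g s

theorem HasSomeTable.ignoresRegs {i c : ℕ} (hi : i ≠ 0) (hc : c ≠ 0)
    (f : ℕ → List (Equiv.Perm (Fin n))) :
    IgnoresRegs i c (fun j s => HasSomeTable (f j) s) := by
  rintro j s s' ⟨g, h⟩ hr ha
  exact ⟨g, HasTable.ignoresRegs hi hc (fun j => (f j, g)) j s s' h hr ha⟩

theorem HasSomeTable.frame {P : RamProg} {L : List (Equiv.Perm (Fin n))}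
    {s s' : RamState} (h : HasSomeTable L s) (f : Frame P s s') (h0 : P.writesReg 0 = false)
    (h3 : P.writesArr 3 = false) (h4 : P.writesArr 4 = false) : HasSomeTable L s' := by
  obtain ⟨g, h⟩ := h
  exact ⟨g, h.frame f h0 h3 h4⟩

/-- Steps for sifting one permutation. -/
def siftTime (n : ℕ) : ℕ := n * (7 * (n * n) + 27 * n + 36) + 4

/-- Steps for sifting `m` generators and all products of two entries. -/
def passTime (n m : ℕ) : ℕ :=
  (m * ((7 * m + 10 * n + 10 + siftTime n) + 5) + 4) +
    (n * n * ((n * n * ((14 * (n * n) + 11 * n + 16 + siftTime n) + 5) + 4) + 5) + 4)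

theorem siftGeneratorsProg_ends {S L : List (Equiv.Perm (Fin n))} {s : RamState}
    (h : HasSomeTable L s) (hS : s.arr 0 = encodePerms S) (hs : s.reg 32 = S.length) :
    siftGeneratorsProg.Ends s
      (S.length * ((7 * S.length + 10 * n + 10 + siftTime n) + 5) + 4)
      (HasSomeTable (siftGenerators S S.length L)) := by
  refine RamProg.Ends.loop (fun j => HasSomeTable (siftGenerators S j L)) hs rfl rfl rfl
    (HasSomeTable.ignoresRegs (by omega) (by omega) (fun j => siftGenerators S j L)) h ?_
  rintro j s₁ f₁ ⟨g, h₁⟩ hj hjn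
  refine RamProg.Ends.seq (loadGenerator_ends h₁ ((f₁.arr 0 rfl).trans hS) hjn hj)
    fun s₂ f₂ h₂ => ?_
  exact (siftInsertProg_ends h₂).mono le_rfl fun s₃ f₃ h₃ => ⟨_, h₃⟩

theorem siftAllProductsProg_ends {L : List (Equiv.Perm (Fin n))} {s : RamState}
    (h : HasSomeTable L s) (hs : s.reg 1 = n * n) :
    siftAllProductsProg.Ends s
      (n * n * ((n * n * ((14 * (n * n) + 11 * n + 16 + siftTime n) + 5) + 4) + 5) + 4)
      (HasSomeTable (siftAllProducts (n * n) L)) := by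
  refine RamProg.Ends.loop (fun a => HasSomeTable (siftAllProducts a L)) hs rfl rfl rfl
    (HasSomeTable.ignoresRegs (by omega) (by omega) (fun a => siftAllProducts a L)) h ?_
  rintro a s₁ f₁ h₁ ha han
  refine RamProg.Ends.loop (fun b => HasSomeTable (siftProducts a b (siftAllProducts a L)))
    ((f₁.reg 1 rfl).trans hs) rfl rfl rfl (HasSomeTable.ignoresRegs (by omega) (by omega)
      (fun b => siftProducts a b (siftAllProducts a L))) h₁ ?_
  rintro b s₂ f₂ ⟨g, h₂⟩ hb hbn
  refine RamProg.Ends.seq (loadProduct_ends h₂ han hbn ((f₂.reg 34 rfl).trans ha) hb)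
    fun s₃ f₃ h₃ => ?_
  exact (siftInsertProg_ends h₃).mono le_rfl fun s₄ f₄ h₄ => ⟨_, h₄⟩

theorem simsTableProg_ends {S : List (Equiv.Perm (Fin n))} {s : RamState}
    (h : HasSomeTable (trivialTable n) s) (hS : s.arr 0 = encodePerms S)
    (hs : s.reg 32 = S.length) (hs1 : s.reg 1 = n * n) (hs33 : s.reg 33 = n * n + 1) :
    simsTableProg.Ends s ((n * n + 1) * (passTime n S.length + 5) + 4)
      (HasSomeTable (simsTable S)) := by
  refine RamProg.Ends.loop
    (fun j => HasSomeTable (iterSteps (fun _ L => siftPass S L) j (trivialTable n)))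
    hs33 rfl rfl rfl (HasSomeTable.ignoresRegs (by omega) (by omega)
      (fun j => iterSteps (fun _ L => siftPass S L) j (trivialTable n))) h ?_
  rintro j s₁ f₁ h₁ hj hjn
  refine RamProg.Ends.seq (siftGeneratorsProg_ends h₁ ((f₁.arr 0 rfl).trans hS)
    ((f₁.reg 32 rfl).trans hs)) fun s₂ f₂ h₂ => ?_
  exact siftAllProductsProg_ends h₂ ((f₂.reg 1 rfl).trans ((f₁.reg 1 rfl).trans hs1))

/-! ### Preparation -/

/-- Append the identity to array `a`. -/
def pushIdentity (a : ℕ) : RamProg := .loop 20 21 0 (.block [.push a 20])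

theorem pushIdentity_ends {a : ℕ} {s : RamState} (hs : s.reg 0 = n)
    {L : List (Equiv.Perm (Fin n))} (ha : s.arr a = encodePerms L) :
    (pushIdentity a).Ends s (7 * n + 4) (fun s' => s'.arr a = encodePerms (L ++ [1])) := by
  refine RamProg.Ends.mono (t := n * (2 + 5) + 4) ?_ (by omega) (fun _ _ h => h)
  refine (RamProg.Ends.loop (fun j s' => s'.arr a = encodePerms L ++ List.range j) hs rfl rfl rfl
    ?_ ?_ ?_).mono le_rfl ?_
  · intro j s s' h _ ha
    rwa [ha]
  · simp [ha]
  · intro j s' _ h hj _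
    refine RamProg.Ends.block ?_
    simp [h, hj, List.range_succ]
  · intro s' _ h
    rw [h, encodePerms_append]
    congr 1
    refine encodePerms_one_list (by simp) fun v hv => ?_
    rw [permVal_one hv, List.getD_eq_getElem _ _ (by simpa using hv)]
    simp

/-- Divide the length of array `a` by the content of register `y`. -/
def countProg (a y z : ℕ) : RamProg :=
  .seq (.block [.length 40 a, .length 41 a, .const z 0]) <|
    .loop 20 21 40 <| .ite 41 (.block [.sub 41 41 y, .const 22 1, .add z z 22]) (.block [])

/-- Division by repeated subtraction. The loop runs for the whole length of the array, which is more
often than needed, and idles once nothing is left; hence the `min j m` in the invariant. -/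
theorem countProg_ends {a y z m k : ℕ} {s : RamState} (hy : s.reg y = k) (hk : 0 < k)
    (hlen : (s.arr a).length = m * k)
    (hyr : [20, 21, 22, 40, 41, 99, z].all (· != y) = true)
    (hzr : [20, 21, 22, 40, 41, 99].all (· != z) = true) :
    (countProg a y z).Ends s (10 * (m * k) + 8) (fun s' => s'.reg z = m) := by
  simp only [List.all_cons, List.all_nil, Bool.and_eq_true, bne_iff_ne, ne_eq, and_true] at hyr hzr
  obtain ⟨y1, y2, y3, y4, y5, y6, y7⟩ := hyr
  obtain ⟨z1, z2, z3, z4, z5, z6⟩ := hzr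
  refine RamProg.Ends.mono (t := 4 + (m * k * ((4 + 1) + 5) + 4)) ?_ (by omega) (fun _ _ h => h)
  refine RamProg.Ends.seq (RamProg.Ends.block (l := [.length 40 a, .length 41 a, .const z 0])
    (Q := fun s' => s'.reg 40 = m * k ∧ s'.reg 41 = m * k ∧ s'.reg z = 0 ∧ s'.reg y = k) ?_)
    fun s₁ f₁ h₁ => ?_
  · simp [Ne.symm, *]
  obtain ⟨h40, h41, hz0, hy0⟩ := h₁
  refine (RamProg.Ends.loop (fun j s' => s'.reg y = k ∧ s'.reg z = min j m ∧
    s'.reg 41 + k * min j m = m * k) h40 rfl ?_ ?_ ?_ ?_ ?_).mono le_rfl ?_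
  · simp [RamProg.writesReg, RamProg.block, RamInstr.writesReg]
    omega
  · simp [RamProg.writesReg, RamProg.block, RamInstr.writesReg]
    omega
  · rintro j s s' ⟨i1, i2, i3⟩ hr _
    rw [hr y (by omega) (by omega) (by omega), hr z (by omega) (by omega) (by omega),
      hr 41 (by omega) (by omega) (by omega)]
    exact ⟨i1, i2, i3⟩
  · simp [hy0, hz0, h41]
  · rintro j s' _ ⟨i1, i2, i3⟩ hj hjm
    have hle : min j m ≤ m := min_le_right _ _
    refine RamProg.Ends.ite (fun hne => ?_) fun h0 => ?_
    · have hjlt : j < m := by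
        by_contra hge
        rw [min_eq_right (by omega)] at i3
        have : k * m = m * k := mul_comm _ _
        omega
      rw [min_eq_left hjlt.le] at i2 i3
      have hmk : k * (j + 1) ≤ m * k := by nlinarith
      have e1 : k * (j + 1) = k * j + k := by ring
      refine RamProg.Ends.block ?_
      rw [min_eq_left (by omega : j + 1 ≤ m)]
      refine ⟨?_, ?_, ?_⟩
      · simp [Ne.symm y3, Ne.symm y5, Ne.symm y6, Ne.symm y7, i1]
      · simp [Ne.symm z6, Ne.symm z3, Ne.symm z5, i2]
      · simp [z5, Ne.symm z3, Ne.symm z5, i1]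
        omega
    · have hjge : m ≤ j := by
        by_contra hlt
        rw [h0, min_eq_left (by omega)] at i3
        nlinarith
      refine (RamProg.Ends.block (l := []) (Q := fun u => u.reg y = s'.reg y ∧ u.reg z = s'.reg z ∧
        u.reg 41 = s'.reg 41) ?_).mono (by simp) ?_
      · simp [Ne.symm y6, Ne.symm z6]
      · rintro u - ⟨u1, u2, u3⟩
        rw [u1, u2, u3, min_eq_right (by omega : m ≤ j + 1)]
        rw [min_eq_right hjge] at i2 i3
        exact ⟨i1, i2, i3⟩
  · rintro s' - ⟨-, h, -⟩
    rw [h, min_eq_right]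
    nlinarith

end

/-! ### Coset representatives -/

section

variable {n : ℕ}

/-- The entries of `R` represent different right cosets of `H` in the group generated by `T`, and
`R` is closed under multiplication with generators, up to position `(r, t)`. -/
structure IsCosetList (H : Subgroup (Equiv.Perm (Fin n))) (T R : List (Equiv.Perm (Fin n)))
    (r t : ℕ) : Prop where
  pos : 0 < R.length
  head : R.getD 0 1 = 1
  mem : ∀ x ∈ R, x ∈ generatedGroup T
  ne : ∀ i k, i < k → k < R.length → R.getD k 1 * (R.getD i 1)⁻¹ ∉ H
  closed : ∀ i j, i < R.length → j < T.length → i < r ∨ i = r ∧ j < t →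
    ∃ k < R.length, R.getD i 1 * T.getD j 1 * (R.getD k 1)⁻¹ ∈ H

variable {H : Subgroup (Equiv.Perm (Fin n))} {T R : List (Equiv.Perm (Fin n))} {r t : ℕ}

theorem isCosetList_one : IsCosetList H T [1] 0 0 := by
  refine ⟨by simp, rfl, ?_, ?_, ?_⟩
  · intro x hx
    rw [List.mem_singleton.mp hx]
    exact one_mem _
  · intro i k hi hk
    simp at hk
    omega
  · intro i j _ _ h
    omega

theorem IsCosetList.of_found (h : IsCosetList H T R r t) {k : ℕ} (hk : k < R.length)
    (hf : R.getD r 1 * T.getD t 1 * (R.getD k 1)⁻¹ ∈ H) : IsCosetList H T R r (t + 1) := by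
  refine ⟨h.pos, h.head, h.mem, h.ne, fun i j hi hj hij => ?_⟩
  by_cases hlast : i = r ∧ j = t
  · obtain ⟨rfl, rfl⟩ := hlast
    exact ⟨k, hk, hf⟩
  · exact h.closed i j hi hj (by omega)

theorem getD_append_singleton_of_lt {α : Type*} (l : List α) (x d : α) {k : ℕ} (hk : k < l.length) :
    (l ++ [x]).getD k d = l.getD k d := List.getD_append _ _ _ _ hk

theorem getD_append_singleton_length {α : Type*} (l : List α) (x d : α) :
    (l ++ [x]).getD l.length d = x := by simp

theorem IsCosetList.append (h : IsCosetList H T R r t) (hr : r < R.length) (ht : t < T.length)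
    (hf : ∀ k < R.length, R.getD r 1 * T.getD t 1 * (R.getD k 1)⁻¹ ∉ H) :
    IsCosetList H T (R ++ [R.getD r 1 * T.getD t 1]) r (t + 1) := by
  have hlen : (R ++ [R.getD r 1 * T.getD t 1]).length = R.length + 1 := by simp
  refine ⟨by omega, ?_, ?_, ?_, ?_⟩
  · rw [getD_append_singleton_of_lt _ _ _ h.pos, h.head]
  · intro x hx
    rcases List.mem_append.mp hx with hx | hx
    · exact h.mem x hx
    · rw [List.mem_singleton.mp hx]
      refine mul_mem (h.mem _ ?_) (Subgroup.subset_closure ?_)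
      · rw [List.getD_eq_getElem _ _ hr]
        exact List.getElem_mem hr
      · rw [List.getD_eq_getElem _ _ ht]
        exact List.getElem_mem ht
  · intro i k hi hk
    rw [getD_append_singleton_of_lt _ _ _ (by omega : i < R.length)]
    rcases Nat.lt_or_ge k R.length with hk' | hk'
    · rw [getD_append_singleton_of_lt _ _ _ hk']
      exact h.ne i k hi hk'
    · rw [show k = R.length by omega, getD_append_singleton_length]
      exact hf i (by omega)
  · intro i j hi hj hij
    rcases Nat.lt_or_ge i R.length with hi' | hi'
    · rw [getD_append_singleton_of_lt _ _ _ hi']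
      by_cases hlast : i = r ∧ j = t
      · obtain ⟨rfl, rfl⟩ := hlast
        refine ⟨R.length, by omega, ?_⟩
        rw [getD_append_singleton_length, mul_inv_cancel]
        exact H.one_mem
      · obtain ⟨k, hk, hmem⟩ := h.closed i j hi' hj (by omega)
        refine ⟨k, by omega, ?_⟩
        rwa [getD_append_singleton_of_lt _ _ _ hk]
    · omega

theorem IsCosetList.next (h : IsCosetList H T R r T.length) : IsCosetList H T R (r + 1) 0 :=
  ⟨h.pos, h.head, h.mem, h.ne, fun i j hi hj _ => h.closed i j hi hj (by omega)⟩

/-- Inversion turns right cosets into left cosets, so the inverses of the entries lie in different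
classes of the quotient. -/
theorem IsCosetList.length_le (h : IsCosetList H T R r t) :
    R.length ≤ H.relIndex (generatedGroup T) := by
  have hmem : ∀ k : Fin R.length, R.getD k 1 ∈ generatedGroup T := by
    intro k
    rw [List.getD_eq_getElem _ _ k.2]
    exact h.mem _ (List.getElem_mem _)
  let f : Fin R.length → generatedGroup T ⧸ H.subgroupOf (generatedGroup T) := fun k =>
    QuotientGroup.mk ⟨(R.getD k 1)⁻¹, inv_mem (hmem k)⟩
  have hlt : ∀ i k : Fin R.length, (i : ℕ) < k → f i ≠ f k := by
    intro i k hik he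
    have := QuotientGroup.eq.mp he.symm
    rw [Subgroup.mem_subgroupOf] at this
    refine h.ne i k hik k.2 ?_
    simpa using this
  have hf : Function.Injective f := by
    intro i k he
    rcases Nat.lt_trichotomy i k with h1 | h1 | h1
    · exact absurd he (hlt i k h1)
    · exact Fin.ext h1
    · exact absurd he.symm (hlt k i h1)
  have := Nat.card_le_card_of_injective f hf
  rwa [Nat.card_eq_fintype_card, Fintype.card_fin] at this

/-- The union of the listed cosets contains `1` and is stable under right multiplication by
generators. By finiteness, products of generators exhaust the group. -/
theorem IsCosetList.covers (h : IsCosetList H T R r t) (hr : R.length ≤ r)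
    {g : Equiv.Perm (Fin n)} (hg : g ∈ generatedGroup T) :
    ∃ k < R.length, g * (R.getD k 1)⁻¹ ∈ H := by
  have hg' : g ∈ Submonoid.closure {σ | σ ∈ T} := by
    rw [← Subgroup.closure_toSubmonoid_of_finite]
    exact hg
  clear hg
  induction hg' using Submonoid.closure_induction_right with
  | one =>
    refine ⟨0, h.pos, ?_⟩
    rw [h.head, inv_one, mul_one]
    exact H.one_mem
  | mul_right x hx y hy ih =>
    obtain ⟨k, hk, hmem⟩ := ih
    obtain ⟨j, hj, rfl⟩ := List.mem_iff_getElem.mp hy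
    obtain ⟨k', hk', hmem'⟩ := h.closed k j hk hj (Or.inl (by omega))
    refine ⟨k', hk', ?_⟩
    rw [List.getD_eq_getElem T _ hj] at hmem'
    have := H.mul_mem hmem hmem'
    have he : x * (R.getD k 1)⁻¹ * (R.getD k 1 * T[j] * (R.getD k' 1)⁻¹) =
      x * T[j] * (R.getD k' 1)⁻¹ := by group
    rwa [he] at this

/-! ### Programs for coset representatives -/

/-- Write the product of the permutations at register `25` of array `6`, at register `24` of array
`1`, and of the inverse of the one at register `18` of array `6` to array `4`. -/
def loadQuotient : RamProg :=
  .loop 20 21 0 (.block [.add 22 18 20, .read 22 6 22, .add 23 24 20, .read 23 1 23,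
    .add 23 25 23, .read 23 6 23, .write 4 22 23])

/-- Set register `58` to `1` if array `4` contains the identity. -/
def testIdentity : RamProg :=
  .seq (.block [.const 59 0]) <|
    .seq (.loop 20 21 0 (.block [.read 22 4 20, .sub 23 22 20, .add 59 59 23, .sub 23 20 22,
      .add 59 59 23])) <|
    .ite 59 (.block []) (.block [.const 58 1])

/-- Set register `58` to `1` if the product is in the coset of some permutation in array `6`. -/
def searchCoset : RamProg :=
  .loop 56 57 52 <| .seq (mulProg 18 56 0) <| .seq loadQuotient <| .seq siftProg testIdentity

/-- Append the product to array `6`. -/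
def appendCoset : RamProg :=
  .seq (.loop 20 21 0 (.block [.add 23 24 20, .read 23 1 23, .add 23 25 23, .read 23 6 23,
    .push 6 23])) (.block [.const 22 1, .add 52 52 22])

/-- Append the product of entry `50` of array `6` and entry `53` of array `1` to array `6` if it is
in a new coset. -/
def extendCosets : RamProg :=
  .seq (.block [.const 58 0]) <| .seq (mulProg 25 50 0) <| .seq (mulProg 24 53 0) <|
    .seq searchCoset <| .ite 58 (.block []) appendCoset

/-- Enumerate the cosets. -/
def cosetProg : RamProg := .loop 50 51 52 (.loop 53 54 55 extendCosets)

/-- No inverse is computed: the value of `R_r T_t` at `i` is written at position `R_k i`. -/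
theorem loadQuotient_ends {L : List (Equiv.Perm (Fin n))} {g : Equiv.Perm (Fin n)} {s : RamState}
    (h : HasTable L g s) (hR : s.arr 6 = encodePerms R) (hT : s.arr 1 = encodePerms T) {k : ℕ}
    (hk : k < R.length) (hr : r < R.length) (ht : t < T.length) (h18 : s.reg 18 = k * n)
    (h25 : s.reg 25 = r * n) (h24 : s.reg 24 = t * n) :
    loadQuotient.Ends s (13 * n + 4) (HasTable L (R.getD r 1 * T.getD t 1 * (R.getD k 1)⁻¹)) := by
  refine RamProg.Ends.mono (t := n * (8 + 5) + 4) ?_ (by omega) (fun _ _ h => h)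
    (R := HasTable L (R.getD r 1 * T.getD t 1 * (R.getD k 1)⁻¹))
  refine (RamProg.Ends.loop (fun i s' => PartlySet [g] 0 (R.getD k 1)
    (R.getD r 1 * T.getD t 1 * (R.getD k 1)⁻¹) i (s'.arr 4)) (b := 8)
    h.reg rfl rfl rfl ?_ ?_ ?_).mono le_rfl ?_
  · intro j s s' h _ ha
    rwa [ha]
  · rw [h.perm]
    exact PartlySet.zero _ _ _ _
  · intro i s' f hp hi hin
    have e6 : s'.arr 6 = encodePerms R := (f.arr 6 rfl).trans hR
    have e1 : s'.arr 1 = encodePerms T := (f.arr 1 rfl).trans hT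
    have e18 : s'.reg 18 = k * n := (f.reg 18 rfl).trans h18
    have e24 : s'.reg 24 = t * n := (f.reg 24 rfl).trans h24
    have e25 : s'.reg 25 = r * n := (f.reg 25 rfl).trans h25
    refine RamProg.Ends.block ?_
    have := hp.succ (by simp) hin
    rw [permVal_mul _ _ (permVal_lt _ hin), permVal_inv_self _ hin, permVal_mul _ _ hin,
      ← getD_encodePerms R hr (permVal_lt _ hin), ← getD_encodePerms T ht hin,
      ← getD_encodePerms R hk hin] at this
    simpa [-List.getD_eq_getElem?_getD, hi, e1, e6, e18, e24, e25] using this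
  · intro s' f hp
    exact ⟨(f.reg 0 rfl).trans h.reg, h.length, (f.arr 3 rfl).trans h.table, hp.eq (by simp)⟩

/-- Register `59` sums the distances between `v` and its image. Register `58` is only ever raised,
so it accumulates the answer over the whole search. -/
theorem testIdentity_ends {L : List (Equiv.Perm (Fin n))} {g : Equiv.Perm (Fin n)} {s : RamState}
    (h : HasTable L g s) :
    testIdentity.Ends s (11 * n + 9) (fun s' => (s'.reg 58 ≠ 0 ↔ s.reg 58 ≠ 0 ∨ g = 1)) := by
  refine RamProg.Ends.mono (t := 2 + ((n * (6 + 5) + 4) + (2 + 1))) ?_ (by omega)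
    (fun _ _ h => h)
  refine RamProg.Ends.seq (RamProg.Ends.block (l := [.const 59 0]) (Q := fun s' => s'.reg 59 = 0)
    (by simp)) fun s₁ f₁ h₁ => ?_
  have t₁ := h.frame f₁ rfl rfl rfl
  refine RamProg.Ends.seq (RamProg.Ends.loop
    (fun j s' => s'.reg 59 = 0 ↔ ∀ v < j, permVal g v = v) (b := 6) t₁.reg rfl rfl rfl ?_ ?_ ?_)
    fun s₂ f₂ h₂ => ?_
  · intro j s s' h hr _
    rwa [hr 59 (by omega) (by omega) (by omega)]
  · simp [h₁]
  · intro j s' f hI hj hjn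
    have t' := t₁.frame f rfl rfl rfl
    refine RamProg.Ends.block ?_
    have hget := t'.getD_perm hjn
    rw [Nat.forall_lt_succ_right, ← hI]
    simp [-List.getD_eq_getElem?_getD, hj, hget]
    omega
  · have hg : (∀ v < n, permVal g v = v) ↔ g = 1 := by
      constructor
      · intro h
        exact perm_ext_permVal fun v hv => by rw [h v hv, permVal_one hv]
      · rintro rfl v hv
        exact permVal_one hv
    rw [hg] at h₂
    have e58 : s₂.reg 58 = s.reg 58 := (f₂.reg 58 rfl).trans (f₁.reg 58 rfl)
    refine RamProg.Ends.ite (fun hne => ?_) fun h0 => ?_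
    · refine (RamProg.Ends.block (l := []) (Q := fun s' => s'.reg 58 = s₂.reg 58) (by simp)).mono
        (by simp) fun s' _ he => ?_
      rw [he, e58]
      tauto
    · refine RamProg.Ends.block (l := [.const 58 1]) ?_
      simp [h₂.mp h0]

/-- Steps for sifting without insertion, starting from a product. -/
def quotientTime (n B : ℕ) : ℕ := (7 * B + 6) + ((13 * n + 4) + (siftTime n + (11 * n + 9)))

theorem searchCoset_ends {L : List (Equiv.Perm (Fin n))} {s : RamState} (h : HasSomeTable L s)
    (hR : s.arr 6 = encodePerms R) (hT : s.arr 1 = encodePerms T) (hr : r < R.length)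
    (ht : t < T.length) (h25 : s.reg 25 = r * n) (h24 : s.reg 24 = t * n)
    (h52 : s.reg 52 = R.length) (h58 : s.reg 58 = 0) :
    searchCoset.Ends s (R.length * (quotientTime n R.length + 5) + 4) (fun s' => HasSomeTable L s' ∧
      (s'.reg 58 ≠ 0 ↔ ∃ k < R.length,
        sift L n (R.getD r 1 * T.getD t 1 * (R.getD k 1)⁻¹) = 1)) := by
  refine RamProg.Ends.loop (fun j s' => HasSomeTable L s' ∧ (s'.reg 58 ≠ 0 ↔ ∃ k < j,
        sift L n (R.getD r 1 * T.getD t 1 * (R.getD k 1)⁻¹) = 1)) h52 rfl rfl rfl ?_ ?_ ?_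
  · rintro j s s' ⟨h1, h2⟩ hr ha
    refine ⟨HasSomeTable.ignoresRegs (by omega) (by omega) (fun _ => L) j s s' h1 hr ha, ?_⟩
    rwa [hr 58 (by omega) (by omega) (by omega)]
  · exact ⟨h, by simp [h58]⟩
  · rintro j s₁ f₁ ⟨⟨g, h₁⟩, hf⟩ hj hjR
    have hmul := mulProg_ends (z := 18) (x := 56) (y := 0) (by omega) (by omega) (by omega)
      (by omega) (by omega) s₁
    rw [hj, h₁.reg] at hmul
    have e6 : s₁.arr 6 = encodePerms R := (f₁.arr 6 rfl).trans hR
    have e1 : s₁.arr 1 = encodePerms T := (f₁.arr 1 rfl).trans hT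
    refine RamProg.Ends.seq (hmul.mono (by omega : _ ≤ 7 * R.length + 6) fun _ _ h => h)
      fun s₂ f₂ h₂ => ?_
    have t₂ := h₁.frame f₂ rfl rfl rfl
    have := loadQuotient_ends (r := r) (t := t) t₂ ((f₂.arr 6 rfl).trans e6)
      ((f₂.arr 1 rfl).trans e1) hjR hr ht h₂ ((f₂.reg 25 rfl).trans ((f₁.reg 25 rfl).trans h25))
      ((f₂.reg 24 rfl).trans ((f₁.reg 24 rfl).trans h24))
    refine RamProg.Ends.seq this fun s₃ f₃ h₃ => ?_
    refine RamProg.Ends.seq ((siftProg_ends h₃).mono (by rw [siftTime]; gcongr <;> omega)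
      fun _ _ h => h) fun s₄ f₄ h₄ => ?_
    refine (testIdentity_ends h₄).mono le_rfl fun s₅ f₅ h₅ => ⟨⟨_, h₄.frame f₅ rfl rfl rfl⟩, ?_⟩
    rw [h₅, f₄.reg 58 rfl, f₃.reg 58 rfl, f₂.reg 58 rfl, hf, Nat.exists_lt_succ_right]

theorem appendCoset_ends {s : RamState} (h0 : s.reg 0 = n)
    (hR : s.arr 6 = encodePerms R) (hT : s.arr 1 = encodePerms T) (hr : r < R.length)
    (ht : t < T.length) (h25 : s.reg 25 = r * n) (h24 : s.reg 24 = t * n)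
    (h52 : s.reg 52 = R.length) :
    appendCoset.Ends s (11 * n + 7) (fun s' =>
      s'.arr 6 = encodePerms (R ++ [R.getD r 1 * T.getD t 1]) ∧
      s'.reg 52 = (R ++ [R.getD r 1 * T.getD t 1]).length) := by
  refine RamProg.Ends.mono (t := (n * (6 + 5) + 4) + 3) ?_ (by omega) (fun _ _ h => h)
  refine RamProg.Ends.seq (RamProg.Ends.loop (fun j s' => s'.arr 6 = encodePerms R ++
    (List.range j).map (permVal (R.getD r 1 * T.getD t 1))) (b := 6) h0 rfl rfl rfl ?_ ?_ ?_)
    fun s₁ f₁ h₁ => ?_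
  · intro j s s' h _ ha
    rwa [ha]
  · simp [hR]
  · intro j s' f h hj hjn
    have e1 : s'.arr 1 = encodePerms T := (f.arr 1 rfl).trans hT
    have e24 : s'.reg 24 = t * n := (f.reg 24 rfl).trans h24
    have e25 : s'.reg 25 = r * n := (f.reg 25 rfl).trans h25
    refine RamProg.Ends.block ?_
    -- Array `6` grows while it is being read; the entry `r` lies in its old part.
    have hlt : r * n + permVal (T.getD t 1) j < (encodePerms R).length := by
      have := permVal_lt (T.getD t 1) hjn
      rw [length_encodePerms]
      nlinarith
    have : (s'.arr 6).getD (r * n + permVal (T.getD t 1) j) 0 =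
        permVal (R.getD r 1 * T.getD t 1) j := by
      rw [h, List.getD_append _ _ _ _ hlt, getD_encodePerms R hr (permVal_lt _ hjn),
        permVal_mul _ _ hjn]
    rw [← getD_encodePerms T ht hjn] at this
    simp [-List.getD_eq_getElem?_getD, hj, e1, e24, e25, this, List.range_succ]
    rw [h, List.append_assoc]
  · refine RamProg.Ends.block ?_
    have e : encodePerms (R ++ [R.getD r 1 * T.getD t 1]) =
        encodePerms R ++ (List.range n).map (permVal (R.getD r 1 * T.getD t 1)) := by
      rw [encodePerms_append]
      congr 1
      symm
      refine encodePerms_one_list (by simp) fun v hv => ?_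
      rw [List.getD_eq_getElem _ _ (by simpa using hv)]
      simp
    rw [e]
    simp [-List.getD_eq_getElem?_getD, h₁, f₁.reg 52 rfl, h52]

/-- Steps for one attempt to extend the list of representatives. -/
def extendTime (n B m : ℕ) : ℕ :=
  2 + ((7 * B + 6) + ((7 * m + 6) + ((B * (quotientTime n B + 5) + 4) + ((11 * n + 7) + 1))))

theorem quotientTime_mono (n : ℕ) {B B' : ℕ} (h : B ≤ B') :
    quotientTime n B ≤ quotientTime n B' := by
  rw [quotientTime, quotientTime]
  omega

/-- Array `3` contains the table `L`, and array `6` the representatives `R`. -/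
def HasCosets (L R : List (Equiv.Perm (Fin n))) (s : RamState) : Prop :=
  HasSomeTable L s ∧ s.arr 6 = encodePerms R ∧ s.reg 52 = R.length

theorem extendCosets_ends {L : List (Equiv.Perm (Fin n))} {s : RamState} {B : ℕ}
    (hL : ∀ g, g ∈ H ↔ sift L n g = 1) (h : HasCosets L R s) (hc : IsCosetList H T R r t)
    (hT : s.arr 1 = encodePerms T) (hr : r < R.length) (ht : t < T.length) (hs : s.reg 50 = r)
    (hs' : s.reg 53 = t) (hB : R.length ≤ B) :
    extendCosets.Ends s (extendTime n B T.length) (fun s' => ∃ R', HasCosets L R' s' ∧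
      R.length ≤ R'.length ∧ IsCosetList H T R' r (t + 1)) := by
  obtain ⟨⟨g, h⟩, hR, hlen⟩ := h
  refine RamProg.Ends.seq (RamProg.Ends.block (l := [.const 58 0])
    (Q := fun s' => s'.reg 58 = 0) (by simp)) fun s₁ f₁ h₁ => ?_
  have t₁ := h.frame f₁ rfl rfl rfl
  have hmul := mulProg_ends (z := 25) (x := 50) (y := 0) (by omega) (by omega) (by omega)
    (by omega) (by omega) s₁
  rw [f₁.reg 50 rfl, hs, t₁.reg] at hmul
  refine RamProg.Ends.seq (hmul.mono (by omega) fun _ _ h => h) fun s₂ f₂ h₂ => ?_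
  have t₂ := t₁.frame f₂ rfl rfl rfl
  have hmul := mulProg_ends (z := 24) (x := 53) (y := 0) (by omega) (by omega) (by omega)
    (by omega) (by omega) s₂
  rw [f₂.reg 53 rfl, f₁.reg 53 rfl, hs', t₂.reg] at hmul
  refine RamProg.Ends.seq (hmul.mono (by omega) fun _ _ h => h) fun s₃ f₃ h₃ => ?_
  have t₃ := t₂.frame f₃ rfl rfl rfl
  have e6 : s₃.arr 6 = encodePerms R :=
    (f₃.arr 6 rfl).trans ((f₂.arr 6 rfl).trans ((f₁.arr 6 rfl).trans hR))
  have e1 : s₃.arr 1 = encodePerms T :=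
    (f₃.arr 1 rfl).trans ((f₂.arr 1 rfl).trans ((f₁.arr 1 rfl).trans hT))
  have e52 : s₃.reg 52 = R.length :=
    (f₃.reg 52 rfl).trans ((f₂.reg 52 rfl).trans ((f₁.reg 52 rfl).trans hlen))
  have e58 : s₃.reg 58 = 0 := (f₃.reg 58 rfl).trans ((f₂.reg 58 rfl).trans h₁)
  have e25 : s₃.reg 25 = r * n := (f₃.reg 25 rfl).trans h₂
  refine RamProg.Ends.seq ((searchCoset_ends ⟨_, t₃⟩ e6 e1 hr ht e25 h₃ e52 e58).mono ?_
    fun _ _ h => h) fun s₄ f₄ h₄ => ?_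
  · have := quotientTime_mono n hB
    gcongr
  obtain ⟨t₄, h₄⟩ := h₄
  have e6' : s₄.arr 6 = encodePerms R := (f₄.arr 6 rfl).trans e6
  have e52' : s₄.reg 52 = R.length := (f₄.reg 52 rfl).trans e52
  refine RamProg.Ends.ite (fun hne => ?_) fun h0 => ?_
  · obtain ⟨k, hk, hf⟩ := h₄.mp hne
    refine (RamProg.Ends.block (l := []) (Q := fun s' => s' = s₄.execs []) rfl).mono
      (by simp) fun s' f' he => ⟨R, ⟨?_, ?_, ?_⟩, le_rfl, hc.of_found hk ((hL _).mpr hf)⟩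
    · exact t₄.frame f' rfl rfl rfl
    · rw [f'.arr 6 rfl, e6']
    · rw [f'.reg 52 rfl, e52']
  · have e0 : s₄.reg 0 = n := (f₄.reg 0 rfl).trans t₃.reg
    refine (appendCoset_ends e0 e6' ((f₄.arr 1 rfl).trans e1) hr ht ((f₄.reg 25 rfl).trans e25)
      ((f₄.reg 24 rfl).trans h₃) e52').mono le_rfl fun s' f' h' => ⟨_, ⟨?_, h'⟩, by simp, ?_⟩
    · exact t₄.frame f' rfl rfl rfl
    · refine hc.append hr ht fun k hk hmem => ?_
      exact (h₄.mpr ⟨k, hk, (hL _).mp hmem⟩) h0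

theorem cosetProg_ends {L : List (Equiv.Perm (Fin n))} {s : RamState} {B : ℕ}
    (hL : ∀ g, g ∈ H ↔ sift L n g = 1) (h : HasCosets L [1] s)
    (hT : s.arr 1 = encodePerms T) (h55 : s.reg 55 = T.length)
    (hB : H.relIndex (generatedGroup T) = B) :
    cosetProg.Ends s (B * ((T.length * (extendTime n B T.length + 5) + 4) + 5) + 4)
      (fun s' => ∃ R, HasCosets L R s' ∧ R.length ≤ B ∧ (∀ x ∈ R, x ∈ generatedGroup T) ∧
        ∀ g ∈ generatedGroup T, ∃ k < R.length, g * (R.getD k 1)⁻¹ ∈ H) := by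
  have hign : ∀ (i c : ℕ), i ≠ 0 → c ≠ 0 → i ≠ 52 → c ≠ 52 → ∀ (R : List (Equiv.Perm (Fin n)))
      (s s' : RamState), HasCosets L R s → (∀ x, x ≠ i → x ≠ c → x ≠ 99 → s'.reg x = s.reg x) →
      s'.arr = s.arr → HasCosets L R s' := by
    rintro i c h1 h2 h3 h4 R s s' ⟨i1, i2, i3⟩ hr ha
    exact ⟨HasSomeTable.ignoresRegs h1 h2 (fun _ => L) 0 s s' i1 hr ha, by rw [ha, i2],
      by rw [hr 52 h3.symm h4.symm (by omega), i3]⟩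
  -- The bound of the outer loop is the current number of representatives, which grows during the
  -- loop but never exceeds the index.
  refine (RamProg.Ends.loop_le
    (I := fun r s' => ∃ R, HasCosets L R s' ∧ IsCosetList H T R r 0) B
    (T.length * (extendTime n B T.length + 5) + 4) rfl rfl ?_ ?_ ?_ ?_).mono le_rfl ?_
  · rintro j s s' ⟨R, h1, h2⟩ hr ha
    exact ⟨R, hign 50 51 (by omega) (by omega) (by omega) (by omega) R s s' h1 hr ha, h2⟩
  · exact ⟨[1], h, isCosetList_one⟩
  · rintro j s ⟨R, h1, h2⟩
    rw [h1.2.2, ← hB]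
    exact h2.length_le
  · rintro r s₁ f₁ ⟨R, h₁, hc⟩ hr hlt
    rw [h₁.2.2] at hlt
    refine (RamProg.Ends.loop (fun t s' => ∃ R, HasCosets L R s' ∧ r < R.length ∧
      IsCosetList H T R r t) ((f₁.reg 55 rfl).trans h55) rfl rfl rfl ?_ ⟨R, h₁, hlt, hc⟩ ?_).mono
      le_rfl ?_
    · rintro j s s' ⟨R, h1, h2⟩ hr ha
      exact ⟨R, hign 53 54 (by omega) (by omega) (by omega) (by omega) R s s' h1 hr ha, h2⟩
    · rintro t s₂ f₂ ⟨R₂, h₂, hlt₂, hc₂⟩ ht htT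
      refine (extendCosets_ends hL h₂ hc₂ ((f₂.arr 1 rfl).trans ((f₁.arr 1 rfl).trans hT)) hlt₂ htT
        ((f₂.reg 50 rfl).trans hr) ht (hB ▸ hc₂.length_le)).mono le_rfl ?_
      rintro s₃ - ⟨R₃, h₃, hle, hc₃⟩
      exact ⟨R₃, h₃, by omega, hc₃⟩
    · rintro s₂ - ⟨R₂, h₂, hlt₂, hc₂⟩
      exact ⟨R₂, h₂, hc₂.next⟩
  · rintro s' - ⟨r, ⟨R, h₁, hc⟩, hle⟩
    rw [h₁.2.2] at hle
    exact ⟨R, h₁, hB ▸ hc.length_le, hc.mem, fun g hg => hc.covers hle hg⟩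

end

/-! ### Lists of gates -/

/-- The values of all gates, in order. -/
def gateValues {V : Type} (gs : List (Gate V)) (θ : V → Bool) : List Bool :=
  gs.foldl (fun vals g => vals ++ [g.value θ vals]) []

@[simp]
theorem gateValues_nil {V : Type} (θ : V → Bool) : gateValues [] θ = [] := rfl

theorem gateValues_concat {V : Type} (gs : List (Gate V)) (g : Gate V) (θ : V → Bool) :
    gateValues (gs ++ [g]) θ = gateValues gs θ ++ [g.value θ (gateValues gs θ)] := by
  simp [gateValues, List.foldl_append]

@[simp]
theorem length_gateValues {V : Type} (gs : List (Gate V)) (θ : V → Bool) :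
    (gateValues gs θ).length = gs.length := by
  induction gs using List.reverseRecOn with
  | nil => rfl
  | append_singleton gs g ih => simp [gateValues_concat, ih]

/-- The value of the gate at position `k`. -/
def gateValue {V : Type} (gs : List (Gate V)) (θ : V → Bool) (k : ℕ) : Bool :=
  (gateValues gs θ).getD k false

theorem gateValue_append {V : Type} (gs gs' : List (Gate V)) (θ : V → Bool) {k : ℕ}
    (hk : k < gs.length) : gateValue (gs ++ gs') θ k = gateValue gs θ k := by
  induction gs' using List.reverseRecOn with
  | nil => rw [List.append_nil]
  | append_singleton gs' g ih =>
    rw [← List.append_assoc, gateValue, gateValues_concat, List.getD_append _ _ _ _ (by simp; omega)]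
    exact ih

theorem gateValue_concat {V : Type} (gs : List (Gate V)) (g : Gate V) (θ : V → Bool) :
    gateValue (gs ++ [g]) θ gs.length = g.value θ (gateValues gs θ) := by
  rw [gateValue, gateValues_concat, List.getD_append_right _ _ _ _ (by simp)]
  simp

theorem Circuit.eval_eq {V : Type} (C : Circuit V) (θ : V → Bool) :
    C.eval θ = gateValue C.gates θ (C.gates.length - 1) := by
  have h : C.values θ = gateValues C.gates θ := rfl
  rw [Circuit.eval, gateValue, h, ← length_gateValues C.gates θ, List.getLastD_eq_getLast?,
    List.getLast?_eq_getElem?, List.getD_eq_getElem?_getD]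

/-- All gates refer to earlier gates. -/
def IsWired {V : Type} (gs : List (Gate V)) : Prop :=
  ∀ (k : ℕ) (hk : k < gs.length), gs[k].RefersBelow k

theorem IsWired.concat {V : Type} {gs : List (Gate V)} (h : IsWired gs) {g : Gate V}
    (hg : g.RefersBelow gs.length) : IsWired (gs ++ [g]) := by
  intro k hk
  rw [List.getElem_append]
  split_ifs with hk'
  · exact h k hk'
  · have : k = gs.length := by simp at hk; omega
    subst this
    simpa using hg

/-- The gate at position `k` computes the predicate `Φ`. -/
structure GateComputes (gs : List (Gate ℕ)) (k : ℕ) (Φ : (ℕ → Bool) → Prop) : Prop where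
  lt : k < gs.length
  iff : ∀ ν, gateValue gs ν k = true ↔ Φ ν

/-- Gates see only earlier gates, so appending further ones does not affect values already computed.
-/
theorem GateComputes.mono {gs gs' : List (Gate ℕ)} {k : ℕ} {Φ : (ℕ → Bool) → Prop}
    (h : GateComputes gs k Φ) (hgs : gs <+: gs') : GateComputes gs' k Φ := by
  obtain ⟨l, rfl⟩ := hgs
  exact ⟨by rw [List.length_append]; have := h.lt; omega,
    fun ν => by rw [gateValue_append _ _ _ h.lt, h.iff]⟩

theorem GateComputes.congr {gs : List (Gate ℕ)} {k : ℕ} {Φ Ψ : (ℕ → Bool) → Prop}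
    (h : GateComputes gs k Φ) (hΦ : ∀ ν, Φ ν ↔ Ψ ν) : GateComputes gs k Ψ :=
  ⟨h.lt, fun ν => (h.iff ν).trans (hΦ ν)⟩

/-- Array `2` contains the gates `gs`, with variables below `B`, and register `60` their number. -/
structure HasGates (B : ℕ) (gs : List (Gate ℕ)) (s : RamState) : Prop where
  arr : s.arr 2 = gs.flatMap (Gate.encode id)
  reg : s.reg 60 = gs.length
  wired : IsWired gs
  lt : ∀ x, Gate.var x ∈ gs → x < B

theorem HasGates.of_eq {B : ℕ} {gs : List (Gate ℕ)} {s s' : RamState} (h : HasGates B gs s)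
    (ha : s'.arr 2 = s.arr 2) (hr : s'.reg 60 = s.reg 60) : HasGates B gs s' :=
  ⟨ha.trans h.arr, hr.trans h.reg, h.wired, h.lt⟩

theorem HasGates.frame {P : RamProg} {B : ℕ} {gs : List (Gate ℕ)} {s s' : RamState}
    (h : HasGates B gs s) (f : Frame P s s') (ha : P.writesArr 2 = false)
    (hr : P.writesReg 60 = false) : HasGates B gs s' :=
  h.of_eq (f.arr 2 ha) (f.reg 60 hr)

/-! ### Writing gates -/

/-- Append a gate; register `62` stands for a missing argument. The position of the new gate is
stored in register `d`. -/
def emitGate (op a b d : ℕ) : RamProg :=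
  .block [.const 62 0, .const 61 op, .push 2 61, .push 2 a, .push 2 b, .const 61 0, .add d 60 61,
    .const 61 1, .add 60 60 61]

theorem emitGate_ends {B : ℕ} {gs : List (Gate ℕ)} {s : RamState} (h : HasGates B gs s)
    {op a b d : ℕ} {g : Gate ℕ} (ha : a ≠ 61 ∧ a ≠ 62) (hb : b ≠ 61) (hd : 70 ≤ d)
    (hd9 : d ≠ 99)
    (hg : g.encode id = [op, s.reg a, if b = 62 then 0 else s.reg b])
    (hw : g.RefersBelow gs.length) (hB : ∀ x, g = .var x → x < B) :
    (emitGate op a b d).Ends s 10 (fun s' => HasGates B (gs ++ [g]) s' ∧ s'.reg d = gs.length) := by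
  refine RamProg.Ends.block ⟨⟨?_, ?_, h.wired.concat hw, ?_⟩, ?_⟩
  · rw [List.flatMap_append, List.flatMap_singleton, hg, ← h.arr]
    simp [ha.1, ha.2, hb]
  · simp [h.reg, show (60 : ℕ) ≠ d by omega]
  · intro x hx
    rcases List.mem_append.mp hx with hx | hx
    · exact h.lt x hx
    · exact hB x (List.mem_singleton.mp hx).symm
  · simp [h.reg, hd9, show d ≠ 60 by omega, show d ≠ 61 by omega]

/-- Formulas over variables and gates whose names and positions are in registers. -/
inductive Form where
  | var (x : ℕ)
  | wire (r : ℕ)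
  | not (F : Form)
  | and (F G : Form)
  | or (F G : Form)

def Form.size : Form → ℕ
  | .var _ => 1
  | .wire _ => 1
  | .not F => F.size + 1
  | .and F G => F.size + G.size + 1
  | .or F G => F.size + G.size + 1

/-- Write a circuit for a formula. The position of its output gate is stored in register `d`. -/
def emitForm (d : ℕ) : Form → RamProg
  | .var x => emitGate 0 x 62 d
  | .wire r => .block [.const 61 0, .add d r 61]
  | .not F => .seq (emitForm d F) (emitGate 1 d 62 d)
  | .and F G => .seq (emitForm d F) (.seq (emitForm (d + 1) G) (emitGate 2 d (d + 1) d))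
  | .or F G => .seq (emitForm d F) (.seq (emitForm (d + 1) G) (emitGate 3 d (d + 1) d))

/-- The meaning of a formula. -/
inductive Form.Means (B : ℕ) (gs : List (Gate ℕ)) (reg : ℕ → ℕ) :
    Form → ((ℕ → Bool) → Prop) → Prop
  | var {x : ℕ} : x < 60 → reg x < B → Means B gs reg (.var x) (fun ν => ν (reg x) = true)
  | wire {r : ℕ} {Φ : (ℕ → Bool) → Prop} : r < 60 → GateComputes gs (reg r) Φ →
      Means B gs reg (.wire r) Φ
  | not {F : Form} {Φ : (ℕ → Bool) → Prop} : Means B gs reg F Φ →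
      Means B gs reg (.not F) (fun ν => ¬Φ ν)
  | and {F G : Form} {Φ Ψ : (ℕ → Bool) → Prop} : Means B gs reg F Φ → Means B gs reg G Ψ →
      Means B gs reg (.and F G) (fun ν => Φ ν ∧ Ψ ν)
  | or {F G : Form} {Φ Ψ : (ℕ → Bool) → Prop} : Means B gs reg F Φ → Means B gs reg G Ψ →
      Means B gs reg (.or F G) (fun ν => Φ ν ∨ Ψ ν)

theorem emitGate_frame {op a b d : ℕ} {s s' : RamState} (f : Frame (emitGate op a b d) s s')
    (hd : d < 99) {x : ℕ} (hx : x < d) (hx' : x < 60 ∨ 70 ≤ x) : s'.reg x = s.reg x := by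
  refine f.reg x ?_
  simp [emitGate, RamProg.block, RamProg.writesReg, RamInstr.writesReg]
  omega

/-- Appending a NOT-, AND- or OR-gate. -/
theorem GateComputes.concat {gs : List (Gate ℕ)} {g : Gate ℕ} {Φ : (ℕ → Bool) → Prop}
    (h : ∀ ν, g.value ν (gateValues gs ν) = true ↔ Φ ν) :
    GateComputes (gs ++ [g]) gs.length Φ :=
  ⟨by simp, fun ν => by rw [gateValue_concat, h]⟩

/-- The registers from `d` on serve as a stack: the left operand waits in `d` while the right one is
computed from `d + 1` on. Variable names and wires sit below `60`, where nothing is written, so the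
meaning of the formula persists while gates are added; the bound `90` keeps the stack away from
scratch register `99`. -/
theorem emitForm_ends {B : ℕ} {gs : List (Gate ℕ)} {reg : ℕ → ℕ} {F : Form}
    {Φ : (ℕ → Bool) → Prop} (hF : F.Means B gs reg Φ) :
    ∀ (gs₁ : List (Gate ℕ)) (s : RamState) (d : ℕ), gs <+: gs₁ → (∀ x < 60, s.reg x = reg x) →
      HasGates B gs₁ s → 70 ≤ d → d + F.size ≤ 90 →
    (emitForm d F).Ends s (10 * F.size) (fun s' => ∃ gs', gs₁ <+: gs' ∧ HasGates B gs' s' ∧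
      GateComputes gs' (s'.reg d) Φ ∧ ∀ x < d, x < 60 ∨ 70 ≤ x → s'.reg x = s.reg x) := by
  -- One argument for both binary gates, abstracted over the constructor `mk` and its truth table.
  have hbin : ∀ (op : ℕ) (F G : Form) (Φ Ψ Ξ : (ℕ → Bool) → Prop) (mk : ℕ → ℕ → Gate ℕ)
      (gs₁ : List (Gate ℕ)) (s : RamState) (d : ℕ), (∀ x < 60, s.reg x = reg x) →
      70 ≤ d → d + (F.size + G.size + 1) ≤ 90 →
      (∀ i j, (mk i j).encode id = [op, i, j] ∧
        (∀ k, (mk i j).RefersBelow k ↔ i < k ∧ j < k) ∧ ∀ x, mk i j ≠ .var x) →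
      (∀ gs i j, GateComputes gs i Φ → GateComputes gs j Ψ → ∀ ν,
        (mk i j).value ν (gateValues gs ν) = true ↔ Ξ ν) →
      ((emitForm d F).Ends s (10 * F.size) (fun s' => ∃ gs', gs₁ <+: gs' ∧ HasGates B gs' s' ∧
        GateComputes gs' (s'.reg d) Φ ∧ ∀ x < d, x < 60 ∨ 70 ≤ x → s'.reg x = s.reg x)) →
      (∀ (gs₂ : List (Gate ℕ)) (s₁ : RamState), gs₁ <+: gs₂ → (∀ x < 60, s₁.reg x = reg x) →
        HasGates B gs₂ s₁ → (emitForm (d + 1) G).Ends s₁ (10 * G.size) (fun s' => ∃ gs',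
          gs₂ <+: gs' ∧ HasGates B gs' s' ∧ GateComputes gs' (s'.reg (d + 1)) Ψ ∧
          ∀ x < d + 1, x < 60 ∨ 70 ≤ x → s'.reg x = s₁.reg x)) →
      (RamProg.seq (emitForm d F) (.seq (emitForm (d + 1) G) (emitGate op d (d + 1) d))).Ends s
        (10 * (F.size + G.size + 1)) (fun s' => ∃ gs', gs₁ <+: gs' ∧ HasGates B gs' s' ∧
          GateComputes gs' (s'.reg d) Ξ ∧ ∀ x < d, x < 60 ∨ 70 ≤ x → s'.reg x = s.reg x) := by
    intro op F G Φ Ψ Ξ mk gs₁ s d hreg hd hsize hmk hval hF hG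
    refine RamProg.Ends.mono (t := 10 * F.size + (10 * G.size + 10)) ?_ (by omega)
      (fun _ _ h => h)
    refine RamProg.Ends.seq hF fun s₁ _ ⟨gs₂, p₂, h₂, c₂, r₂⟩ => ?_
    refine RamProg.Ends.seq (hG gs₂ s₁ p₂ (fun x hx => ?_) h₂) fun s₂ _ ⟨gs₃, p₃, h₃, c₃, r₃⟩ => ?_
    · rw [r₂ x (by omega) (by omega), hreg x hx]
    have c₂' := c₂.mono p₃
    rw [← r₃ d (by omega) (by omega)] at c₂'
    obtain ⟨m1, m2, m3⟩ := hmk (s₂.reg d) (s₂.reg (d + 1))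
    refine (emitGate_ends h₃ (g := mk (s₂.reg d) (s₂.reg (d + 1))) (by omega) (by omega) hd
      (by omega) ?_ ((m2 _).mpr ⟨c₂'.lt, c₃.lt⟩) fun x hx => absurd hx (m3 x)).mono le_rfl ?_
    · rw [m1, if_neg (by omega)]
    · rintro s₃ f ⟨h₄, e⟩
      refine ⟨_, p₂.trans (p₃.trans (List.prefix_append _ _)), h₄, ?_, fun x hx hx' => ?_⟩
      · rw [e]
        exact .concat (hval _ _ _ c₂' c₃)
      · rw [emitGate_frame f (by omega) hx hx', r₃ x (by omega) hx', r₂ x hx hx']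
  induction hF with
  | @var x hx hlt =>
    intro gs₁ s d hp hreg h hd hsize
    have hsz : (Form.var x).size = 1 := rfl
    rw [← hreg x hx] at hlt ⊢
    refine (emitGate_ends h (g := .var (s.reg x)) (by omega) (by omega) hd
      (by omega) (by simp [Gate.encode]) trivial ?_).mono le_rfl ?_
    · rintro y hy
      cases hy
      exact hlt
    · rintro s' f ⟨h', e⟩
      refine ⟨_, List.prefix_append _ _, h', ?_, fun x hx hx' =>
        emitGate_frame f (by omega) hx hx'⟩
      rw [e]
      exact .concat fun ν => Iff.rfl
  | @wire r Φ hr hc =>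
    intro gs₁ s d hp hreg h hd hsize
    have hsz : (Form.wire r).size = 1 := rfl
    refine (RamProg.Ends.block (l := [.const 61 0, .add d r 61]) (Q := fun s' =>
      s' = s.execs [.const 61 0, .add d r 61]) rfl).mono (by simp [hsz]) ?_
    rintro s' - rfl
    refine ⟨gs₁, List.prefix_refl _, h.of_eq (by simp) ?_, ?_, ?_⟩
    · simp [show (60 : ℕ) ≠ d by omega]
    · have : (s.execs [.const 61 0, .add d r 61]).reg d = reg r := by
        simp [show d ≠ 99 by omega, show r ≠ 61 by omega, hreg r hr]
      rw [this]
      exact hc.mono hp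
    · intro x hx hx'
      simp [show x ≠ 99 by omega, show x ≠ d by omega, show x ≠ 61 by omega]
  | @not F Φ _ ih =>
    intro gs₁ s d hp hreg h hd hsize
    have hsz : F.not.size = F.size + 1 := rfl
    rw [hsz] at hsize ⊢
    refine RamProg.Ends.mono (t := 10 * F.size + 10) ?_ (by omega) (fun _ _ h => h)
    refine RamProg.Ends.seq (ih gs₁ s d hp hreg h hd (by omega)) fun s₁ _ ⟨gs₂, p₂, h₂, c₂, r₂⟩ => ?_
    refine (emitGate_ends h₂ (g := .not (s₁.reg d)) (by omega) (by omega) hd (by omega)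
      (by simp [Gate.encode]) c₂.lt fun x hx => by cases hx).mono le_rfl ?_
    rintro s₃ f ⟨h₄, e⟩
    refine ⟨_, p₂.trans (List.prefix_append _ _), h₄, ?_, fun x hx hx' => ?_⟩
    · rw [e]
      refine .concat fun ν => ?_
      have := c₂.iff ν
      rw [gateValue] at this
      rw [← this]
      simp [Gate.value]
    · rw [emitGate_frame f (by omega) hx hx', r₂ x hx hx']
  | @and F G Φ Ψ _ _ ihF ihG =>
    intro gs₁ s d hp hreg h hd hsize
    have hsz : (F.and G).size = F.size + G.size + 1 := rfl
    rw [hsz] at hsize ⊢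
    refine hbin 2 F G Φ Ψ _ .and gs₁ s d hreg hd hsize
      (fun i j => ⟨rfl, fun k => Iff.rfl, fun x hx => by cases hx⟩) ?_
      (ihF gs₁ s d hp hreg h hd (by omega))
      (fun gs₂ s₁ p₂ r₁ h₂ => ihG gs₂ s₁ (d + 1) (hp.trans p₂) r₁ h₂ (by omega) (by omega))
    intro gs i j hi hj ν
    rw [← hi.iff ν, ← hj.iff ν]
    simp [Gate.value, gateValue]
  | @or F G Φ Ψ _ _ ihF ihG =>
    intro gs₁ s d hp hreg h hd hsize
    have hsz : (F.or G).size = F.size + G.size + 1 := rfl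
    rw [hsz] at hsize ⊢
    refine hbin 3 F G Φ Ψ _ .or gs₁ s d hreg hd hsize
      (fun i j => ⟨rfl, fun k => Iff.rfl, fun x hx => by cases hx⟩) ?_
      (ihF gs₁ s d hp hreg h hd (by omega))
      (fun gs₂ s₁ p₂ r₁ h₂ => ihG gs₂ s₁ (d + 1) (hp.trans p₂) r₁ h₂ (by omega) (by omega))
    intro gs i j hi hj ν
    rw [← hi.iff ν, ← hj.iff ν]
    simp [Gate.value, gateValue]

/-- Write a circuit for a formula and store the position of its output gate in register `r`. -/
def assignForm (r : ℕ) (F : Form) : RamProg :=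
  .seq (emitForm 70 F) (.block [.const 61 0, .add r 70 61])

theorem assignForm_ends {B : ℕ} {gs : List (Gate ℕ)} {s : RamState} {F : Form}
    {Φ : (ℕ → Bool) → Prop} (hF : F.Means B gs s.reg Φ) (h : HasGates B gs s) (r : ℕ) (hr : r < 60)
    (hsize : F.size ≤ 20) :
    (assignForm r F).Ends s (10 * F.size + 3) (fun s' => ∃ gs', gs <+: gs' ∧ HasGates B gs' s' ∧
      GateComputes gs' (s'.reg r) Φ) := by
  refine RamProg.Ends.seq (emitForm_ends hF gs s 70 (List.prefix_refl _) (fun _ _ => rfl) h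
    le_rfl (by omega)) fun s₁ _ ⟨gs', p, h', c, _⟩ => RamProg.Ends.block ⟨gs', p, h'.of_eq ?_ ?_, ?_⟩
  · simp
  · simp [show (60 : ℕ) ≠ r by omega]
  · simpa [show r ≠ 99 by omega] using c

/-! ### Circuits for permuted assignments -/

section

variable {n B : ℕ}

/-- The gates written so far contain the constants, in registers `2` and `3`, and a gate for `Φ`, in
register `4`. -/
structure HasConstraint (B : ℕ) (Φ : (ℕ → Bool) → Prop) (gs : List (Gate ℕ)) (s : RamState) :
    Prop where
  gates : HasGates B gs s
  bot : GateComputes gs (s.reg 2) (fun _ => False)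
  top : GateComputes gs (s.reg 3) (fun _ => True)
  acc : GateComputes gs (s.reg 4) Φ

/-- `y` is the assignment `x` permuted by `w`, for the assignments in the blocks at `src` and `dst`. -/
def BlockMap (w : Equiv.Perm (Fin n)) (src dst : ℕ) (ν : ℕ → Bool) : Prop :=
  ∀ v < n, ν (dst + permVal w v) = ν (src + v)

/-- Equality of two variables, together with the gate in register `6`. -/
def equalForm : Form :=
  .and (.wire 6) (.or (.and (.var 8) (.var 9)) (.not (.or (.var 8) (.var 9))))

/-- A gate in register `6` for the permutation at register `24` of array `a`. -/
def permCircuit (a : ℕ) : RamProg :=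
  .seq (.block [.const 61 0, .add 6 3 61]) <|
    .loop 20 21 0 <| .seq (.block [.add 22 24 20, .read 22 a 22, .add 8 27 22, .add 9 26 20])
      (assignForm 6 equalForm)

/-- Require that the block at register `27` is the block at register `26` permuted by one of the
permutations from register `24` on in array `a`; their number is in register `25`. -/
def permsCircuit (a : ℕ) : RamProg :=
  .seq (.block [.const 61 0, .add 5 2 61]) <|
    .seq (.loop 28 29 25 <| .seq (permCircuit a) <|
      .seq (assignForm 5 (.or (.wire 5) (.wire 6))) (.block [.add 24 24 0]))
    (assignForm 4 (.and (.wire 4) (.wire 5)))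

theorem permCircuit_ends {a : ℕ} (ha : a ≠ 2) {L : List (Equiv.Perm (Fin n))}
    {gs : List (Gate ℕ)} {s : RamState} {k src dst : ℕ} (h : HasGates B gs s)
    (htrue : GateComputes gs (s.reg 3) (fun _ => True)) (h0 : s.reg 0 = n)
    (hL : s.arr a = encodePerms L) (hk : k < L.length) (h24 : s.reg 24 = k * n)
    (h26 : s.reg 26 = src) (h27 : s.reg 27 = dst) (hsrc : src + n ≤ B) (hdst : dst + n ≤ B) :
    (permCircuit a).Ends s (113 * n + 7) (fun s' => ∃ gs', gs <+: gs' ∧ HasGates B gs' s' ∧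
      GateComputes gs' (s'.reg 6) (BlockMap (L.getD k 1) src dst)) := by
  have harr : ∀ P : RamProg, P = permCircuit a → P.writesArr a = false := by
    rintro P rfl
    simpa [permCircuit, RamProg.loop, RamProg.block, RamProg.writesArr, RamInstr.writesArr,
      assignForm, emitForm, equalForm, emitGate] using ha
  have hfa := harr _ rfl
  -- `equalForm` has size `10`, and `assignForm` takes ten steps per unit of size plus three.
  refine RamProg.Ends.mono (t := 3 + (n * ((5 + 103) + 5) + 4)) ?_ (by omega) (fun _ _ h => h)
  refine RamProg.Ends.seq (RamProg.Ends.block (l := [.const 61 0, .add 6 3 61])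
    (Q := fun s' => s'.reg 6 = s.reg 3) (by simp)) fun s₁ f₁ h₁ => ?_
  refine (RamProg.Ends.loop (fun j s' => ∃ gs', gs <+: gs' ∧ HasGates B gs' s' ∧
    GateComputes gs' (s'.reg 6) (fun ν => ∀ v < j, ν (dst + permVal (L.getD k 1) v) = ν (src + v)))
    ((f₁.reg 0 rfl).trans h0) rfl rfl rfl ?_ ?_ ?_).mono le_rfl fun _ _ h => h
  · rintro j s s' ⟨gs', i1, i2, i3⟩ hr ha
    refine ⟨gs', i1, i2.of_eq (by rw [ha]) (hr 60 (by omega) (by omega) (by omega)), ?_⟩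
    rwa [hr 6 (by omega) (by omega) (by omega)]
  · refine ⟨gs, List.prefix_refl _, h.frame f₁ rfl rfl, ?_⟩
    rw [h₁]
    exact htrue.congr (by simp)
  · rintro j s₂ f₂ ⟨gs₂, p₂, g₂, c₂⟩ hj hjn
    have ea : s₂.arr a = encodePerms L := by
      rw [f₂.arr a, f₁.arr a, hL]
      · rfl
      · simp only [permCircuit, RamProg.writesArr, Bool.or_eq_false_iff] at hfa
        exact hfa.2
    have hlt := permVal_lt (L.getD k 1) hjn
    refine RamProg.Ends.seq (RamProg.Ends.block
      (l := [.add 22 24 20, .read 22 a 22, .add 8 27 22, .add 9 26 20])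
      (Q := fun s' => s'.reg 8 = dst + permVal (L.getD k 1) j ∧ s'.reg 9 = src + j) ?_)
      fun s₃ f₃ h₃ => ?_
    · rw [← getD_encodePerms L hk hjn]
      have e24 := (f₂.reg 24 rfl).trans (f₁.reg 24 rfl)
      have e26 := (f₂.reg 26 rfl).trans (f₁.reg 26 rfl)
      have e27 := (f₂.reg 27 rfl).trans (f₁.reg 27 rfl)
      simp [-List.getD_eq_getElem?_getD, hj, e24, e26, e27, h24, h26, h27, ea]
    have g₃ := g₂.frame f₃ rfl rfl
    have c₃ : GateComputes gs₂ (s₃.reg 6)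
      (fun ν => ∀ v < j, ν (dst + permVal (L.getD k 1) v) = ν (src + v)) := by
      rwa [f₃.reg 6 rfl]
    have m8 : (Form.var 8).Means B gs₂ s₃.reg
        (fun ν => ν (dst + permVal (L.getD k 1) j) = true) := by
      rw [← h₃.1]
      exact .var (by omega) (by omega)
    have m9 : (Form.var 9).Means B gs₂ s₃.reg (fun ν => ν (src + j) = true) := by
      rw [← h₃.2]
      exact .var (by omega) (by omega)
    have m : equalForm.Means B gs₂ s₃.reg _ :=
      .and (.wire (by omega) c₃) (.or (.and m8 m9) (.not (.or m8 m9)))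
    refine (assignForm_ends m g₃ 6 (by omega) (by decide)).mono le_rfl ?_
    rintro s₄ - ⟨gs₄, p₄, g₄, c₄⟩
    refine ⟨gs₄, p₂.trans p₄, g₄, c₄.congr fun ν => ?_⟩
    rw [Nat.forall_lt_succ_right]
    refine and_congr Iff.rfl ?_
    cases ν (dst + permVal (L.getD k 1) j) <;> cases ν (src + j) <;> simp

/-- Steps for a circuit for one of `m` permutations. -/
def permsTime (n m : ℕ) : ℕ := 3 + ((m * (((113 * n + 7) + (33 + 2)) + 5) + 4) + 33)

/-- Register `5` accumulates the disjunction, starting from the constant false, while register `24`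
advances by `n` to the next permutation. -/
theorem permsCircuit_ends {a : ℕ} (ha : a = 3 ∨ a = 6) {L : List (Equiv.Perm (Fin n))}
    {gs : List (Gate ℕ)} {Φ : (ℕ → Bool) → Prop} {s : RamState} {k m src dst : ℕ}
    (h : HasConstraint B Φ gs s) (h0 : s.reg 0 = n)
    (hL : s.arr a = encodePerms L) (hk : k + m ≤ L.length) (h24 : s.reg 24 = k * n)
    (h25 : s.reg 25 = m)
    (h26 : s.reg 26 = src) (h27 : s.reg 27 = dst) (hsrc : src + n ≤ B) (hdst : dst + n ≤ B) :
    (permsCircuit a).Ends s (permsTime n m) (fun s' => ∃ gs', HasConstraint B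
      (fun ν => Φ ν ∧ ∃ p < m, BlockMap (L.getD (k + p) 1) src dst ν) gs' s') := by
  have hfr : ∀ x, (permsCircuit a).writesReg x = (permsCircuit 3).writesReg x := fun _ => rfl
  have hfa : (permsCircuit a).writesArr a = false := by rcases ha with rfl | rfl <;> rfl
  have ha2 : a ≠ 2 := by omega
  refine RamProg.Ends.seq (RamProg.Ends.block (l := [.const 61 0, .add 5 2 61])
    (Q := fun s' => s'.reg 5 = s.reg 2) (by simp)) fun s₁ f₁ h₁ => ?_
  refine RamProg.Ends.seq (RamProg.Ends.loop (fun j s' => ∃ gs', gs <+: gs' ∧ HasGates B gs' s' ∧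
    GateComputes gs' (s'.reg 5) (fun ν => ∃ p < j, BlockMap (L.getD (k + p) 1) src dst ν) ∧
    s'.reg 24 = (k + j) * n)
    ((f₁.reg 25 rfl).trans h25) rfl rfl rfl ?_ ?_ ?_) fun s₂ f₂ h₂ => ?_
  · rintro j s s' ⟨gs', i1, i2, i3, i4⟩ hr ha
    refine ⟨gs', i1, i2.of_eq (by rw [ha]) (hr 60 (by omega) (by omega) (by omega)), ?_, ?_⟩
    · rwa [hr 5 (by omega) (by omega) (by omega)]
    · rwa [hr 24 (by omega) (by omega) (by omega)]
  · refine ⟨gs, List.prefix_refl _, h.gates.frame f₁ rfl rfl, ?_, (f₁.reg 24 rfl).trans h24⟩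
    rw [h₁]
    exact h.bot.congr (by simp)
  · rintro j s₂ f₂ ⟨gs₂, p₂, g₂, c₂, e₂⟩ hj hjm
    have ea : s₂.arr a = encodePerms L := by
      rw [f₂.arr a, f₁.arr a, hL]
      · rfl
      · simp only [permsCircuit, RamProg.writesArr, Bool.or_eq_false_iff] at hfa
        exact hfa.2.1
    have htrue : GateComputes gs₂ (s₂.reg 3) (fun _ => True) := by
      rw [f₂.reg 3 rfl, f₁.reg 3 rfl]
      exact h.top.mono p₂
    refine RamProg.Ends.seq (t := 113 * n + 7) (t' := 33 + 2) (permCircuit_ends ha2 g₂ htrue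
      ((f₂.reg 0 rfl).trans ((f₁.reg 0 rfl).trans h0)) ea (by omega) e₂
      ((f₂.reg 26 rfl).trans ((f₁.reg 26 rfl).trans h26))
      ((f₂.reg 27 rfl).trans ((f₁.reg 27 rfl).trans h27)) hsrc hdst)
      fun s₃ f₃ ⟨gs₃, p₃, g₃, c₃⟩ => ?_
    have c₂' : GateComputes gs₃ (s₃.reg 5)
        (fun ν => ∃ p < j, BlockMap (L.getD (k + p) 1) src dst ν) := by
      rw [f₃.reg 5 rfl]
      exact c₂.mono p₃
    refine RamProg.Ends.seq (assignForm_ends (.or (.wire (by omega) c₂') (.wire (by omega) c₃)) g₃ 5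
      (by omega) (by decide)) fun s₄ f₄ ⟨gs₄, p₄, g₄, c₄⟩ => ?_
    refine RamProg.Ends.block ⟨gs₄, p₂.trans (p₃.trans p₄), g₄.of_eq (by simp) (by simp), ?_, ?_⟩
    · simp only [RamState.execs, RamInstr.exec, RamState.setReg_reg, Nat.reduceEqDiff, reduceIte]
      refine c₄.congr fun ν => ?_
      rw [Nat.exists_lt_succ_right]
    · have e24 : s₄.reg 24 = (k + j) * n := (f₄.reg 24 rfl).trans ((f₃.reg 24 rfl).trans e₂)
      have e0 : s₄.reg 0 = n := (f₄.reg 0 rfl).trans ((f₃.reg 0 rfl).trans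
        ((f₂.reg 0 rfl).trans ((f₁.reg 0 rfl).trans h0)))
      simp [e24, e0]
      ring
  · obtain ⟨gs₂, p₂, g₂, c₂, -⟩ := h₂
    have c₂' : GateComputes gs₂ (s₂.reg 4) Φ := by
      rw [f₂.reg 4 rfl, f₁.reg 4 rfl]
      exact h.acc.mono p₂
    refine (assignForm_ends (.and (.wire (by omega) c₂') (.wire (by omega) c₂)) g₂ 4
      (by omega) (by decide)).mono le_rfl fun s₃ f₃ ⟨gs₃, p₃, g₃, c₃⟩ => ⟨gs₃, g₃, ?_, ?_, c₃⟩
    · rw [f₃.reg 2 rfl, f₂.reg 2 rfl, f₁.reg 2 rfl]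
      exact h.bot.mono (p₂.trans p₃)
    · rw [f₃.reg 3 rfl, f₂.reg 3 rfl, f₁.reg 3 rfl]
      exact h.top.mono (p₂.trans p₃)

/-! ### Circuits for comparisons -/

/-- The number with the first `k` binary digits from the block at `off`. -/
def blockNumber (ν : ℕ → Bool) (off : ℕ) : ℕ → ℕ
  | 0 => 0
  | k + 1 => blockNumber ν off k + if ν (off + k) = true then 2 ^ k else 0

theorem blockNumber_lt (ν : ℕ → Bool) (off k : ℕ) : blockNumber ν off k < 2 ^ k := by
  induction k with
  | zero => simp [blockNumber]
  | succ k ih =>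
    rw [blockNumber, pow_succ]
    split_ifs <;> omega

/-- Digit `k` outweighs all lower digits together, so a comparison can be carried upward from the
lowest digit on a single wire. -/
theorem blockNumber_succ_le (ν : ℕ → Bool) (off off' k : ℕ) :
    blockNumber ν off (k + 1) ≤ blockNumber ν off' (k + 1) ↔
      (¬ν (off + k) = true ∧ ν (off' + k) = true) ∨
        ((¬ν (off + k) = true ∨ ν (off' + k) = true) ∧
          blockNumber ν off k ≤ blockNumber ν off' k) := by
  have h := blockNumber_lt ν off k
  have h' := blockNumber_lt ν off' k
  rw [blockNumber, blockNumber]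
  cases ν (off + k) <;> cases ν (off' + k) <;> simp <;> omega

/-- One step of the comparison of two numbers. -/
def compareForm : Form :=
  .or (.and (.not (.var 8)) (.var 9)) (.and (.or (.not (.var 8)) (.var 9)) (.wire 6))

/-- Require that the block at `0` is at most the block at register `27`. -/
def compareCircuit : RamProg :=
  .seq (.block [.const 61 0, .add 6 3 61]) <|
    .seq (.loop 20 21 0 <| .seq (.block [.const 61 0, .add 8 20 61, .add 9 27 20])
      (assignForm 6 compareForm))
    (assignForm 4 (.and (.wire 4) (.wire 6)))

theorem compareCircuit_ends {gs : List (Gate ℕ)} {Φ : (ℕ → Bool) → Prop} {s : RamState} {dst : ℕ}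
    (h : HasConstraint B Φ gs s) (h0 : s.reg 0 = n) (h27 : s.reg 27 = dst) (hdst : dst + n ≤ B) :
    compareCircuit.Ends s (122 * n + 40) (fun s' => ∃ gs', HasConstraint B
      (fun ν => Φ ν ∧ blockNumber ν 0 n ≤ blockNumber ν dst n) gs' s') := by
  refine RamProg.Ends.mono (t := 3 + ((n * ((4 + 113) + 5) + 4) + 33)) ?_ (by omega)
    (fun _ _ h => h)
  refine RamProg.Ends.seq (RamProg.Ends.block (l := [.const 61 0, .add 6 3 61])
    (Q := fun s' => s'.reg 6 = s.reg 3) (by simp)) fun s₁ f₁ h₁ => ?_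
  refine RamProg.Ends.seq (RamProg.Ends.loop (fun j s' => ∃ gs', gs <+: gs' ∧ HasGates B gs' s' ∧
    GateComputes gs' (s'.reg 6) (fun ν => blockNumber ν 0 j ≤ blockNumber ν dst j))
    ((f₁.reg 0 rfl).trans h0) rfl rfl rfl ?_ ?_ ?_) fun s₂ f₂ h₂ => ?_
  · rintro j s s' ⟨gs', i1, i2, i3⟩ hr ha
    refine ⟨gs', i1, i2.of_eq (by rw [ha]) (hr 60 (by omega) (by omega) (by omega)), ?_⟩
    rwa [hr 6 (by omega) (by omega) (by omega)]
  · refine ⟨gs, List.prefix_refl _, h.gates.frame f₁ rfl rfl, ?_⟩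
    rw [h₁]
    exact h.top.congr (by simp [blockNumber])
  · rintro j s₂ f₂ ⟨gs₂, p₂, g₂, c₂⟩ hj hjn
    refine RamProg.Ends.seq (RamProg.Ends.block
      (l := [.const 61 0, .add 8 20 61, .add 9 27 20])
      (Q := fun s' => s'.reg 8 = 0 + j ∧ s'.reg 9 = dst + j) ?_) fun s₃ f₃ h₃ => ?_
    · have e27 := (f₂.reg 27 rfl).trans (f₁.reg 27 rfl)
      simp [hj, e27, h27]
    have c₃ : GateComputes gs₂ (s₃.reg 6)
      (fun ν => blockNumber ν 0 j ≤ blockNumber ν dst j) := by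
      rwa [f₃.reg 6 rfl]
    have m8 : (Form.var 8).Means B gs₂ s₃.reg (fun ν => ν (0 + j) = true) := by
      rw [← h₃.1]
      exact .var (by omega) (by omega)
    have m9 : (Form.var 9).Means B gs₂ s₃.reg (fun ν => ν (dst + j) = true) := by
      rw [← h₃.2]
      exact .var (by omega) (by omega)
    have m : compareForm.Means B gs₂ s₃.reg _ :=
      .or (.and (.not m8) m9) (.and (.or (.not m8) m9) (.wire (by omega) c₃))
    refine (assignForm_ends m (g₂.frame f₃ rfl rfl) 6 (by omega) (by decide)).mono le_rfl ?_
    rintro s₄ - ⟨gs₄, p₄, g₄, c₄⟩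
    exact ⟨gs₄, p₂.trans p₄, g₄, c₄.congr fun ν => (blockNumber_succ_le ν 0 dst j).symm⟩
  · obtain ⟨gs₂, p₂, g₂, c₂⟩ := h₂
    have c₂' : GateComputes gs₂ (s₂.reg 4) Φ := by
      rw [f₂.reg 4 rfl, f₁.reg 4 rfl]
      exact h.acc.mono p₂
    refine (assignForm_ends (.and (.wire (by omega) c₂') (.wire (by omega) c₂)) g₂ 4
      (by omega) (by decide)).mono le_rfl fun s₃ f₃ ⟨gs₃, p₃, g₃, c₃⟩ => ⟨gs₃, g₃, ?_, ?_, c₃⟩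
    · rw [f₃.reg 2 rfl, f₂.reg 2 rfl, f₁.reg 2 rfl]
      exact h.bot.mono (p₂.trans p₃)
    · rw [f₃.reg 3 rfl, f₂.reg 3 rfl, f₁.reg 3 rfl]
      exact h.top.mono (p₂.trans p₃)

/-! ### Copies of a circuit -/

/-- The gate in a copy that starts at position `base` and has its variables in the block at `off`. -/
def Gate.relocate (base off : ℕ) : Gate (Fin n) → Gate ℕ
  | .var v => .var (v + off)
  | .not i => .not (i + base)
  | .and i j => .and (i + base) (j + base)
  | .or i j => .or (i + base) (j + base)

/-- References inside the copy are shifted past the older gates, so the copy sees only its own gates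
and reads its variables from the block at `off`. -/
theorem gateValues_relocate (gs : List (Gate ℕ)) (l : List (Gate (Fin n))) (off : ℕ)
    (ν : ℕ → Bool) :
    gateValues (gs ++ l.map (Gate.relocate gs.length off)) ν =
      gateValues gs ν ++ gateValues l (fun v => ν (v + off)) := by
  induction l using List.reverseRecOn with
  | nil => simp
  | append_singleton l g ih =>
    rw [List.map_append, List.map_singleton, ← List.append_assoc, gateValues_concat,
      gateValues_concat, ih, List.append_assoc]
    congr 3
    have hget : ∀ i (l' : List Bool), (gateValues gs ν ++ l').getD (i + gs.length) false =
        l'.getD i false := by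
      intro i l'
      rw [List.getD_append_right _ _ _ _ (by simp)]
      simp
    cases g <;> simp only [Gate.relocate, Gate.value, hget]

theorem Gate.RefersBelow.relocate {g : Gate (Fin n)} {k : ℕ} (h : g.RefersBelow k) (base off : ℕ) :
    (g.relocate base off).RefersBelow (base + k) := by
  cases g <;> simp only [Gate.relocate, Gate.RefersBelow] at h ⊢ <;> omega

theorem Gate.encode_eq {V : Type} (name : V → ℕ) (g : Gate V) :
    ∃ a b c, g.encode name = [a, b, c] := by
  cases g <;> exact ⟨_, _, _, rfl⟩

/-- Three consecutive entries of the code of a list of gates. -/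
theorem getD_flatMap_encode {V : Type} (name : V → ℕ) (l : List (Gate V)) {k : ℕ}
    (hk : k < l.length) : (l[k]).encode name = [(l.flatMap (Gate.encode name)).getD (3 * k) 0,
      (l.flatMap (Gate.encode name)).getD (3 * k + 1) 0,
      (l.flatMap (Gate.encode name)).getD (3 * k + 2) 0] := by
  induction l generalizing k with
  | nil => simp at hk
  | cons g l ih =>
    obtain ⟨a, b, c, h⟩ := g.encode_eq name
    rw [List.flatMap_cons, h]
    cases k with
    | zero => simp [h]
    | succ k =>
      rw [List.getElem_cons_succ, ih (by simpa using hk), show 3 * (k + 1) = 3 * k + 3 by ring]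
      simp

/-- Write a copy of the circuit in array `102`, with its variables in the block at register `45`;
the number of gates is in register `46`. -/
def copyGates : RamProg :=
  .seq (.block [.const 61 0, .add 49 60 61, .const 44 0]) <|
    .loop 47 48 46 <|
      .seq (.block [.const 61 1, .read 64 102 44, .add 44 44 61, .read 65 102 44, .add 44 44 61,
        .read 66 102 44, .add 44 44 61, .sub 67 64 61]) <|
      .seq (.ite 64 (.ite 67 (.block [.add 65 65 49, .add 66 66 49]) (.block [.add 65 65 49]))
        (.block [.add 65 65 45]))
      (.block [.push 2 64, .push 2 65, .push 2 66, .const 61 1, .add 60 60 61])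

/-- Require that a copy of the circuit is satisfied. -/
def copyCircuit : RamProg :=
  .seq copyGates <| .seq (.block [.const 61 1, .sub 7 60 61])
    (assignForm 4 (.and (.wire 4) (.wire 7)))

theorem copyGates_ends {C : Circuit (Fin n)} {gs : List (Gate ℕ)} {s : RamState} {off : ℕ}
    (h : HasGates B gs s) (hC : s.arr 102 = C.encode Fin.val) (h45 : s.reg 45 = off)
    (h46 : s.reg 46 = C.gates.length) (hoff : off + n ≤ B) :
    copyGates.Ends s (25 * C.gates.length + 8) (fun s' =>
      HasGates B (gs ++ C.gates.map (Gate.relocate gs.length off)) s') := by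
  refine RamProg.Ends.mono (t := 4 + (C.gates.length * ((9 + ((3 + 1 + 1) + 6)) + 5) + 4)) ?_
    (by omega) (fun _ _ h => h)
  refine RamProg.Ends.seq (RamProg.Ends.block (l := [.const 61 0, .add 49 60 61, .const 44 0])
    (Q := fun s' => s'.reg 49 = gs.length ∧ s'.reg 44 = 0) (by simp [h.reg])) fun s₁ f₁ h₁ => ?_
  refine (RamProg.Ends.loop (fun j s' => HasGates B (gs ++ (C.gates.take j).map
    (Gate.relocate gs.length off)) s' ∧ s'.reg 44 = 3 * j)
    ((f₁.reg 46 rfl).trans h46) rfl rfl rfl ?_ ?_ ?_).mono le_rfl fun s' _ h => ?_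
  · rintro j s s' ⟨h1, h2⟩ hr ha
    refine ⟨h1.of_eq (by rw [ha]) (hr 60 (by omega) (by omega) (by omega)), ?_⟩
    rwa [hr 44 (by omega) (by omega) (by omega)]
  · simp only [List.take_zero, List.map_nil, List.append_nil]
    exact ⟨h.frame f₁ rfl rfl, h₁.2⟩
  · rintro j s₂ f₂ ⟨h₂, e₂⟩ hj hjC
    have e102 : s₂.arr 102 = C.gates.flatMap (Gate.encode Fin.val) :=
      (f₂.arr 102 rfl).trans ((f₁.arr 102 rfl).trans hC)
    have e45 : s₂.reg 45 = off := (f₂.reg 45 rfl).trans ((f₁.reg 45 rfl).trans h45)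
    have e49 : s₂.reg 49 = gs.length := (f₂.reg 49 rfl).trans h₁.1
    have henc := getD_flatMap_encode Fin.val C.gates hjC
    rw [← e102] at henc
    rw [List.take_succ_eq_append_getElem hjC, List.map_append, List.map_singleton,
      ← List.append_assoc]
    have hwired := (C.wired j hjC).relocate gs.length off
    obtain ⟨g, hg⟩ : ∃ g, C.gates[j] = g := ⟨_, rfl⟩
    rw [hg] at henc hwired ⊢
    refine RamProg.Ends.seq (RamProg.Ends.block
      (l := [.const 61 1, .read 64 102 44, .add 44 44 61, .read 65 102 44, .add 44 44 61,
        .read 66 102 44, .add 44 44 61, .sub 67 64 61])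
      (Q := fun s' => g.encode Fin.val = [s'.reg 64, s'.reg 65, s'.reg 66] ∧
        s'.reg 67 = s'.reg 64 - 1 ∧ s'.reg 44 = 3 * (j + 1)) ?_) fun s₃ f₃ ⟨h₃, h67, h44⟩ => ?_
    · rw [henc]
      simp [-List.getD_eq_getElem?_getD, e₂]
      ring
    have e45' : s₃.reg 45 = off := (f₃.reg 45 rfl).trans e45
    have e49' : s₃.reg 49 = gs.length := (f₃.reg 49 rfl).trans e49
    refine RamProg.Ends.seq (t := 3 + 1 + 1) (t' := 6) (R := fun s' =>
      (g.relocate gs.length off).encode id = [s'.reg 64, s'.reg 65, s'.reg 66]) ?_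
      fun s₄ f₄ h₄ => ?_
    -- Operation code `0` is a variable, shifted by the block offset; code `1` is a NOT-gate with
    -- one reference to shift; codes `2` and `3` have two references.
    · refine RamProg.Ends.ite (fun h64 => RamProg.Ends.ite (fun h67' => ?_) fun h67' => ?_)
        fun h64 => ?_
      · refine RamProg.Ends.block ?_
        cases g <;> simp [Gate.encode, Gate.relocate] at h₃ ⊢ <;> omega
      · refine (RamProg.Ends.block (l := [.add 65 65 49]) (Q := fun s' =>
          (g.relocate gs.length off).encode id = [s'.reg 64, s'.reg 65, s'.reg 66]) ?_).mono
          (by simp) fun _ _ h => h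
        cases g <;> simp [Gate.encode, Gate.relocate] at h₃ ⊢ <;> omega
      · refine (RamProg.Ends.block (l := [.add 65 65 45]) (Q := fun s' =>
          (g.relocate gs.length off).encode id = [s'.reg 64, s'.reg 65, s'.reg 66]) ?_).mono
          (by simp) fun _ _ h => h
        cases g <;> simp [Gate.encode, Gate.relocate] at h₃ ⊢ <;> omega
    · have g₄ := (h₂.frame f₃ rfl rfl).frame f₄ rfl rfl
      refine RamProg.Ends.block ⟨⟨?_, ?_, ?_, ?_⟩, ?_⟩
      · rw [List.flatMap_append, List.flatMap_singleton, h₄, ← g₄.arr]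
        simp
      · simp [g₄.reg]
        omega
      · refine g₄.wired.concat ?_
        rwa [List.length_append, List.length_map, List.length_take, min_eq_left (by omega)]
      · intro x hx
        rcases List.mem_append.mp hx with hx | hx
        · exact g₄.lt x hx
        · have hx := List.mem_singleton.mp hx
          cases hgc : g with
          | var v =>
            rw [hgc] at hx
            cases hx
            omega
          | not i => rw [hgc] at hx; cases hx
          | and i j => rw [hgc] at hx; cases hx
          | or i j => rw [hgc] at hx; cases hx
      · simpa [f₄.reg 44 rfl] using h44
  · rw [List.take_length] at h
    exact h.1

theorem copyCircuit_ends {C : Circuit (Fin n)} {gs : List (Gate ℕ)} {Φ : (ℕ → Bool) → Prop}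
    {s : RamState} {off : ℕ}
    (h : HasConstraint B Φ gs s) (hC : s.arr 102 = C.encode Fin.val) (h45 : s.reg 45 = off)
    (h46 : s.reg 46 = C.gates.length) (hoff : off + n ≤ B) :
    copyCircuit.Ends s (25 * C.gates.length + 44) (fun s' => ∃ gs', HasConstraint B
      (fun ν => Φ ν ∧ C.eval (fun v => ν (v + off)) = true) gs' s') := by
  refine RamProg.Ends.mono (t := (25 * C.gates.length + 8) + (3 + 33)) ?_ (by omega)
    (fun _ _ h => h)
  refine RamProg.Ends.seq (copyGates_ends h.gates hC h45 h46 hoff) fun s₁ f₁ h₁ => ?_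
  have hpos : 0 < C.gates.length := List.length_pos_iff.mpr C.nonempty
  set gs₁ := gs ++ C.gates.map (Gate.relocate gs.length off) with hgs₁
  have hlen : gs₁.length = gs.length + C.gates.length := by simp [hgs₁]
  refine RamProg.Ends.seq (RamProg.Ends.block (l := [.const 61 1, .sub 7 60 61])
    (Q := fun s' => s'.reg 7 = gs.length + (C.gates.length - 1)) ?_) fun s₂ f₂ h₂ => ?_
  · simp [h₁.reg, hlen]
    omega
  have p : gs <+: gs₁ := List.prefix_append _ _
  have c₁ : GateComputes gs₁ (s₂.reg 4) Φ := by
    rw [f₂.reg 4 rfl, f₁.reg 4 rfl]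
    exact h.acc.mono p
  have c₂ : GateComputes gs₁ (s₂.reg 7) (fun ν => C.eval (fun v => ν (v + off)) = true) := by
    refine ⟨by omega, fun ν => ?_⟩
    rw [h₂, C.eval_eq, gateValue, gateValue, hgs₁, gateValues_relocate,
      List.getD_append_right _ _ _ _ (by simp), length_gateValues, Nat.add_sub_cancel_left]
  refine (assignForm_ends (.and (.wire (by omega) c₁) (.wire (by omega) c₂)) (h₁.frame f₂ rfl rfl)
    4 (by omega) (by decide)).mono le_rfl fun s₃ f₃ ⟨gs₃, p₃, g₃, c₃⟩ => ⟨gs₃, g₃, ?_, ?_, c₃⟩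
  · rw [f₃.reg 2 rfl, f₂.reg 2 rfl, f₁.reg 2 rfl]
    exact h.bot.mono (p.trans p₃)
  · rw [f₃.reg 3 rfl, f₂.reg 3 rfl, f₁.reg 3 rfl]
    exact h.top.mono (p.trans p₃)

end

/-! ### The circuit for the overgroup -/

section

variable {n B : ℕ}

/-- The blocks from `d` on show that the assignment in the block at `0` is not larger than some
assignment accepted by `C` to which it is mapped by entry `r` of `R` and entries of the table `L`. -/
def ChainHolds (C : Circuit (Fin n)) (L R : List (Equiv.Perm (Fin n))) (r d : ℕ)
    (ν : ℕ → Bool) : Prop :=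
  BlockMap (R.getD r 1) 0 d ν ∧
    (∀ i < n, ∃ p < n * n, BlockMap (L.getD p 1) (d + i * n) (d + (i + 1) * n) ν) ∧
    C.eval (fun v => ν (v + (d + n * n))) = true ∧
    blockNumber ν 0 n ≤ blockNumber ν (d + n * n) n

/-- The constant gates. -/
def constantsCircuit : RamProg :=
  .seq (.block [.const 60 0, .const 8 0]) <|
    .seq (assignForm 2 (.and (.var 8) (.not (.var 8)))) <|
    .seq (assignForm 3 (.not (.wire 2))) (.block [.const 61 0, .add 4 3 61])

/-- There are no constant gates, so false is written as `x ∧ ¬x` for variable `0`, which requires `0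
< B`. -/
theorem constantsCircuit_ends {s : RamState} (h : s.arr 2 = []) (hB : 0 < B) :
    constantsCircuit.Ends s 72 (fun s' => ∃ gs, HasConstraint B (fun _ => True) gs s') := by
  refine RamProg.Ends.mono (t := 3 + (43 + (23 + 3))) ?_ le_rfl (fun _ _ h => h)
  refine RamProg.Ends.seq (RamProg.Ends.block (l := [.const 60 0, .const 8 0])
    (Q := fun s' => s'.reg 60 = 0 ∧ s'.reg 8 = 0) (by simp)) fun s₁ f₁ h₁ => ?_
  have g₁ : HasGates B [] s₁ := by
    refine ⟨(f₁.arr 2 rfl).trans h, h₁.1, fun k hk => ?_, fun x hx => ?_⟩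
    · simp at hk
    · simp at hx
  have m8 : (Form.var 8).Means B [] s₁.reg (fun ν => ν (s₁.reg 8) = true) :=
    .var (by omega) (by omega)
  refine RamProg.Ends.seq (assignForm_ends (.and m8 (.not m8)) g₁ 2 (by omega) (by decide))
    fun s₂ f₂ ⟨gs₂, p₂, g₂, c₂⟩ => ?_
  have c₂' := c₂.congr (Ψ := fun _ => False) (by tauto)
  refine RamProg.Ends.seq (assignForm_ends (.not (.wire (by omega) c₂')) g₂ 3 (by omega)
    (by decide)) fun s₃ f₃ ⟨gs₃, p₃, g₃, c₃⟩ => ?_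
  have c₃' := c₃.congr (Ψ := fun _ => True) (by tauto)
  refine RamProg.Ends.block ⟨gs₃, g₃.of_eq (by simp) (by simp), ?_, ?_, ?_⟩
  · simpa [f₃.reg 2 rfl] using c₂'.mono p₃
  · simpa using c₃'
  · simpa using c₃'

/-- The constraint for the representative at register `50`. -/
def chainCircuit : RamProg :=
  .seq (.block [.const 61 0, .add 24 35 61, .const 25 1, .const 26 0, .add 27 34 61]) <|
    .seq (permsCircuit 6) <|
    .seq (.loop 36 37 0 <| .seq (.block [.const 61 0, .const 24 0, .add 25 1 61, .add 26 27 61,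
      .add 27 27 0]) (permsCircuit 3)) <|
    .seq (.block [.const 61 0, .add 45 27 61]) <|
    .seq copyCircuit <| .seq compareCircuit (.block [.add 34 27 0, .add 35 35 0])

/-- Array `3` contains a table, array `6` representatives, and array `102` a circuit. -/
structure HasInput (C : Circuit (Fin n)) (L R : List (Equiv.Perm (Fin n))) (s : RamState) :
    Prop where
  reg0 : s.reg 0 = n
  reg1 : s.reg 1 = n * n
  reg52 : s.reg 52 = R.length
  reg46 : s.reg 46 = C.gates.length
  length : L.length = n * n
  table : s.arr 3 = encodePerms L
  cosets : s.arr 6 = encodePerms R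
  circuit : s.arr 102 = C.encode Fin.val

theorem HasInput.frame {P : RamProg} {C : Circuit (Fin n)} {L R : List (Equiv.Perm (Fin n))}
    {s s' : RamState} (h : HasInput C L R s) (f : Frame P s s')
    (hr : [0, 1, 52, 46].all (fun x => !P.writesReg x) = true)
    (ha : [3, 6, 102].all (fun x => !P.writesArr x) = true) : HasInput C L R s' := by
  simp only [List.all_cons, List.all_nil, Bool.and_eq_true, Bool.not_eq_true', and_true] at hr ha
  exact ⟨(f.reg 0 hr.1).trans h.reg0, (f.reg 1 hr.2.1).trans h.reg1,
    (f.reg 52 hr.2.2.1).trans h.reg52, (f.reg 46 hr.2.2.2).trans h.reg46, h.length,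
    (f.arr 3 ha.1).trans h.table, (f.arr 6 ha.2.1).trans h.cosets,
    (f.arr 102 ha.2.2).trans h.circuit⟩

theorem HasConstraint.of_eq {Φ : (ℕ → Bool) → Prop} {gs : List (Gate ℕ)} {s s' : RamState}
    (h : HasConstraint B Φ gs s) (ha : s'.arr 2 = s.arr 2)
    (hr : ∀ x ∈ [60, 2, 3, 4], s'.reg x = s.reg x) : HasConstraint B Φ gs s' := by
  refine ⟨h.gates.of_eq ha (hr 60 (by simp)), ?_, ?_, ?_⟩
  · rw [hr 2 (by simp)]
    exact h.bot
  · rw [hr 3 (by simp)]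
    exact h.top
  · rw [hr 4 (by simp)]
    exact h.acc

theorem HasConstraint.frame {P : RamProg} {Φ : (ℕ → Bool) → Prop} {gs : List (Gate ℕ)}
    {s s' : RamState} (h : HasConstraint B Φ gs s) (f : Frame P s s') (ha : P.writesArr 2 = false)
    (hr : [60, 2, 3, 4].all (fun x => !P.writesReg x) = true) : HasConstraint B Φ gs s' := by
  refine h.of_eq (f.arr 2 ha) fun x hx => f.reg x ?_
  simpa using List.all_eq_true.mp hr x hx

theorem HasConstraint.congr {Φ Ψ : (ℕ → Bool) → Prop} {gs : List (Gate ℕ)} {s : RamState}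
    (h : HasConstraint B Φ gs s) (hΦ : ∀ ν, Φ ν ↔ Ψ ν) : HasConstraint B Ψ gs s :=
  ⟨h.gates, h.bot, h.top, h.acc.congr hΦ⟩

/-- Steps for the constraint for one representative, apart from copying the circuit. -/
def chainTime (n : ℕ) : ℕ :=
  6 + (permsTime n 1 + ((n * ((6 + permsTime n (n * n)) + 5) + 4) + (3 + (44 +
    ((122 * n + 40) + 3)))))

/-- A chain occupies `n + 1` blocks of `n` variables. Link `i` may use any table entry, not only one
of row `i`; this loses nothing, since all entries belong to the group. -/
theorem chainCircuit_ends {C : Circuit (Fin n)} {L R : List (Equiv.Perm (Fin n))} {s : RamState}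
    {gs : List (Gate ℕ)} {Φ : (ℕ → Bool) → Prop} {r d : ℕ} (h : HasConstraint B Φ gs s)
    (hI : HasInput C L R s) (hr : r < R.length) (h35 : s.reg 35 = r * n) (h34 : s.reg 34 = d)
    (hn : n ≤ d) (hd : d + (n + 1) * n ≤ B) :
    chainCircuit.Ends s (chainTime n + 25 * C.gates.length) (fun s' => ∃ gs', HasConstraint B
      (fun ν => Φ ν ∧ ChainHolds C L R r d ν) gs' s' ∧ s'.reg 35 = (r + 1) * n ∧
      s'.reg 34 = d + (n + 1) * n) := by
  have hdn : (n + 1) * n = n * n + n := by ring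
  refine RamProg.Ends.mono (t := 6 + (permsTime n 1 + ((n * ((6 + permsTime n (n * n)) + 5) + 4) +
    (3 + ((25 * C.gates.length + 44) + ((122 * n + 40) + 3)))))) ?_ (by rw [chainTime]; omega)
    (fun _ _ h => h)
  refine RamProg.Ends.seq (RamProg.Ends.block
    (l := [.const 61 0, .add 24 35 61, .const 25 1, .const 26 0, .add 27 34 61])
    (Q := fun s' => s'.reg 24 = r * n ∧ s'.reg 25 = 1 ∧ s'.reg 26 = 0 ∧ s'.reg 27 = d)
    (by simp [h34, h35])) fun s₁ f₁ h₁ => ?_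
  have i₁ := hI.frame f₁ rfl rfl
  refine RamProg.Ends.seq (permsCircuit_ends (m := 1) (Or.inr rfl) (h.frame f₁ rfl rfl) i₁.reg0
    i₁.cosets (by omega) h₁.1 h₁.2.1 h₁.2.2.1 h₁.2.2.2 (by omega) (by omega))
    fun s₂ f₂ ⟨gs₂, c₂⟩ => ?_
  have i₂ := i₁.frame f₂ rfl rfl
  refine RamProg.Ends.seq (RamProg.Ends.loop (fun j s' => (∃ gs', HasConstraint B (fun ν =>
    (Φ ν ∧ BlockMap (R.getD r 1) 0 d ν) ∧
      ∀ i < j, ∃ p < n * n, BlockMap (L.getD p 1) (d + i * n) (d + (i + 1) * n) ν) gs' s') ∧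
    s'.reg 27 = d + j * n)
    i₂.reg0 rfl rfl rfl ?_ ?_ ?_) fun s₃ f₃ ⟨⟨gs₃, c₃⟩, e₃⟩ => ?_
  · rintro j s s' ⟨⟨gs', h1⟩, h2⟩ hr ha
    refine ⟨⟨gs', h1.of_eq (by rw [ha]) fun x hx => hr x ?_ ?_ ?_⟩, ?_⟩
    · rintro rfl; simp at hx
    · rintro rfl; simp at hx
    · rintro rfl; simp at hx
    · rwa [hr 27 (by omega) (by omega) (by omega)]
  · refine ⟨⟨gs₂, c₂.congr fun ν => ?_⟩, ?_⟩
    · simp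
    · simpa using (f₂.reg 27 rfl).trans h₁.2.2.2
  · rintro j s₃ f₃ ⟨⟨gs₃, c₃⟩, e₃⟩ hj hjn
    have i₃ := i₂.frame f₃ rfl rfl
    have hjd : (j + 1) * n ≤ n * n := Nat.mul_le_mul_right n hjn
    have hj1 : (j + 1) * n = j * n + n := by ring
    refine RamProg.Ends.seq (RamProg.Ends.block
      (l := [.const 61 0, .const 24 0, .add 25 1 61, .add 26 27 61, .add 27 27 0])
      (Q := fun s' => s'.reg 24 = 0 * n ∧ s'.reg 25 = n * n ∧ s'.reg 26 = d + j * n ∧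
        s'.reg 27 = d + (j + 1) * n) ?_) fun s₄ f₄ h₄ => ?_
    · simp [e₃, i₃.reg0, i₃.reg1]
      ring
    have i₄ := i₃.frame f₄ rfl rfl
    refine (permsCircuit_ends (Or.inl rfl) (c₃.frame f₄ rfl rfl) i₄.reg0
      i₄.table (by rw [i₄.length]; omega) h₄.1 h₄.2.1 h₄.2.2.1 h₄.2.2.2 (by omega)
      (by omega)).mono le_rfl fun s₅ f₅ ⟨gs₅, c₅⟩ => ⟨⟨gs₅, c₅.congr fun ν => ?_⟩, ?_⟩
    · rw [Nat.forall_lt_succ_right]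
      simp only [zero_add]
      tauto
    · rw [f₅.reg 27 rfl, h₄.2.2.2]
  have i₃ := i₂.frame f₃ rfl rfl
  refine RamProg.Ends.seq (RamProg.Ends.block (l := [.const 61 0, .add 45 27 61])
    (Q := fun s' => s'.reg 45 = d + n * n) (by simp [e₃])) fun s₄ f₄ h₄ => ?_
  have i₄ := i₃.frame f₄ rfl rfl
  refine RamProg.Ends.seq (copyCircuit_ends (c₃.frame f₄ rfl rfl) i₄.circuit h₄ i₄.reg46
    (by omega)) fun s₅ f₅ ⟨gs₅, c₅⟩ => ?_
  have i₅ := i₄.frame f₅ rfl rfl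
  have e27 : s₅.reg 27 = d + n * n := (f₅.reg 27 rfl).trans ((f₄.reg 27 rfl).trans e₃)
  refine RamProg.Ends.seq (compareCircuit_ends c₅ i₅.reg0 e27 (by omega))
    fun s₆ f₆ ⟨gs₆, c₆⟩ => ?_
  have e35 : s₆.reg 35 = r * n := (f₆.reg 35 rfl).trans ((f₅.reg 35 rfl).trans
    ((f₄.reg 35 rfl).trans ((f₃.reg 35 rfl).trans ((f₂.reg 35 rfl).trans
    ((f₁.reg 35 rfl).trans h35)))))
  have e0 : s₆.reg 0 = n := (f₆.reg 0 rfl).trans i₅.reg0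
  refine RamProg.Ends.block ⟨gs₆, (c₆.of_eq (by simp) (by simp)).congr fun ν => ?_, ?_, ?_⟩
  · rw [ChainHolds]
    tauto
  · simp [e35, e0]
    ring
  · simp [f₆.reg 27 rfl, e27, e0]
    ring

/-- The whole circuit. -/
def circuitProg : RamProg :=
  .seq constantsCircuit <| .seq (.block [.const 45 0]) <| .seq copyCircuit <|
    .seq (.block [.const 61 0, .add 34 0 61, .const 35 0]) <|
    .seq (.loop 50 51 52 chainCircuit) (emitGate 2 4 4 70)

/-- Steps for writing the circuit, apart from copying the given circuit. -/
def circuitTime (n M : ℕ) : ℕ := 72 + (2 + (44 + (4 + ((M * (chainTime n + 5) + 4) + 10))))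

theorem circuitProg_ends {C : Circuit (Fin n)} {L R : List (Equiv.Perm (Fin n))} {s : RamState}
    (hI : HasInput C L R s) (h2 : s.arr 2 = []) (hn : 0 < n) :
    circuitProg.Ends s (circuitTime n R.length + (R.length + 1) * (25 * C.gates.length))
      (fun s' => ∃ gs, HasGates (n + R.length * ((n + 1) * n)) gs s' ∧ gs ≠ [] ∧
        GateComputes gs (gs.length - 1) (fun ν => C.eval (fun v => ν (v + 0)) = true ∧
          ∀ r < R.length, ChainHolds C L R r (n + r * ((n + 1) * n)) ν)) := by
  refine RamProg.Ends.mono (t := 72 + (2 + ((25 * C.gates.length + 44) + (4 +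
    ((R.length * ((chainTime n + 25 * C.gates.length) + 5) + 4) + 10))))) ?_ ?_ (fun _ _ h => h)
  swap
  · rw [circuitTime]
    apply le_of_eq
    ring
  refine RamProg.Ends.seq (constantsCircuit_ends (B := n + R.length * ((n + 1) * n)) h2 (by omega))
    fun s₁ f₁ ⟨gs₁, c₁⟩ => ?_
  have i₁ := hI.frame f₁ rfl rfl
  refine RamProg.Ends.seq (RamProg.Ends.block (l := [.const 45 0])
    (Q := fun s' => s'.reg 45 = 0) (by simp)) fun s₂ f₂ h₂ => ?_
  have i₂ := i₁.frame f₂ rfl rfl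
  refine RamProg.Ends.seq (copyCircuit_ends (c₁.frame f₂ rfl rfl) i₂.circuit h₂ i₂.reg46
    (by omega)) fun s₃ f₃ ⟨gs₃, c₃⟩ => ?_
  have i₃ := i₂.frame f₃ rfl rfl
  refine RamProg.Ends.seq (RamProg.Ends.block (l := [.const 61 0, .add 34 0 61, .const 35 0])
    (Q := fun s' => s'.reg 34 = n ∧ s'.reg 35 = 0) (by simp [i₃.reg0])) fun s₄ f₄ h₄ => ?_
  have i₄ := i₃.frame f₄ rfl rfl
  refine RamProg.Ends.seq (RamProg.Ends.loop (fun j s' => (∃ gs', HasConstraint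
    (n + R.length * ((n + 1) * n)) (fun ν => C.eval (fun v => ν (v + 0)) = true ∧
      ∀ r < j, ChainHolds C L R r (n + r * ((n + 1) * n)) ν) gs' s') ∧
    s'.reg 35 = j * n ∧ s'.reg 34 = n + j * ((n + 1) * n))
    i₄.reg52 rfl rfl rfl ?_ ?_ ?_) fun s₅ f₅ ⟨⟨gs₅, c₅⟩, _⟩ => ?_
  · rintro j s s' ⟨⟨gs', h1⟩, h2, h3⟩ hr ha
    refine ⟨⟨gs', h1.of_eq (by rw [ha]) fun x hx => hr x ?_ ?_ ?_⟩, ?_, ?_⟩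
    · rintro rfl; simp at hx
    · rintro rfl; simp at hx
    · rintro rfl; simp at hx
    · rwa [hr 35 (by omega) (by omega) (by omega)]
    · rwa [hr 34 (by omega) (by omega) (by omega)]
  · refine ⟨⟨gs₃, (c₃.frame f₄ rfl rfl).congr fun ν => ?_⟩, ?_, ?_⟩
    · simp
    · simpa using h₄.2
    · simpa using h₄.1
  · rintro j s₅ f₅ ⟨⟨gs₅, c₅⟩, e35, e34⟩ hj hjR
    have i₅ := i₄.frame f₅ rfl rfl
    have hle : (j + 1) * ((n + 1) * n) ≤ R.length * ((n + 1) * n) :=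
      Nat.mul_le_mul_right _ hjR
    have hj1 : (j + 1) * ((n + 1) * n) = j * ((n + 1) * n) + (n + 1) * n := by ring
    refine (chainCircuit_ends c₅ i₅ hjR e35 e34 (by omega) (by omega)).mono le_rfl
      fun s₆ f₆ ⟨gs₆, c₆, d₆, e₆⟩ => ⟨⟨gs₆, c₆.congr fun ν => ?_⟩, d₆, by omega⟩
    rw [Nat.forall_lt_succ_right]
    tauto
  -- The output has to be the last gate, so the accumulated constraint is repeated at the end as a
  -- conjunction with itself.
  · refine (emitGate_ends c₅.gates (g := .and (s₅.reg 4) (s₅.reg 4)) (by omega) (by omega) le_rfl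
      (by omega) (by simp [Gate.encode]) ⟨c₅.acc.lt, c₅.acc.lt⟩ fun x hx => by cases hx).mono
      le_rfl fun s₆ _ h₆ => ⟨_, h₆.1, by simp, ?_⟩
    rw [List.length_append, List.length_singleton, Nat.add_sub_cancel]
    refine .concat fun ν => ?_
    rw [← c₅.acc.iff ν]
    simp [Gate.value, gateValue]

end

/-! ### Minimal representatives -/

section

variable {n : ℕ}

theorem perm_apply_inv (σ : Equiv.Perm (Fin n)) (v : Fin n) : σ (σ⁻¹ v) = v :=
  σ.apply_symm_apply v

theorem perm_inv_apply (σ : Equiv.Perm (Fin n)) (v : Fin n) : σ⁻¹ (σ v) = v :=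
  σ.symm_apply_apply v

/-- The assignment in the block at `off`. -/
def blockAt (n : ℕ) (ν : ℕ → Bool) (off : ℕ) : Fin n → Bool := fun v => ν (v + off)

/-- The number with the binary digits `x`. -/
def assignmentNumber (x : Fin n → Bool) : ℕ :=
  blockNumber (fun v => if h : v < n then x ⟨v, h⟩ else false) 0 n

theorem blockNumber_congr {ν ν' : ℕ → Bool} {off off' k : ℕ}
    (h : ∀ v < k, ν (off + v) = ν' (off' + v)) : blockNumber ν off k = blockNumber ν' off' k := by
  induction k with
  | zero => rfl
  | succ k ih => rw [blockNumber, blockNumber, ih fun v hv => h v (by omega), h k (by omega)]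

theorem blockNumber_eq (ν : ℕ → Bool) (off : ℕ) :
    blockNumber ν off n = assignmentNumber (blockAt n ν off) := by
  refine blockNumber_congr fun v hv => ?_
  simp [hv, blockAt, add_comm]

theorem blockNumber_injective {ν ν' : ℕ → Bool} {off off' k : ℕ}
    (h : blockNumber ν off k = blockNumber ν' off' k) : ∀ v < k, ν (off + v) = ν' (off' + v) := by
  induction k with
  | zero => intro v hv; omega
  | succ k ih =>
    rw [blockNumber, blockNumber] at h
    have h1 := blockNumber_lt ν off k
    have h2 := blockNumber_lt ν' off' k
    have h3 : ν (off + k) = ν' (off' + k) := by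
      cases hb : ν (off + k) <;> cases hb' : ν' (off' + k) <;> simp [hb, hb'] at h ⊢ <;> omega
    rw [h3] at h
    intro v hv
    rcases Nat.lt_succ_iff_lt_or_eq.mp hv with hv | rfl
    · exact ih (by omega) v hv
    · exact h3

theorem assignmentNumber_injective {x y : Fin n → Bool}
    (h : assignmentNumber x = assignmentNumber y) : x = y := by
  funext v
  have := blockNumber_injective h v v.2
  simpa using this

theorem blockMap_iff (w : Equiv.Perm (Fin n)) (src dst : ℕ) (ν : ℕ → Bool) :
    BlockMap w src dst ν ↔ ∀ v, blockAt n ν dst (w v) = blockAt n ν src v := by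
  constructor
  · intro h v
    have := h v v.2
    rwa [permVal_fin, add_comm, add_comm src] at this
  · intro h v hv
    have := h ⟨v, hv⟩
    rw [blockAt, blockAt, ← permVal_fin] at this
    rwa [add_comm dst, add_comm src]

/-- `θ` is accepted by `C`, and for all representatives in `R` some accepted assignment in the
corresponding part of the orbit is not smaller than `θ`. -/
def IsMinimal (H : Subgroup (Equiv.Perm (Fin n))) (C : Circuit (Fin n))
    (R : List (Equiv.Perm (Fin n))) (θ : Fin n → Bool) : Prop :=
  C.eval θ = true ∧ ∀ r < R.length, ∃ h ∈ H, ∃ y : Fin n → Bool,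
    (∀ v, y ((h * R.getD r 1) v) = θ v) ∧ C.eval y = true ∧
      assignmentNumber θ ≤ assignmentNumber y

/-- Soundness of the guess: composing the links of a chain gives an element of `H`, because every
table entry is one. -/
theorem IsMinimal.of_chainHolds {H : Subgroup (Equiv.Perm (Fin n))} {C : Circuit (Fin n)}
    {L R : List (Equiv.Perm (Fin n))} {ν : ℕ → Bool} (hL : IsSimsTable H L) {d : ℕ → ℕ}
    (hC : C.eval (fun v => ν (v + 0)) = true)
    (h : ∀ r < R.length, ChainHolds C L R r (d r) ν) : IsMinimal H C R (blockAt n ν 0) := by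
  refine ⟨hC, fun r hr => ?_⟩
  obtain ⟨h1, h2, h3, h4⟩ := h r hr
  rw [blockMap_iff] at h1
  have key : ∀ i ≤ n, ∃ h ∈ H, ∀ v, blockAt n ν (d r + i * n) ((h * R.getD r 1) v) =
      blockAt n ν 0 v := by
    intro i hi
    induction i with
    | zero => exact ⟨1, H.one_mem, fun v => by simpa using h1 v⟩
    | succ i ih =>
      obtain ⟨h, hh, he⟩ := ih (by omega)
      obtain ⟨p, hp, hb⟩ := h2 i (by omega)
      rw [blockMap_iff] at hb
      refine ⟨L.getD p 1 * h, H.mul_mem (hL.getD_mem p) hh, fun v => ?_⟩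
      rw [← he v, ← hb, mul_assoc, Equiv.Perm.mul_apply]
  obtain ⟨h, hh, he⟩ := key n le_rfl
  refine ⟨h, hh, _, he, h3, ?_⟩
  rwa [blockNumber_eq, blockNumber_eq] at h4

/-- Completeness of the guess. The blocks `X` depend on neither `ν` nor `d`, so the blocks for all
representatives can later be combined into one assignment. -/
theorem IsMinimal.chainHolds {H : Subgroup (Equiv.Perm (Fin n))} {C : Circuit (Fin n)}
    {L R : List (Equiv.Perm (Fin n))} {θ : Fin n → Bool}
    (hS : ∀ g, g ∈ H ↔ sift L n g = 1) (h : IsMinimal H C R θ) {r : ℕ} (hr : r < R.length) :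
    ∃ X : ℕ → Fin n → Bool, ∀ (ν : ℕ → Bool) (d : ℕ), blockAt n ν 0 = θ →
      (∀ i ≤ n, blockAt n ν (d + i * n) = X i) → ChainHolds C L R r d ν := by
  obtain ⟨h, hh, y, hy, hC, hle⟩ := h.2 r hr
  -- Block `i` carries `θ` moved by `sift L i h⁻¹ * h * R_r`. This is `R_r` for `i = 0` and, since
  -- `h⁻¹` sifts to `1`, it is `h * R_r` for `i = n`.
  refine ⟨fun i v => θ ((sift L i h⁻¹ * h * R.getD r 1)⁻¹ v), fun ν d h0 hX => ?_⟩
  beta_reduce at hX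
  have hyn : blockAt n ν (d + n * n) = y := by
    rw [hX n le_rfl, (hS _).mp (H.inv_mem hh), one_mul]
    funext v
    rw [← hy, perm_apply_inv]
  refine ⟨?_, fun i hi => ?_, ?_, ?_⟩
  · rw [blockMap_iff, h0]
    intro v
    have := hX 0 (Nat.zero_le _)
    rw [zero_mul, add_zero] at this
    rw [this, show sift L 0 h⁻¹ = h⁻¹ from rfl, inv_mul_cancel, one_mul]
    beta_reduce
    rw [perm_inv_apply]
  · refine ⟨i * n + permVal (sift L i h⁻¹) i, index_lt hi (permVal_lt _ hi), ?_⟩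
    rw [blockMap_iff, hX i (by omega), hX (i + 1) (by omega)]
    intro v
    have : sift L (i + 1) h⁻¹ = L.getD (i * n + permVal (sift L i h⁻¹) i) 1 * sift L i h⁻¹ := rfl
    rw [this, mul_assoc, mul_assoc, mul_inv_rev]
    beta_reduce
    rw [Equiv.Perm.mul_apply, perm_inv_apply, mul_assoc]
  · have : (fun v : Fin n => ν (v + (d + n * n))) = y := hyn
    rw [this, hC]
  · rw [blockNumber_eq, blockNumber_eq, h0, hyn]
    exact hle

/-- The element taking `θ` to `τ` lies in some coset `H R_k`, so `τ` is in the `H`-orbit of `R_k θ`.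
The guessed `y` for `k` is accepted in the same `H`-orbit, and completeness of `C` gives `y = τ`. -/
theorem IsMinimal.number_le {H : Subgroup (Equiv.Perm (Fin n))}
    {T R : List (Equiv.Perm (Fin n))} {C : Circuit (Fin n)} (hC : IsCompleteSB H C)
    (hR : ∀ g ∈ generatedGroup T, ∃ k < R.length, g * (R.getD k 1)⁻¹ ∈ H)
    {θ τ : Fin n → Bool} (hθ : IsMinimal H C R θ) (hτ : C.eval τ = true)
    (ho : τ ∈ assignmentOrbit (generatedGroup T) θ) :
    assignmentNumber θ ≤ assignmentNumber τ := by
  obtain ⟨g, hg, hgτ⟩ := ho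
  obtain ⟨k, hk, hmem⟩ := hR g hg
  obtain ⟨h, hh, y, hy, hyC, hle⟩ := hθ.2 k hk
  obtain ⟨z, -, -, huniq⟩ := hC (fun v => θ ((R.getD k 1)⁻¹ v))
  have h1 : y ∈ assignmentOrbit H (fun v => θ ((R.getD k 1)⁻¹ v)) := by
    refine ⟨h, hh, fun v => ?_⟩
    beta_reduce
    rw [← hy, Equiv.Perm.mul_apply, perm_apply_inv]
  have h2 : τ ∈ assignmentOrbit H (fun v => θ ((R.getD k 1)⁻¹ v)) := by
    refine ⟨_, hmem, fun v => ?_⟩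
    beta_reduce
    rw [← hgτ, Equiv.Perm.mul_apply]
  have e1 : y = z := by
    by_contra hne
    rw [huniq y h1 hne] at hyC
    exact absurd hyC (by simp)
  have e2 : τ = z := by
    by_contra hne
    rw [huniq τ h2 hne] at hτ
    exact absurd hτ (by simp)
  rwa [e2, ← e1]

theorem mem_assignmentOrbit_trans {G : Subgroup (Equiv.Perm (Fin n))} {x y z : Fin n → Bool}
    (h : y ∈ assignmentOrbit G x) (h' : z ∈ assignmentOrbit G y) : z ∈ assignmentOrbit G x := by
  obtain ⟨g, hg, he⟩ := h
  obtain ⟨g', hg', he'⟩ := h'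
  exact ⟨g' * g, G.mul_mem hg' hg, fun v => by rw [Equiv.Perm.mul_apply, he', he]⟩

theorem mem_assignmentOrbit_symm {G : Subgroup (Equiv.Perm (Fin n))} {x y : Fin n → Bool}
    (h : y ∈ assignmentOrbit G x) : x ∈ assignmentOrbit G y := by
  obtain ⟨g, hg, he⟩ := h
  exact ⟨g⁻¹, G.inv_mem hg, fun v => by rw [← he, perm_apply_inv]⟩

/-- An accepted assignment with least number in the orbit is minimal. Two minimal ones bound each
other by `IsMinimal.number_le`, so their numbers, and hence the assignments, agree. -/
theorem exists_isMinimal {H : Subgroup (Equiv.Perm (Fin n))}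
    {T R : List (Equiv.Perm (Fin n))} {C : Circuit (Fin n)} (hC : IsCompleteSB H C)
    (hHT : H ≤ generatedGroup T) (hRT : ∀ x ∈ R, x ∈ generatedGroup T)
    (hR : ∀ g ∈ generatedGroup T, ∃ k < R.length, g * (R.getD k 1)⁻¹ ∈ H) (θ : Fin n → Bool) :
    ∃ τ ∈ assignmentOrbit (generatedGroup T) θ, IsMinimal H C R τ ∧
      ∀ τ' ∈ assignmentOrbit (generatedGroup T) θ, τ' ≠ τ → ¬IsMinimal H C R τ' := by
  have hne : {τ | τ ∈ assignmentOrbit (generatedGroup T) θ ∧ C.eval τ = true}.Nonempty := by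
    obtain ⟨τ, ⟨h, hh, he⟩, hτ, -⟩ := hC θ
    exact ⟨τ, ⟨h, hHT hh, he⟩, hτ⟩
  obtain ⟨τ, ⟨ho, hτ⟩, hmin⟩ := Set.exists_min_image _ assignmentNumber (Set.toFinite _) hne
  have hτm : IsMinimal H C R τ := by
    refine ⟨hτ, fun r hr => ?_⟩
    obtain ⟨y, ⟨h, hh, he⟩, hy, -⟩ := hC (fun v => τ ((R.getD r 1)⁻¹ v))
    have hyτ : ∀ v, y ((h * R.getD r 1) v) = τ v := fun v => by
      rw [Equiv.Perm.mul_apply, he]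
      beta_reduce
      rw [perm_inv_apply]
    refine ⟨h, hh, y, hyτ, hy, hmin y ⟨mem_assignmentOrbit_trans ho ⟨_, ?_, hyτ⟩, hy⟩⟩
    refine mul_mem (hHT hh) (hRT _ ?_)
    rw [List.getD_eq_getElem _ _ hr]
    exact List.getElem_mem hr
  refine ⟨τ, ho, hτm, fun τ' ho' hne' hm => hne' ?_⟩
  have hττ' : τ' ∈ assignmentOrbit (generatedGroup T) τ :=
    mem_assignmentOrbit_trans (mem_assignmentOrbit_symm ho) ho'
  exact assignmentNumber_injective (le_antisymm
    (hm.number_le hC hR hτ (mem_assignmentOrbit_symm hττ')) (hτm.number_le hC hR hm.1 hττ'))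

/-! ### Circuits with numbered variables -/

/-- Rename the variables of a gate. -/
def Gate.rename {V W : Type} (f : V → W) : Gate V → Gate W
  | .var v => .var (f v)
  | .not i => .not i
  | .and i j => .and i j
  | .or i j => .or i j

theorem gateValues_rename {V W : Type} (f : V → W) (gs : List (Gate V)) (θ : W → Bool) :
    gateValues (gs.map (Gate.rename f)) θ = gateValues gs (fun v => θ (f v)) := by
  induction gs using List.reverseRecOn with
  | nil => rfl
  | append_singleton gs g ih =>
    rw [List.map_append, List.map_singleton, gateValues_concat, gateValues_concat, ih]
    cases g <;> rfl

/-- The variable with a given number. -/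
def numberedVar {n m : ℕ} (hn : 0 < n) (x : ℕ) : Fin n ⊕ Fin m :=
  if h : x < n then .inl ⟨x, h⟩ else if h' : x - n < m then .inr ⟨x - n, h'⟩ else .inl ⟨0, hn⟩

theorem varName_numberedVar {m : ℕ} (hn : 0 < n) {x : ℕ} (hx : x < n + m) :
    varName (numberedVar (m := m) hn x) = x := by
  rw [numberedVar]
  split_ifs with h h'
  · rfl
  · simp only [varName, Sum.elim_inr]
    omega
  · omega

/-- The circuit with gates `gs`. -/
def numberedCircuit {m : ℕ} (hn : 0 < n) (gs : List (Gate ℕ)) (hne : gs ≠ []) (hw : IsWired gs) :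
    Circuit (Fin n ⊕ Fin m) where
  gates := gs.map (Gate.rename (numberedVar hn))
  nonempty := by simpa using hne
  wired := by
    intro k hk
    have := hw k (by simpa using hk)
    rw [List.getElem_map]
    cases hg : gs[k]'(by simpa using hk) <;> rw [hg] at this <;> exact this

theorem encode_numberedCircuit {m : ℕ} (hn : 0 < n) {gs : List (Gate ℕ)} (hne : gs ≠ [])
    (hw : IsWired gs) (hlt : ∀ x, Gate.var x ∈ gs → x < n + m) :
    (numberedCircuit (m := m) hn gs hne hw).encode varName = gs.flatMap (Gate.encode id) := by
  rw [Circuit.encode, numberedCircuit, List.flatMap_map]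
  refine List.flatMap_congr fun g hg => ?_
  cases g with
  | var x => simp [Gate.rename, Gate.encode, varName_numberedVar hn (hlt x hg)]
  | _ => rfl

theorem eval_numberedCircuit {m : ℕ} (hn : 0 < n) {gs : List (Gate ℕ)} (hne : gs ≠ [])
    (hw : IsWired gs) (θ : Fin n ⊕ Fin m → Bool) :
    (numberedCircuit (m := m) hn gs hne hw).eval θ =
      gateValue gs (fun x => θ (numberedVar hn x)) (gs.length - 1) := by
  rw [Circuit.eval_eq, gateValue, gateValue, numberedCircuit, gateValues_rename, List.length_map]

theorem isCompleteSBWithAdditional_numberedCircuit {H : Subgroup (Equiv.Perm (Fin n))}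
    {L T R : List (Equiv.Perm (Fin n))} {C : Circuit (Fin n)} (hC : IsCompleteSB H C)
    (hHT : H ≤ generatedGroup T) (hRT : ∀ x ∈ R, x ∈ generatedGroup T)
    (hR : ∀ g ∈ generatedGroup T, ∃ k < R.length, g * (R.getD k 1)⁻¹ ∈ H)
    (hL : IsSimsTable H L) (hS : ∀ g, g ∈ H ↔ sift L n g = 1) (hn : 0 < n) {gs : List (Gate ℕ)}
    (hne : gs ≠ []) (hw : IsWired gs)
    (hgs : GateComputes gs (gs.length - 1) (fun ν => C.eval (fun v => ν (v + 0)) = true ∧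
      ∀ r < R.length, ChainHolds C L R r (n + r * ((n + 1) * n)) ν)) :
    IsCompleteSBWithAdditional (generatedGroup T)
      (numberedCircuit (m := R.length * ((n + 1) * n)) hn gs hne hw) := by
  have hblock : ∀ (θ : Fin n → Bool) (α : Fin (R.length * ((n + 1) * n)) → Bool),
      blockAt n (fun x => Sum.elim θ α (numberedVar hn x)) 0 = θ := by
    intro θ α
    funext v
    simp [blockAt, numberedVar]
  -- The additional variables act as an existential quantifier, so the circuit is satisfiable
  -- exactly at the minimal assignments.
  have key : ∀ θ : Fin n → Bool, IsMinimal H C R θ ↔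
      ∃ α : Fin (R.length * ((n + 1) * n)) → Bool,
        (numberedCircuit (m := R.length * ((n + 1) * n)) hn gs hne hw).eval (Sum.elim θ α) =
          true := by
    intro θ
    constructor
    · intro hθ
      have : ∀ r, ∃ X : ℕ → Fin n → Bool, r < R.length → ∀ (ν : ℕ → Bool) (d : ℕ),
          blockAt n ν 0 = θ → (∀ i ≤ n, blockAt n ν (d + i * n) = X i) →
            ChainHolds C L R r d ν := by
        intro r
        by_cases hr : r < R.length
        · obtain ⟨X, hX⟩ := hθ.chainHolds hS hr
          exact ⟨X, fun _ => hX⟩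
        · exact ⟨fun _ _ => false, fun h => absurd h hr⟩
      choose X hX using this
      -- Additional variable `(r * (n + 1) + i) * n + v` is position `v` of block `i` in chain `r`;
      -- the quotients and remainders decode this numbering.
      refine ⟨fun j => X (j / n / (n + 1)) (j / n % (n + 1)) ⟨j % n, Nat.mod_lt _ hn⟩, ?_⟩
      rw [eval_numberedCircuit, hgs.iff]
      refine ⟨?_, fun r hr => hX r hr _ _ (hblock θ _) fun i hi => ?_⟩
      · have h1 := hθ.1
        rw [← hblock θ fun j => X (j / n / (n + 1)) (j / n % (n + 1)) ⟨j % n, Nat.mod_lt _ hn⟩]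
          at h1
        exact h1
      · funext v
        have e : (v : ℕ) + (n + r * ((n + 1) * n) + i * n) = n + ((r * (n + 1) + i) * n + v) := by
          ring
        have h1 : ((r * (n + 1) + i) * n + v) / n = r * (n + 1) + i := by
          rw [mul_comm, Nat.mul_add_div hn, Nat.div_eq_of_lt v.2, add_zero]
        have h2 : ((r * (n + 1) + i) * n + v) % n = v := by
          rw [mul_comm, Nat.mul_add_mod, Nat.mod_eq_of_lt v.2]
        have h3 : (r * (n + 1) + i) / (n + 1) = r := by
          rw [mul_comm, Nat.mul_add_div (by omega), Nat.div_eq_of_lt (by omega), add_zero]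
        have h4 : (r * (n + 1) + i) % (n + 1) = i := by
          rw [mul_comm, Nat.mul_add_mod, Nat.mod_eq_of_lt (by omega)]
        have hlt : (r * (n + 1) + i) * n + v < R.length * ((n + 1) * n) := by
          have : (r + 1) * ((n + 1) * n) ≤ R.length * ((n + 1) * n) := Nat.mul_le_mul_right _ hr
          have hin : i * n ≤ n * n := Nat.mul_le_mul_right _ hi
          have hv := v.2
          nlinarith
        have hvar : numberedVar (m := R.length * ((n + 1) * n)) hn
            (n + ((r * (n + 1) + i) * n + v)) = .inr ⟨(r * (n + 1) + i) * n + v, hlt⟩ := by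
          rw [numberedVar, dif_neg (by omega), dif_pos (by omega)]
          congr 2
          omega
        rw [blockAt, e, hvar]
        simp only [Sum.elim_inr, h1, h2, h3, h4]
    · rintro ⟨α, hα⟩
      rw [eval_numberedCircuit, hgs.iff] at hα
      have := IsMinimal.of_chainHolds hL hα.1 hα.2
      rwa [hblock] at this
  intro θ
  obtain ⟨τ, ho, hτ, huniq⟩ := exists_isMinimal hC hHT hRT hR θ
  refine ⟨τ, ho, (key τ).mp hτ, fun τ' ho' hne' α => ?_⟩
  by_contra hα
  exact huniq τ' ho' hne' ((key τ').mpr ⟨α, by simpa using hα⟩)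

end

/-! ### The whole program -/

section

variable {n : ℕ}

/-- Copy the first list of permutations and the degree to the memory of the given program. -/
def setupProg : RamProg :=
  .seq (.block [.length 40 0, .const 61 0, .add 100 0 61])
    (.loop 20 21 40 (.block [.read 22 0 20, .push 100 22]))

theorem setupProg_ends (S T : List (Equiv.Perm (Fin n))) :
    setupProg.Ends (initialState S T) (8 * (S.length * n) + 8) (fun s' => s'.reg 100 = n ∧
      s'.arr 100 = encodePerms S) := by
  refine RamProg.Ends.mono (t := 4 + (S.length * n * (3 + 5) + 4)) ?_ (by omega) (fun _ _ h => h)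
  refine RamProg.Ends.seq (RamProg.Ends.block (l := [.length 40 0, .const 61 0, .add 100 0 61])
    (Q := fun s' => s'.reg 40 = S.length * n ∧ s'.reg 100 = n) ?_) fun s₁ f₁ ⟨h₁, h₂⟩ => ?_
  · simp [initialState, length_encodePerms]
  refine (RamProg.Ends.loop (fun j s' => s'.arr 100 = (encodePerms S).take j) h₁ rfl rfl rfl
    ?_ ?_ ?_).mono le_rfl fun s' f h => ⟨(f.reg 100 rfl).trans h₂, ?_⟩
  · intro j s s' h _ ha
    rwa [ha]
  · exact f₁.arr 100 rfl
  · intro j s' f h hj hjn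
    refine RamProg.Ends.block ?_
    have e0 : s'.arr 0 = encodePerms S := (f.arr 0 rfl).trans (f₁.arr 0 rfl)
    have hlt : j < (encodePerms S).length := by rwa [length_encodePerms]
    rw [List.take_succ_eq_append_getElem hlt, ← List.getD_eq_getElem _ 0 hlt]
    simp [-List.getD_eq_getElem?_getD, h, hj, e0]
  · rw [h, ← length_encodePerms, List.take_length]

/-- Prepare the table, the list of representatives, and the lengths of the lists. -/
def prepareProg : RamProg :=
  .seq (mulProg 1 0 0) <| .seq (.block [.const 61 1, .add 33 1 61, .const 52 1, .const 42 3]) <|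
    .seq (.loop 10 11 1 (pushIdentity 3)) <| .seq (pushIdentity 4) <| .seq (pushIdentity 6) <|
    .seq (countProg 0 0 32) <| .seq (countProg 1 0 55) (countProg 102 42 46)

/-- Everything that follows the run of the given program. -/
def finishProg : RamProg :=
  .seq prepareProg <| .seq simsTableProg <| .seq cosetProg circuitProg

/-- Memory after the run of the given program. -/
structure HasResult (S T : List (Equiv.Perm (Fin n))) (C : Circuit (Fin n)) (s : RamState) :
    Prop where
  reg : s.reg 0 = n
  gens : s.arr 0 = encodePerms S
  gens' : s.arr 1 = encodePerms T
  nil : ∀ a, 2 ≤ a → a < 100 → s.arr a = []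
  circuit : s.arr 102 = C.encode Fin.val

theorem length_flatMap_encode {V : Type} (name : V → ℕ) (l : List (Gate V)) :
    (l.flatMap (Gate.encode name)).length = l.length * 3 := by
  induction l with
  | nil => rfl
  | cons g l ih =>
    obtain ⟨a, b, c, h⟩ := g.encode_eq name
    rw [List.flatMap_cons, List.length_append, ih, h, List.length_cons]
    simp
    ring

/-- Memory after the preparation. -/
structure IsPrepared (S T : List (Equiv.Perm (Fin n))) (C : Circuit (Fin n)) (s : RamState) :
    Prop where
  table : HasTable (trivialTable n) 1 s
  cosets : s.arr 6 = encodePerms [(1 : Equiv.Perm (Fin n))]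
  gens : s.arr 0 = encodePerms S
  gens' : s.arr 1 = encodePerms T
  nil : s.arr 2 = []
  circuit : s.arr 102 = C.encode Fin.val
  reg1 : s.reg 1 = n * n
  reg33 : s.reg 33 = n * n + 1
  reg52 : s.reg 52 = 1
  reg32 : s.reg 32 = S.length
  reg55 : s.reg 55 = T.length
  reg46 : s.reg 46 = C.gates.length

/-- Steps for the preparation, apart from counting gates. -/
def prepareTime (n m m' : ℕ) : ℕ :=
  (7 * n + 6) + (5 + ((n * n * ((7 * n + 4) + 5) + 4) + ((7 * n + 4) + ((7 * n + 4) +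
    ((10 * (m * n) + 8) + ((10 * (m' * n) + 8) + 8))))))

theorem prepareProg_ends {S T : List (Equiv.Perm (Fin n))} {C : Circuit (Fin n)} {s : RamState}
    (h : HasResult S T C s) (hn : 0 < n) :
    prepareProg.Ends s (prepareTime n S.length T.length + 30 * C.gates.length)
      (IsPrepared S T C) := by
  refine RamProg.Ends.mono (t := (7 * n + 6) + (5 + ((n * n * ((7 * n + 4) + 5) + 4) +
    ((7 * n + 4) + ((7 * n + 4) + ((10 * (S.length * n) + 8) + ((10 * (T.length * n) + 8) +
    (10 * (C.gates.length * 3) + 8)))))))) ?_ (by rw [prepareTime]; omega) (fun _ _ h => h)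
  have hmul := mulProg_ends (z := 1) (x := 0) (y := 0) (by omega) (by omega) (by omega) (by omega)
    (by omega) s
  rw [h.reg] at hmul
  refine RamProg.Ends.seq hmul fun s₁ f₁ h₁ => ?_
  refine RamProg.Ends.seq (RamProg.Ends.block
    (l := [.const 61 1, .add 33 1 61, .const 52 1, .const 42 3])
    (Q := fun s' => s'.reg 1 = n * n ∧ s'.reg 33 = n * n + 1 ∧ s'.reg 52 = 1 ∧ s'.reg 42 = 3)
    (by simp [h₁])) fun s₂ f₂ h₂ => ?_
  have e₂ : s₂.reg 0 = n := (f₂.reg 0 rfl).trans ((f₁.reg 0 rfl).trans h.reg)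
  refine RamProg.Ends.seq (RamProg.Ends.loop
    (fun j s' => s'.arr 3 = encodePerms (List.replicate j (1 : Equiv.Perm (Fin n)))) h₂.1 rfl rfl
    rfl ?_ ?_ ?_) fun s₃ f₃ h₃ => ?_
  · intro j s s' h _ ha
    rwa [ha]
  · exact (f₂.arr 3 rfl).trans ((f₁.arr 3 rfl).trans (h.nil 3 (by omega) (by omega)))
  · intro j s' f h hj hjn
    refine (pushIdentity_ends ((f.reg 0 rfl).trans e₂) h).mono le_rfl fun s'' _ h => ?_
    rwa [List.replicate_succ']
  have e₃ : s₃.reg 0 = n := (f₃.reg 0 rfl).trans e₂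
  have n₃ : ∀ a, (a = 4 ∨ a = 6) → s₃.arr a = encodePerms ([] : List (Equiv.Perm (Fin n))) := by
    rintro a (rfl | rfl)
    · exact (f₃.arr 4 rfl).trans ((f₂.arr 4 rfl).trans ((f₁.arr 4 rfl).trans
        (h.nil 4 (by omega) (by omega))))
    · exact (f₃.arr 6 rfl).trans ((f₂.arr 6 rfl).trans ((f₁.arr 6 rfl).trans
        (h.nil 6 (by omega) (by omega))))
  refine RamProg.Ends.seq (pushIdentity_ends e₃ (n₃ 4 (Or.inl rfl))) fun s₄ f₄ h₄ => ?_
  have e₄ : s₄.reg 0 = n := (f₄.reg 0 rfl).trans e₃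
  refine RamProg.Ends.seq (pushIdentity_ends e₄ ((f₄.arr 6 rfl).trans (n₃ 6 (Or.inr rfl))))
    fun s₅ f₅ h₅ => ?_
  have e₅ : s₅.reg 0 = n := (f₅.reg 0 rfl).trans e₄
  have harr : ∀ a, a ≠ 3 → a ≠ 4 → a ≠ 6 → s₅.arr a = s.arr a := by
    intro a h3 h4 h6
    rw [f₅.arr a, f₄.arr a, f₃.arr a, f₂.arr a rfl, f₁.arr a rfl] <;>
      simp [RamProg.loop, pushIdentity, RamProg.block, RamProg.writesArr, RamInstr.writesArr, *]
  refine RamProg.Ends.seq (countProg_ends (m := S.length) e₅ hn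
    (by rw [harr 0 (by omega) (by omega) (by omega), h.gens, length_encodePerms]) rfl rfl)
    fun s₆ f₆ h₆ => ?_
  refine RamProg.Ends.seq (countProg_ends (m := T.length) ((f₆.reg 0 rfl).trans e₅) hn
    (by rw [f₆.arr 1 rfl, harr 1 (by omega) (by omega) (by omega), h.gens', length_encodePerms])
    rfl rfl) fun s₇ f₇ h₇ => ?_
  have e42 : s₇.reg 42 = 3 := (f₇.reg 42 rfl).trans ((f₆.reg 42 rfl).trans ((f₅.reg 42 rfl).trans
    ((f₄.reg 42 rfl).trans ((f₃.reg 42 rfl).trans h₂.2.2.2))))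
  have harr' : ∀ a, a ≠ 3 → a ≠ 4 → a ≠ 6 → s₇.arr a = s.arr a := by
    intro a h3 h4 h6
    rw [f₇.arr a rfl, f₆.arr a rfl, harr a h3 h4 h6]
  refine (countProg_ends (m := C.gates.length) e42 (by omega)
    (by rw [harr' 102 (by omega) (by omega) (by omega), h.circuit, Circuit.encode,
      length_flatMap_encode])
    rfl rfl).mono le_rfl fun s₈ f₈ h₈ => ?_
  have harr'' : ∀ a, a ≠ 3 → a ≠ 4 → a ≠ 6 → s₈.arr a = s.arr a := by
    intro a h3 h4 h6
    rw [f₈.arr a rfl, harr' a h3 h4 h6]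
  exact
    { table :=
        { reg := (f₈.reg 0 rfl).trans ((f₇.reg 0 rfl).trans ((f₆.reg 0 rfl).trans e₅))
          length := by simp [trivialTable]
          table := (f₈.arr 3 rfl).trans ((f₇.arr 3 rfl).trans ((f₆.arr 3 rfl).trans
            ((f₅.arr 3 rfl).trans ((f₄.arr 3 rfl).trans h₃))))
          perm := (f₈.arr 4 rfl).trans ((f₇.arr 4 rfl).trans ((f₆.arr 4 rfl).trans
            ((f₅.arr 4 rfl).trans h₄))) }
      cosets := (f₈.arr 6 rfl).trans ((f₇.arr 6 rfl).trans ((f₆.arr 6 rfl).trans h₅))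
      gens := (harr'' 0 (by omega) (by omega) (by omega)).trans h.gens
      gens' := (harr'' 1 (by omega) (by omega) (by omega)).trans h.gens'
      nil := (harr'' 2 (by omega) (by omega) (by omega)).trans (h.nil 2 (by omega) (by omega))
      circuit := (harr'' 102 (by omega) (by omega) (by omega)).trans h.circuit
      reg1 := (f₈.reg 1 rfl).trans ((f₇.reg 1 rfl).trans ((f₆.reg 1 rfl).trans
        ((f₅.reg 1 rfl).trans ((f₄.reg 1 rfl).trans ((f₃.reg 1 rfl).trans h₂.1)))))
      reg33 := (f₈.reg 33 rfl).trans ((f₇.reg 33 rfl).trans ((f₆.reg 33 rfl).trans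
        ((f₅.reg 33 rfl).trans ((f₄.reg 33 rfl).trans ((f₃.reg 33 rfl).trans h₂.2.1)))))
      reg52 := (f₈.reg 52 rfl).trans ((f₇.reg 52 rfl).trans ((f₆.reg 52 rfl).trans
        ((f₅.reg 52 rfl).trans ((f₄.reg 52 rfl).trans ((f₃.reg 52 rfl).trans h₂.2.2.1)))))
      reg32 := (f₈.reg 32 rfl).trans ((f₇.reg 32 rfl).trans h₆)
      reg55 := (f₈.reg 55 rfl).trans h₇
      reg46 := h₈ }

/-- Steps after the run of the given program, apart from reading its circuit. -/
def finishTime (n m m' B : ℕ) : ℕ :=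
  prepareTime n m m' + (((n * n + 1) * (passTime n m + 5) + 4) +
    ((B * ((m' * (extendTime n B m' + 5) + 4) + 5) + 4) + circuitTime n B))

theorem finishProg_ends {S T : List (Equiv.Perm (Fin n))} {C : Circuit (Fin n)} {s : RamState}
    (h : HasResult S T C s) (hn : 0 < n) (hC : IsCompleteSB (generatedGroup S) C)
    (hST : generatedGroup S ≤ generatedGroup T) {B : ℕ}
    (hB : (generatedGroup S).relIndex (generatedGroup T) = B) :
    finishProg.Ends s (finishTime n S.length T.length B + (55 + 25 * B) * C.gates.length)
      (fun s' => ∃ (m : ℕ) (C' : Circuit (Fin n ⊕ Fin m)), s'.arr 2 = C'.encode varName ∧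
        IsCompleteSBWithAdditional (generatedGroup T) C') := by
  refine RamProg.Ends.mono (t := (prepareTime n S.length T.length + 30 * C.gates.length) +
    (((n * n + 1) * (passTime n S.length + 5) + 4) +
    ((B * ((T.length * (extendTime n B T.length + 5) + 4) + 5) + 4) +
    (circuitTime n B + (B + 1) * (25 * C.gates.length))))) ?_ ?_ (fun _ _ h => h)
  swap
  · rw [finishTime]
    apply le_of_eq
    ring
  obtain ⟨hL, hsift⟩ := simsTable_spec S
  refine RamProg.Ends.seq (prepareProg_ends h hn) fun s₁ f₁ h₁ => ?_
  refine RamProg.Ends.seq (simsTableProg_ends ⟨1, h₁.table⟩ h₁.gens h₁.reg32 h₁.reg1 h₁.reg33)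
    fun s₂ f₂ h₂ => ?_
  refine RamProg.Ends.seq (cosetProg_ends (T := T) hsift
    ⟨h₂, (f₂.arr 6 rfl).trans h₁.cosets, (f₂.reg 52 rfl).trans h₁.reg52⟩
    ((f₂.arr 1 rfl).trans h₁.gens') ((f₂.reg 55 rfl).trans h₁.reg55) hB)
    fun s₃ f₃ ⟨R, ⟨⟨g, h₃⟩, hR, hlen⟩, hRB, hRT, hcov⟩ => ?_
  have hI : HasInput C (simsTable S) R s₃ :=
    { reg0 := h₃.reg
      reg1 := (f₃.reg 1 rfl).trans ((f₂.reg 1 rfl).trans h₁.reg1)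
      reg52 := hlen
      reg46 := (f₃.reg 46 rfl).trans ((f₂.reg 46 rfl).trans h₁.reg46)
      length := h₃.length
      table := h₃.table
      cosets := hR
      circuit := (f₃.arr 102 rfl).trans ((f₂.arr 102 rfl).trans h₁.circuit) }
  refine (circuitProg_ends hI ((f₃.arr 2 rfl).trans ((f₂.arr 2 rfl).trans h₁.nil)) hn).mono ?_ ?_
  · rw [circuitTime, circuitTime]
    gcongr
  · rintro s₄ - ⟨gs, hgs, hne, hcomp⟩
    refine ⟨_, numberedCircuit hn gs hne hgs.wired, ?_,
      isCompleteSBWithAdditional_numberedCircuit hC hST hRT hcov hL hsift hn hne hgs.wired hcomp⟩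
    rw [encode_numberedCircuit hn hne hgs.wired hgs.lt, hgs.arr]

/-! ### Composition with the given program and total running time -/

/-- The program for the overgroup. -/
def overgroupProg (A : RamProg) : RamProg := .seq setupProg (.seq (A.shift 100) finishProg)

theorem overgroupProg_computes {A : RamProg} {S T : List (Equiv.Perm (Fin n))} {t : ℕ} (hn : 0 < n)
    (hA : ComputesSB A S t) (hST : generatedGroup S ≤ generatedGroup T) {B : ℕ}
    (hB : (generatedGroup S).relIndex (generatedGroup T) = B) :
    ComputesSBWithAdditional (overgroupProg A) S T
      (t * (8 * (S.length * n) + 8 + 1 + finishTime n S.length T.length B + (55 + 25 * B))) := by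
  obtain ⟨k, s, C, hrun, hk, hs, hC⟩ := hA
  have hkpos := hrun.pos
  -- Array `2` starts empty and receives three numbers per gate, so the circuit is no larger than
  -- the running time.
  have hlen : C.gates.length ≤ k := by
    have := hrun.length_arr_le 2
    have h2 : (initialState S []).arr 2 = [] := rfl
    rw [h2, hs, Circuit.encode, length_flatMap_encode, List.length_nil] at this
    omega
  suffices h : (overgroupProg A).Ends (initialState S T) (8 * (S.length * n) + 8 + (k +
      (finishTime n S.length T.length B + (55 + 25 * B) * C.gates.length))) (fun s' =>
      ∃ (m : ℕ) (C' : Circuit (Fin n ⊕ Fin m)), s'.arr 2 = C'.encode varName ∧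
        IsCompleteSBWithAdditional (generatedGroup T) C') by
    obtain ⟨k', s', hr, hk', m, C', hout, hC'⟩ := h
    refine ⟨k', s', m, C', hr, hk'.trans ?_, hout, hC'⟩
    have ht : 1 ≤ t := by omega
    have h1 : (55 + 25 * B) * C.gates.length ≤ (55 + 25 * B) * t := by gcongr; omega
    -- Costs proportional to the circuit are absorbed by `t`; all other costs are multiplied by `t`,
    -- which is at least `1` because every run takes a step.
    nlinarith [Nat.mul_le_mul_right (8 * (S.length * n) + 8 + finishTime n S.length T.length B) ht]
  refine RamProg.Ends.seq (setupProg_ends S T) fun s₁ f₁ ⟨h₁, h₂⟩ => ?_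
  -- The given program expects no second list. The list `T` stays in array `1`, outside the
  -- renumbered memory, so that program sees an empty array in its place.
  have hemb : Embeds 100 (initialState S []) s₁ := by
    constructor
    · intro x
      rcases Nat.eq_zero_or_pos x with rfl | hx
      · exact h₁
      · rw [f₁.reg (x + 100)]
        · simp [initialState, show x ≠ 0 by omega]
        · simp [setupProg, RamProg.loop, RamProg.block, RamProg.writesReg, RamInstr.writesReg]
          omega
    · intro a
      rcases Nat.eq_zero_or_pos a with rfl | ha
      · exact h₂
      · rw [f₁.arr (a + 100)]
        · simp [initialState, Function.update_apply, show a ≠ 0 by omega, encodePerms]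
        · simp [setupProg, RamProg.loop, RamProg.block, RamProg.writesArr, RamInstr.writesArr]
          omega
  obtain ⟨s₂, hrun₂, hemb₂⟩ := hrun.shift hemb
  have hends : (A.shift 100).Ends s₁ k (fun s' => s' = s₂) := ⟨k, s₂, hrun₂, le_rfl, rfl⟩
  refine RamProg.Ends.seq hends ?_
  rintro _ f₂ rfl
  refine finishProg_ends ⟨?_, ?_, ?_, ?_, (hemb₂.arr 2).trans hs⟩ hn hC hST hB
  · exact (f₂.reg 0 (RamProg.writesReg_shift (by omega) A)).trans (f₁.reg 0 rfl)
  · exact (f₂.arr 0 (RamProg.writesArr_shift (by omega) A)).trans (f₁.arr 0 rfl)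
  · exact (f₂.arr 1 (RamProg.writesArr_shift (by omega) A)).trans (f₁.arr 1 rfl)
  · intro a ha ha'
    rw [f₂.arr a (RamProg.writesArr_shift (by omega) A), f₁.arr a]
    · simp [initialState, show a ≠ 0 by omega, show a ≠ 1 by omega]
    · simp [setupProg, RamProg.loop, RamProg.block, RamProg.writesArr, RamInstr.writesArr]
      omega

end

/-! ### Polynomial bounds -/

/-- The function is a polynomial. -/
def IsPolynomialFun (f : ℕ → ℕ) : Prop := ∃ p : Polynomial ℕ, ∀ w, p.eval w = f w

theorem IsPolynomialFun.id : IsPolynomialFun (fun w => w) := ⟨Polynomial.X, fun _ => by simp⟩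

theorem IsPolynomialFun.const (c : ℕ) : IsPolynomialFun (fun _ => c) :=
  ⟨Polynomial.C c, fun _ => by simp⟩

theorem IsPolynomialFun.add {f g : ℕ → ℕ} (hf : IsPolynomialFun f) (hg : IsPolynomialFun g) :
    IsPolynomialFun (fun w => f w + g w) := by
  obtain ⟨p, hp⟩ := hf
  obtain ⟨p', hp'⟩ := hg
  exact ⟨p + p', fun w => by rw [Polynomial.eval_add, hp, hp']⟩

theorem IsPolynomialFun.mul {f g : ℕ → ℕ} (hf : IsPolynomialFun f) (hg : IsPolynomialFun g) :
    IsPolynomialFun (fun w => f w * g w) := by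
  obtain ⟨p, hp⟩ := hf
  obtain ⟨p', hp'⟩ := hg
  exact ⟨p * p', fun w => by rw [Polynomial.eval_mul, hp, hp']⟩

theorem eval_le_eval_of_le (q : Polynomial ℕ) {a b : ℕ} (h : a ≤ b) : q.eval a ≤ q.eval b := by
  rw [Polynomial.eval_eq_sum, Polynomial.eval_eq_sum]
  exact Finset.sum_le_sum fun i _ =>
    Nat.mul_le_mul_left _ (Nat.pow_le_pow_left h i)

/-- A bound for the additional factor. -/
def overheadTime (n m m' B : ℕ) : ℕ :=
  8 * (m * n) + 8 + 1 + finishTime n m m' B + (55 + 25 * B)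

theorem overheadTime_mono {n m m' B w : ℕ} (hn : n ≤ w) (hm : m ≤ w) (hm' : m' ≤ w) (hB : B ≤ w) :
    overheadTime n m m' B ≤ overheadTime w w w w := by
  unfold overheadTime finishTime prepareTime passTime extendTime quotientTime circuitTime
    chainTime permsTime siftTime
  gcongr

theorem isPolynomialFun_overheadTime : IsPolynomialFun (fun w => overheadTime w w w w) := by
  unfold overheadTime finishTime prepareTime passTime extendTime quotientTime circuitTime
    chainTime permsTime siftTime
  repeat' first
    | exact IsPolynomialFun.id
    | exact IsPolynomialFun.const _
    | apply IsPolynomialFun.add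
    | apply IsPolynomialFun.mul

theorem mainTheorem8 (q : Polynomial ℕ) :
    ∃ p : Polynomial ℕ,
      ∀ (𝓗 : (n : ℕ) → Set (List (Equiv.Perm (Fin n))))
        (t : (n : ℕ) → List (Equiv.Perm (Fin n)) → ℕ) (A : RamProg),
        (∀ n : ℕ, 0 < n → ∀ S ∈ 𝓗 n, S.length ≤ q.eval n → ComputesSB A S (t n S)) →
        ∃ B : RamProg, ∀ n : ℕ, 0 < n → ∀ S ∈ 𝓗 n, S.length ≤ q.eval n →
          ∀ T : List (Equiv.Perm (Fin n)), T.length ≤ q.eval n →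
            generatedGroup S ≤ generatedGroup T →
            ComputesSBWithAdditional B S T
              (t n S * p.eval (n * (generatedGroup S).relIndex (generatedGroup T))) := by
  obtain ⟨p, hp⟩ := isPolynomialFun_overheadTime
  -- With `w = n |G:H|`, the degree, the index and the lengths of both lists are all at most `w +
  -- q(w)`. The overhead does not depend on `A`, so the polynomial is fixed in advance.
  refine ⟨p.comp (Polynomial.X + q), fun 𝓗 t A hA => ⟨overgroupProg A, ?_⟩⟩
  intro n hn S hS hSq T hTq hST
  obtain ⟨k, s, m, C, hrun, hk, hs, hC⟩ := overgroupProg_computes hn (hA n hn S hS hSq) hST rfl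
  refine ⟨k, s, m, C, hrun, hk.trans (Nat.mul_le_mul_left _ ?_), hs, hC⟩
  set B := (generatedGroup S).relIndex (generatedGroup T)
  -- `relIndex` would be `0` for infinite index; finiteness excludes this, which gives `n ≤ n * B`.
  have hB : 0 < B := Nat.pos_of_ne_zero Subgroup.index_ne_zero_of_finite
  have hnB : n ≤ n * B := Nat.le_mul_of_pos_right n hB
  have hBn : B ≤ n * B := Nat.le_mul_of_pos_left B hn
  have hq := eval_le_eval_of_le q hnB
  rw [Polynomial.eval_comp, Polynomial.eval_add, Polynomial.eval_X, hp]
  exact overheadTime_mono (by omega) (by omega) (by omega) (by omega)
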